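/- Let $g\in\{\delta,\eta\}$ be the Euclidean metric or the Minkowski metric $\eta=\mathrm{diag}(1,-1,\dots,-1)$ on $\mathbb{R}^d$, and let $E$ be any one of the spaces $C^1_0([0,1],\mathbb{R}^d)$, $W^{1,1}_0([0,1],\mathbb{R}^d)$, $W^{1,2}_0([0,1],\mathbb{R}^d)$ of curves $\sigma$ with $\sigma(0)=0$ that are, respectively, of class $C^1$ (with the $C^1$ norm), or absolutely continuous with $\dot\sigma\in L_p$, $p=1,2$ (with the norm $\|\dot\sigma\|_{L_p}$). Let $E_0=\{u\in E: u(1)=0\}$. Repeated indices are summed. Lévy trace. Let $V$ be a finite-dimensional normed space. A continuous bilinear map $Q:E\times E\to V$ is in the domain of $\mathrm{tr}^g_L$ if for all $u,v\in E_0$ $$Q(u,v)=\int_0^1\!\!\int_0^1 Q^V_{\mu\nu}(t,s)u^\mu(t)v^\nu(s)\,dt\,ds+\int_0^1 Q^L_{\mu\nu}(t)u^\mu(t)v^\nu(t)\,dt+\tfrac12\int_0^1 Q^S_{\mu\nu}(t)\bigl(\dot u^\mu(t)v^\nu(t)+\dot v^\mu(t)u^\nu(t)\bigr)dt$$ with $V$-valued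 kernels $Q^V_{\mu\nu}\in L_1([0,1]^2)$, $Q^L_{\mu\nu}=Q^L_{\nu\mu}\in L_1[0,1]$, $Q^S_{\mu\nu}=-Q^S_{\nu\mu}\in L_\infty[0,1]$; then $\mathrm{tr}^g_L Q=\int_0^1 g^{\mu\nu}Q^L_{\mu\nu}(t)\,dt$. The domain of $D^2_{\mathrm{tr}^g_L}$ consists of the $f\in C^2(E,V)$ (in the Fréchet sense) whose second derivatives $f''(\sigma)$ are all in the domain of $\mathrm{tr}^g_L$, and $D^2_{\mathrm{tr}^g_L}f(\sigma)=\mathrm{tr}^g_L f''(\sigma)$. Connections. Let $G$ be a closed subgroup of $U(N)$ with Lie algebra $\mathrm{Lie}(G)\subset u(N)$, let $A=A_\mu dx^\mu$ be a $\mathrm{Lie}(G)$-valued $C^\infty$ 1-form on $\mathbb{R}^d$, let $F_{\mu\nu}=\partial_\mu A_\nu-\partial_\nu A_\mu+[A_\mu,A_\nu]$ be its curvature, and $\nabla_\mu\varphi=\partial_\mu\varphi+[A_\mu,\varphi]$. For $\sigma\in E$ and $0\le s\le t\le 1$ let $U_{t,s}=U^A_{t,s}(\sigma)$ be the solution of $$\tfrac{d}{dt}U_{t,s}=-A_\mu(\sigma(t))\dot\sigma^\mu(t)U_{t,s},\qquad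 \tfrac{d}{ds}U_{t,s}=U_{t,s}A_\mu(\sigma(s))\dot\sigma^\mu(s),\qquad U_{s,s}=I_N$$ (in the integral, Carathéodory sense), and let $U_{s,t}=U_{t,s}^{-1}$. Let $j=j_\nu dx^\nu$ be a continuous $M_N(\mathbb{C})$-valued 1-form on $\mathbb{R}^d$ (the current). Theorem. The function $U^A_{1,0}:E\to M_N(\mathbb{C})$ is in the domain of $D^2_{\mathrm{tr}^g_L}$, and the following two assertions are equivalent: 1. $A$ solves the Yang–Mills equations with current $j$: $g^{\lambda\mu}\nabla_\lambda F_{\mu\nu}=j_\nu$ on $\mathbb{R}^d$ for all $\nu$; 2. for all $\sigma\in E$, $$D^2_{\mathrm{tr}^g_L}U^A_{1,0}(\sigma)=-\int_0^1 U^A_{1,t}(\sigma)\,j_\nu(\sigma(t))\,\dot\sigma^\nu(t)\,U^A_{t,0}(\sigma)\,dt .$$ -/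

import Mathlib

open MeasureTheory Set
open scoped ContDiff Matrix Matrix.Norms.Operator

noncomputable section

namespace LevyYM

/-! ### Spaces of curves -/

/-- The base space `ℝ^d`. -/
abbrev Vec (d : ℕ) : Type := EuclideanSpace ℝ (Fin d)

/-- The parameter interval `[0,1]` with Lebesgue measure. -/
abbrev vol01 : Measure ℝ := volume.restrict (Icc (0 : ℝ) 1)

/-- A curve on `[0,1]` viewed as a function of a real parameter (constant outside `[0,1]`). -/
def ext {d : ℕ} (σ : C(unitInterval, Vec d)) : ℝ → Vec d :=
  Set.IccExtend (zero_le_one' ℝ) σ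

/-- The derivative of a curve with respect to its parameter `t ∈ [0,1]` (one-sided at the two end
points). -/
def velocity {d : ℕ} (γ : ℝ → Vec d) (t : ℝ) : Vec d := derivWithin γ (Icc (0 : ℝ) 1) t

lemma ext_add {d : ℕ} (σ τ : C(unitInterval, Vec d)) : ext (σ + τ) = ext σ + ext τ := rfl

lemma ext_smul {d : ℕ} (c : ℝ) (σ : C(unitInterval, Vec d)) : ext (c • σ) = c • ext σ := rfl

lemma ext_zero {d : ℕ} : ext (0 : C(unitInterval, Vec d)) = 0 := rfl

lemma ext_apply {d : ℕ} (σ : C(unitInterval, Vec d)) (t : unitInterval) : ext σ t = σ t := by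
  simp [ext]

lemma velocity_zero {d : ℕ} : velocity (0 : ℝ → Vec d) = 0 := by
  funext t
  simp [velocity]

lemma velocity_smul {d : ℕ} (c : ℝ) (γ : ℝ → Vec d) : velocity (c • γ) = c • velocity γ := by
  funext t
  exact derivWithin_const_smul_field c γ

lemma ae_differentiableWithinAt {d : ℕ} {γ : ℝ → Vec d}
    (h : AbsolutelyContinuousOnInterval γ 0 1) :
    ∀ᵐ t ∂vol01, DifferentiableWithinAt ℝ γ (Icc (0 : ℝ) 1) t := by
  have h1 := h.boundedVariationOn
  rw [uIcc_of_le zero_le_one] at h1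
  exact (ae_restrict_iff' measurableSet_Icc).2
    h1.locallyBoundedVariationOn.ae_differentiableWithinAt_of_mem

lemma velocity_add_ae {d : ℕ} {γ δ : ℝ → Vec d}
    (hγ : AbsolutelyContinuousOnInterval γ 0 1) (hδ : AbsolutelyContinuousOnInterval δ 0 1) :
    velocity (γ + δ) =ᵐ[vol01] velocity γ + velocity δ := by
  filter_upwards [ae_differentiableWithinAt hγ, ae_differentiableWithinAt hδ] with t h1 h2
  exact derivWithin_add h1 h2

/-- The curves of class `C^1` on `[0,1]` that start at the origin. -/
def C1Sub (d : ℕ) : Submodule ℝ C(unitInterval, Vec d) where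
  carrier := {σ | ContDiffOn ℝ 1 (ext σ) (Icc (0 : ℝ) 1) ∧ σ 0 = 0}
  add_mem' := by
    rintro σ τ ⟨h1, h2⟩ ⟨h3, h4⟩
    exact ⟨by rw [ext_add]; exact h1.add h3, by simp [h2, h4]⟩
  zero_mem' := ⟨by rw [ext_zero]; exact contDiffOn_const, rfl⟩
  smul_mem' := by
    rintro c σ ⟨h1, h2⟩
    exact ⟨by rw [ext_smul]; exact contDiffOn_const.smul h1, by simp [h2]⟩

/-- The absolutely continuous curves on `[0,1]` that start at the origin and whose derivative is in
`L_p`. -/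
def WSub (p : ENNReal) (d : ℕ) : Submodule ℝ C(unitInterval, Vec d) where
  carrier := {σ | AbsolutelyContinuousOnInterval (ext σ) 0 1 ∧ σ 0 = 0 ∧
    MemLp (velocity (ext σ)) p vol01}
  add_mem' := by
    rintro σ τ ⟨h1, h2, h3⟩ ⟨h4, h5, h6⟩
    exact ⟨by rw [ext_add]; exact h1.add h4, by simp [h2, h5],
      by rw [ext_add]; exact (h3.add h6).ae_eq (velocity_add_ae h1 h4).symm⟩
  zero_mem' := by
    refine ⟨?_, rfl, by rw [ext_zero, velocity_zero]; exact MemLp.zero⟩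
    rw [ext_zero]
    exact (LipschitzWith.const (0 : Vec d)).lipschitzOnWith.absolutelyContinuousOnInterval
  smul_mem' := by
    rintro c σ ⟨h1, h2, h3⟩
    exact ⟨by rw [ext_smul]; exact h1.const_smul c, by simp [h2],
      by rw [ext_smul, velocity_smul]; exact h3.const_smul c⟩

/-- The space `C^1_0([0,1], ℝ^d)`; its norm is defined below. -/
def C10 (d : ℕ) : Type := C1Sub d

/-- The space `W^{1,p}_0([0,1], ℝ^d)`; its norm is defined below. -/
def W10 (p : ENNReal) (d : ℕ) : Type := WSub p d

instance (d : ℕ) : AddCommGroup (C10 d) := inferInstanceAs (AddCommGroup (C1Sub d))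
instance (d : ℕ) : Module ℝ (C10 d) := inferInstanceAs (Module ℝ (C1Sub d))
instance (p : ENNReal) (d : ℕ) : AddCommGroup (W10 p d) := inferInstanceAs (AddCommGroup (WSub p d))
instance (p : ENNReal) (d : ℕ) : Module ℝ (W10 p d) := inferInstanceAs (Module ℝ (WSub p d))

/-- The curve `t ↦ σ(t)` of an element of `C^1_0`. -/
def C10.path {d : ℕ} (σ : C10 d) : ℝ → Vec d := ext σ.1

/-- The curve `t ↦ σ(t)` of an element of `W^{1,p}_0`. -/
def W10.path {p : ENNReal} {d : ℕ} (σ : W10 p d) : ℝ → Vec d := ext σ.1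

/-- The derivative of an element of `C^1_0`, as a continuous function on `[0,1]`. -/
def C10.vel {d : ℕ} (σ : C10 d) : C(unitInterval, Vec d) where
  toFun t := velocity σ.path t
  continuous_toFun :=
    (σ.2.1.continuousOn_derivWithin (uniqueDiffOn_Icc zero_lt_one) le_rfl).domRestrict

/-- The linear embedding `σ ↦ (σ, σ')` of `C^1_0` that defines its norm. -/
def C10.embed (d : ℕ) : C10 d →ₗ[ℝ] C(unitInterval, Vec d) × C(unitInterval, Vec d) where
  toFun σ := (σ.1, σ.vel)
  map_add' σ τ := by
    refine Prod.ext rfl (ContinuousMap.ext fun t => ?_)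
    exact derivWithin_add (σ.2.1.differentiableOn one_ne_zero t t.2)
      (τ.2.1.differentiableOn one_ne_zero t t.2)
  map_smul' c σ := by
    refine Prod.ext rfl (ContinuousMap.ext fun t => ?_)
    exact congrFun (velocity_smul c σ.path) t

lemma C10.embed_injective (d : ℕ) : Function.Injective (C10.embed d) := fun _ _ h =>
  Subtype.ext (congrArg Prod.fst h)

/-- The `C^1` norm `max (sup |σ|) (sup |σ'|)`. -/
instance (d : ℕ) : NormedAddCommGroup (C10 d) :=
  NormedAddCommGroup.induced (C10 d) _ (C10.embed d) (C10.embed_injective d)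

instance (d : ℕ) : NormedSpace ℝ (C10 d) := NormedSpace.induced ℝ (C10 d) _ (C10.embed d)

lemma W10.ac {p : ENNReal} {d : ℕ} (σ : W10 p d) : AbsolutelyContinuousOnInterval σ.path 0 1 :=
  σ.2.1

lemma W10.memLp {p : ENNReal} {d : ℕ} (σ : W10 p d) : MemLp (velocity σ.path) p vol01 := σ.2.2.2

lemma W10.velocity_add {p : ENNReal} {d : ℕ} (σ τ : W10 p d) :
    velocity (σ + τ).path =ᵐ[vol01] velocity σ.path + velocity τ.path :=
  velocity_add_ae σ.ac τ.ac

lemma W10.velocity_smul {p : ENNReal} {d : ℕ} (c : ℝ) (σ : W10 p d) :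
    velocity (c • σ).path = c • velocity σ.path :=
  LevyYM.velocity_smul c σ.path

/-- The derivative of an element of `W^{1,p}_0`, as an element of `L_p`. -/
def W10.embed (p : ENNReal) (d : ℕ) : W10 p d →ₗ[ℝ] Lp (Vec d) p vol01 where
  toFun σ := σ.memLp.toLp (velocity σ.path)
  map_add' σ τ := by
    rw [← MemLp.toLp_add]
    exact MemLp.toLp_congr _ _ (W10.velocity_add σ τ)
  map_smul' c σ := by
    rw [RingHom.id_apply, ← MemLp.toLp_const_smul]
    exact MemLp.toLp_congr _ _ (Filter.EventuallyEq.of_eq (W10.velocity_smul c σ))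

lemma W10.embed_injective (p : ENNReal) (d : ℕ) : Function.Injective (W10.embed p d) := by
  rw [← LinearMap.ker_eq_bot, LinearMap.ker_eq_bot']
  intro σ hσ
  have h0 : velocity σ.path =ᵐ[vol01] 0 :=
    σ.memLp.coeFn_toLp.symm.trans ((Lp.eq_zero_iff_ae_eq_zero (f := W10.embed p d σ)).1 hσ)
  have hac : AbsolutelyContinuousOnInterval σ.path 0 1 := σ.2.1
  have hd : ∀ᵐ t ∂(volume : Measure ℝ), t ∈ uIcc (0 : ℝ) 1 → HasDerivAt σ.path 0 t := by
    have h1 := (ae_restrict_iff' measurableSet_Icc).1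
      (h0.and (ae_differentiableWithinAt hac))
    have h2 : ∀ᵐ t ∂(volume : Measure ℝ), t ≠ 0 := by simp [ae_iff]
    have h3 : ∀ᵐ t ∂(volume : Measure ℝ), t ≠ 1 := by simp [ae_iff]
    filter_upwards [h1, h2, h3] with t ht ht0 ht1 hmem
    rw [uIcc_of_le zero_le_one] at hmem
    obtain ⟨hz, hdiff⟩ := ht hmem
    have hnhds : Icc (0 : ℝ) 1 ∈ nhds t :=
      Icc_mem_nhds (lt_of_le_of_ne hmem.1 ht0.symm) (lt_of_le_of_ne hmem.2 ht1)
    have := hdiff.hasDerivWithinAt.hasDerivAt hnhds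
    have hz' : derivWithin σ.path (Icc (0 : ℝ) 1) t = 0 := hz
    rwa [← hz']
  obtain ⟨c, hc⟩ := hac.const_of_ae_hasDerivAt_zero hd
  refine Subtype.ext (ContinuousMap.ext fun t => ?_)
  have hc' : ∀ s : unitInterval, σ.1 s = c := fun s => by
    rw [← ext_apply]
    exact hc s (by rw [uIcc_of_le zero_le_one]; exact s.2)
  change σ.1 t = 0
  rw [hc' t, ← hc' 0]
  exact σ.2.2.1

/-- The norm `‖σ'‖_{L_p}` of `W^{1,p}_0`. -/
instance (p : ENNReal) [Fact (1 ≤ p)] (d : ℕ) : NormedAddCommGroup (W10 p d) :=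
  NormedAddCommGroup.induced (W10 p d) _ (W10.embed p d) (W10.embed_injective p d)

instance (p : ENNReal) [Fact (1 ≤ p)] (d : ℕ) : NormedSpace ℝ (W10 p d) :=
  NormedSpace.induced ℝ (W10 p d) _ (W10.embed p d)

/-! ### The Lévy trace and the associated second-order operator

In this part `E` is a normed space of curves in `ℝ^d` on `[0,1]`; `path σ` is the curve of
`σ : E`. -/

section Levy

variable {d : ℕ} {E V : Type*} [NormedAddCommGroup E] [NormedSpace ℝ E]
  [NormedAddCommGroup V] [NormedSpace ℝ V]

/-- `KV`, `KL`, `KS` are the Volterra, Lévy and singular kernels of the continuous bilinear map `Q`: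
they represent `Q` on the pairs of curves that vanish at both ends. -/
structure IsKernelRep (path : E → ℝ → Vec d) (Q : E →L[ℝ] E →L[ℝ] V)
    (KV : Fin d → Fin d → ℝ × ℝ → V) (KL KS : Fin d → Fin d → ℝ → V) : Prop where
  integrable_volterra : ∀ μ ν, Integrable (KV μ ν) (vol01.prod vol01)
  integrable_levy : ∀ μ ν, Integrable (KL μ ν) vol01
  bounded_singular : ∀ μ ν, MemLp (KS μ ν) ⊤ vol01
  symm_levy : ∀ μ ν, KL μ ν =ᵐ[vol01] KL ν μ
  antisymm_singular : ∀ μ ν, KS μ ν =ᵐ[vol01] -KS ν μ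
  repr : ∀ u v : E, path u 1 = 0 → path v 1 = 0 →
    Q u v =
      (∫ z, ∑ μ, ∑ ν, (path u z.1 μ * path v z.2 ν) • KV μ ν z ∂(vol01.prod vol01))
      + (∫ t, ∑ μ, ∑ ν, (path u t μ * path v t ν) • KL μ ν t ∂vol01)
      + (1 / 2 : ℝ) • ∫ t, ∑ μ, ∑ ν,
          (velocity (path u) t μ * path v t ν + velocity (path v) t μ * path u t ν) • KS μ ν t
          ∂vol01

/-- `Q` belongs to the domain of the Lévy trace `tr_L^g` and `tr_L^g Q = c`. The upper-index metric
`g^{μν}` is the inverse matrix of `g`. For the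
three spaces of curves above the value `c` does not depend on the choice of the kernels. -/
def HasLevyTrace (g : Matrix (Fin d) (Fin d) ℝ) (path : E → ℝ → Vec d)
    (Q : E →L[ℝ] E →L[ℝ] V) (c : V) : Prop :=
  ∃ KV KL KS, IsKernelRep path Q KV KL KS ∧ c = ∫ t, ∑ μ, ∑ ν, g⁻¹ μ ν • KL μ ν t ∂vol01

/-- The second Fréchet derivative of `f` at `σ`. -/
def secondDeriv (f : E → V) (σ : E) : E →L[ℝ] E →L[ℝ] V := fderiv ℝ (fderiv ℝ f) σ

/-- `f` belongs to the domain of the operator `D^2_{tr_L^g}`: it is twice continuously Fréchet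
differentiable and all its second derivatives are in the domain of the Lévy trace. -/
def InLevyDomain (g : Matrix (Fin d) (Fin d) ℝ) (path : E → ℝ → Vec d) (f : E → V) : Prop :=
  ContDiff ℝ 2 f ∧ ∀ σ, ∃ c, HasLevyTrace g path (secondDeriv f σ) c

/-- `f` belongs to the domain of the operator `D^2_{tr_L^g}` and `D^2_{tr_L^g} f = h`. -/
def HasLevyD2 (g : Matrix (Fin d) (Fin d) ℝ) (path : E → ℝ → Vec d) (f h : E → V) : Prop :=
  ContDiff ℝ 2 f ∧ ∀ σ, HasLevyTrace g path (secondDeriv f σ) (h σ)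

end Levy

/-- The Minkowski metric `diag(1, -1, …, -1)` on `ℝ^d`. -/
def minkowski (d : ℕ) : Matrix (Fin d) (Fin d) ℝ :=
  Matrix.diagonal fun μ => if (μ : ℕ) = 0 then 1 else -1

/-! ### Connections and the Yang–Mills equations -/

section Gauge

variable {d N : ℕ}

/-- The Lie algebra of a closed subgroup `G` of `U(N)`, as a set of matrices. -/
def lieAlg (G : Subgroup (Matrix.unitaryGroup (Fin N) ℂ)) : Set (Matrix (Fin N) (Fin N) ℂ) :=
  {X | ∀ t : ℝ, ∃ a ∈ G, (a : Matrix (Fin N) (Fin N) ℂ) = NormedSpace.exp (t • X)}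

/-- A `C^∞` connection form `A_μ dx^μ` on `ℝ^d` with values in the Lie algebra of `G`; the value of
`A_μ` at `x` is `A.form x μ`. -/
structure Connection (d : ℕ) (G : Subgroup (Matrix.unitaryGroup (Fin N) ℂ)) where
  form : Vec d → Fin d → Matrix (Fin N) (Fin N) ℂ
  smooth : ∀ μ, ContDiff ℝ ∞ fun x => form x μ
  mem_lieAlg : ∀ x μ, form x μ ∈ lieAlg G

/-- The partial derivative `∂_μ φ`. -/
def partialD (μ : Fin d) (φ : Vec d → Matrix (Fin N) (Fin N) ℂ) (x : Vec d) :
    Matrix (Fin N) (Fin N) ℂ :=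
  fderiv ℝ φ x (EuclideanSpace.single μ 1)

variable {G : Subgroup (Matrix.unitaryGroup (Fin N) ℂ)}

/-- The covariant derivative `∇_μ φ = ∂_μ φ + [A_μ, φ]`. -/
def covD (A : Connection d G) (μ : Fin d) (φ : Vec d → Matrix (Fin N) (Fin N) ℂ) (x : Vec d) :
    Matrix (Fin N) (Fin N) ℂ :=
  partialD μ φ x + (A.form x μ * φ x - φ x * A.form x μ)

/-- The curvature `F_{μν} = ∂_μ A_ν - ∂_ν A_μ + [A_μ, A_ν]`. -/
def curvature (A : Connection d G) (μ ν : Fin d) (x : Vec d) : Matrix (Fin N) (Fin N) ℂ :=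
  partialD μ (fun y => A.form y ν) x - partialD ν (fun y => A.form y μ) x
    + (A.form x μ * A.form x ν - A.form x ν * A.form x μ)

/-- The Yang–Mills equations `g^{λμ} ∇_λ F_{μν} = j_ν` with current `j`. -/
def YangMills (g : Matrix (Fin d) (Fin d) ℝ) (A : Connection d G)
    (j : Vec d → Fin d → Matrix (Fin N) (Fin N) ℂ) : Prop :=
  ∀ x ν, ∑ l, ∑ μ, g⁻¹ l μ • covD A l (curvature A μ ν) x = j x ν

/-! ### Parallel transport -/

/-- The contraction `B_ν(γ(t)) γ'^ν(t)` of a matrix-valued 1-form with the velocity of a curve. -/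
def along (B : Vec d → Fin d → Matrix (Fin N) (Fin N) ℂ) (γ : ℝ → Vec d) (t : ℝ) :
    Matrix (Fin N) (Fin N) ℂ :=
  ∑ ν, velocity γ t ν • B (γ t) ν

/-- `U t s = U_{t,s}` is the evolution family of the connection along the curve `γ`: for
`0 ≤ s ≤ t ≤ 1` it solves `d/dt U_{t,s} = -A_μ(γ(t)) γ'^μ(t) U_{t,s}` and
`d/ds U_{t,s} = U_{t,s} A_μ(γ(s)) γ'^μ(s)` with `U_{s,s} = 1`, and `U_{s,t} = U_{t,s}⁻¹`. The
velocity is only integrable, so the equations are understood in the sense of Carathéodory, that is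
as integral equations for continuous functions. -/
structure IsTransport (A : Connection d G) (γ : ℝ → Vec d)
    (U : ℝ → ℝ → Matrix (Fin N) (Fin N) ℂ) : Prop where
  continuous_left : ∀ s ∈ Icc (0 : ℝ) 1, ContinuousOn (fun t => U t s) (Icc s 1)
  continuous_right : ∀ t ∈ Icc (0 : ℝ) 1, ContinuousOn (fun s => U t s) (Icc 0 t)
  forward : ∀ s ∈ Icc (0 : ℝ) 1, ∀ t ∈ Icc s 1,
    U t s = 1 - ∫ r in s..t, along A.form γ r * U r s
  backward : ∀ t ∈ Icc (0 : ℝ) 1, ∀ s ∈ Icc 0 t,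
    U t s = 1 - ∫ r in s..t, U t r * along A.form γ r
  inverse : ∀ s ∈ Icc (0 : ℝ) 1, ∀ t ∈ Icc s 1, U s t = (U t s)⁻¹

open Classical in
/-- The evolution family `U^A_{t,s}` along the curve `γ`, the solution of the equations above
(which is unique for `s, t ∈ [0,1]`). -/
def transport (A : Connection d G) (γ : ℝ → Vec d) : ℝ → ℝ → Matrix (Fin N) (Fin N) ℂ :=
  if h : ∃ U, IsTransport A γ U then h.choose else fun _ _ => 1

/-- The integral `-∫_0^1 U_{1,t} j_ν(γ(t)) γ'^ν(t) U_{t,0} dt`. -/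
def currentIntegral (A : Connection d G) (j : Vec d → Fin d → Matrix (Fin N) (Fin N) ℂ)
    (γ : ℝ → Vec d) : Matrix (Fin N) (Fin N) ℂ :=
  -∫ t in (0 : ℝ)..1, transport A γ 1 t * along j γ t * transport A γ t 0

end Gauge

end LevyYM

end

noncomputable section

namespace LevyYM

/-! ### Primitives of integrable functions -/

section Primitive

variable {F F₁ F₂ F₃ : Type*} [NormedAddCommGroup F] [NormedSpace ℝ F]
  [NormedAddCommGroup F₁] [NormedSpace ℝ F₁] [NormedAddCommGroup F₂] [NormedSpace ℝ F₂]
  [NormedAddCommGroup F₃] [NormedSpace ℝ F₃]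

/-! Everything is pulled back to velocities. A curve in any of the three spaces is the primitive of
its velocity `x`, an element of `L_1`, and `x` depends linearly and continuously on the curve
(`IsVelocityMap`). Hence `U_{1,0}` is `holonomy` composed with a continuous linear map, and the
calculus can be done once, on `L_1`. With `b = A(γ)γ'`, the equation `P' = -bP`, `P(0) = 1` reads
`(1 + V_b) P = 1` for the Volterra operator `V_b`. It is quasinilpotent, so `1 + V_b` is invertible;
inversion and superposition are smooth, so the holonomy is twice continuously differentiable, and
its second derivative is a sum of iterated integrals (`secondDeriv_holonomy`).

Let `Q = P⁻¹`. Conjugation turns ordinary derivatives into covariant ones: `(Q M P)' = Q (M' + [b,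
M]) P`. Integrating by parts, for variations that vanish at both ends, replaces the potentials by
the curvature `F` (`second_variation`). What remains has a Volterra kernel made of products of two
terms `F(e_μ, γ')`, a Lévy kernel `-(1/2)(∇_μ F_{νρ} + ∇_ν F_{μρ}) γ'^ρ` and a singular kernel
`F_{μν}`, all conjugated by the transport (`isKernelRep_holonomy`). Contracting the Lévy kernel with
the symmetric `g^{μν}` gives `-∫ U_{1,t} (g^{λμ} ∇_λ F_{μν}) γ'^ν U_{t,0} dt`
(`hasLevyTrace_transport`). This proves membership in the domain, and the Yang–Mills equations then
give the second assertion.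

For the converse two facts are needed. The trace does not depend on the kernels: on `u_n = sin(nπt)
e_κ` the singular term vanishes by antisymmetry, the Volterra term tends to zero by
Riemann–Lebesgue, and the Lévy term tends to half the integral of its diagonal entry
(`HasLevyTrace.unique`). A continuous 1-form `J` with `∫ U_{1,t} J(γ') U_{t,0} dt = 0` on all curves
vanishes: applied to `t ↦ γ(rt)`, the hypothesis says that a primitive is zero for all `r`, and its
derivative at `r = 1` gives `J` at the end point on the final velocity, both of which are arbitrary
(`eq_zero_of_integral_eq_zero`). Take `J` to be the difference of the two sides of the Yang–Mills
equations. -/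

/-- `X` is on `[a,b]` a primitive of the integrable function `x`. -/
structure IsPrimitiveOn (a b : ℝ) (X x : ℝ → F) : Prop where
  intervalIntegrable : IntervalIntegrable x volume a b
  eq_add : ∀ t ∈ Icc a b, X t = X a + ∫ r in a..t, x r

namespace IsPrimitiveOn

variable {a b : ℝ} {X x Y y : ℝ → F}

lemma intervalIntegrable_sub (h : IsPrimitiveOn a b X x) {s t : ℝ} (hs : s ∈ Icc a b)
    (ht : t ∈ Icc a b) : IntervalIntegrable x volume s t :=
  h.intervalIntegrable.mono_set (by
    rw [uIcc_of_le (hs.1.trans hs.2)]; exact uIcc_subset_Icc hs ht)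

lemma sub_eq (h : IsPrimitiveOn a b X x) {s t : ℝ} (hs : s ∈ Icc a b)
    (ht : t ∈ Icc a b) : X t - X s = ∫ r in s..t, x r := by
  have ha : a ∈ Icc a b := left_mem_Icc.2 (hs.1.trans hs.2)
  rw [h.eq_add t ht, h.eq_add s hs, add_sub_add_left_eq_sub,
    intervalIntegral.integral_interval_sub_left (h.intervalIntegrable_sub ha ht)
      (h.intervalIntegrable_sub ha hs)]

lemma mono (h : IsPrimitiveOn a b X x) {s t : ℝ} (hs : s ∈ Icc a b) (ht : t ∈ Icc a b) :
    IsPrimitiveOn s t X x where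
  intervalIntegrable := h.intervalIntegrable_sub hs ht
  eq_add r hr := by
    rw [← h.sub_eq hs ⟨hs.1.trans hr.1, hr.2.trans ht.2⟩, add_sub_cancel]

lemma continuousOn (h : IsPrimitiveOn a b X x) : ContinuousOn X (Icc a b) := by
  by_cases hab : a ≤ b
  · have := intervalIntegral.continuousOn_primitive_interval'
      h.intervalIntegrable left_mem_uIcc
    rw [uIcc_of_le hab] at this
    exact (continuousOn_const.add this).congr h.eq_add
  · simp [Icc_eq_empty hab]

lemma congr_ae (hab : a ≤ b) (h : IsPrimitiveOn a b X x)
    (hxy : x =ᵐ[volume.restrict (Icc a b)] y) : IsPrimitiveOn a b X y := by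
  have h1 : ∀ᵐ r, r ∈ Icc a b → x r = y r := (ae_restrict_iff' measurableSet_Icc).1 hxy
  refine ⟨h.intervalIntegrable.congr_ae (ae_restrict_of_ae_restrict_of_subset
    (by rw [uIoc_of_le hab]; exact Ioc_subset_Icc_self) hxy), fun t ht => ?_⟩
  rw [h.eq_add t ht]
  congr 1
  refine intervalIntegral.integral_congr_ae ?_
  filter_upwards [h1] with r hr hrt
  rw [uIoc_of_le ht.1] at hrt
  exact hr ⟨hrt.1.le, hrt.2.trans ht.2⟩

lemma congr_left (h : IsPrimitiveOn a b X x) (hXY : EqOn X Y (Icc a b)) :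
    IsPrimitiveOn a b Y x := by
  refine ⟨h.intervalIntegrable, fun t ht => ?_⟩
  rw [← hXY ht, ← hXY (left_mem_Icc.2 (ht.1.trans ht.2)), h.eq_add t ht]

lemma add (h : IsPrimitiveOn a b X x) (h' : IsPrimitiveOn a b Y y) :
    IsPrimitiveOn a b (fun t => X t + Y t) (fun t => x t + y t) := by
  refine ⟨h.intervalIntegrable.add h'.intervalIntegrable, fun t ht => ?_⟩
  have ha : a ∈ Icc a b := left_mem_Icc.2 (ht.1.trans ht.2)
  rw [intervalIntegral.integral_add (h.intervalIntegrable_sub ha ht)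
    (h'.intervalIntegrable_sub ha ht), h.eq_add t ht, h'.eq_add t ht]
  abel

lemma const (c : F) : IsPrimitiveOn a b (fun _ => c) (fun _ => 0) :=
  ⟨by simp, fun t _ => by simp⟩

lemma neg (h : IsPrimitiveOn a b X x) : IsPrimitiveOn a b (fun t => -X t) (fun t => -x t) := by
  refine ⟨h.intervalIntegrable.neg, fun t ht => ?_⟩
  rw [intervalIntegral.integral_neg, h.eq_add t ht]
  abel

lemma const_smul (c : ℝ) (h : IsPrimitiveOn a b X x) :
    IsPrimitiveOn a b (fun t => c • X t) (fun t => c • x t) := by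
  refine ⟨h.intervalIntegrable.smul c, fun t ht => ?_⟩
  rw [intervalIntegral.integral_smul, h.eq_add t ht, smul_add]

lemma norm_sub_le (h : IsPrimitiveOn a b X x) {s t : ℝ} (hs : s ∈ Icc a b)
    (ht : t ∈ Icc a b) (hst : s ≤ t) : ‖X t - X s‖ ≤ ∫ r in s..t, ‖x r‖ := by
  rw [h.sub_eq hs ht]
  exact intervalIntegral.norm_integral_le_integral_norm hst

lemma ae_hasDerivAt [CompleteSpace F] (hab : a ≤ b) (h : IsPrimitiveOn a b X x) :
    ∀ᵐ t ∂volume.restrict (Icc a b), HasDerivAt X (x t) t := by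
  have h1 := h.intervalIntegrable.ae_hasDerivAt_integral
  have h2 : ∀ᵐ t ∂(volume : Measure ℝ), t ≠ a := by simp [ae_iff]
  have h3 : ∀ᵐ t ∂(volume : Measure ℝ), t ≠ b := by simp [ae_iff]
  rw [ae_restrict_iff' measurableSet_Icc]
  filter_upwards [h1, h2, h3] with t ht ht0 ht1 hmem
  have hnhds : Icc a b ∈ nhds t :=
    Icc_mem_nhds (lt_of_le_of_ne hmem.1 ht0.symm) (lt_of_le_of_ne hmem.2 ht1)
  have := (ht (by rwa [uIcc_of_le hab]) a left_mem_uIcc).const_add (X a)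
  refine this.congr_of_eventuallyEq ?_
  filter_upwards [hnhds] with r hr using h.eq_add r hr

end IsPrimitiveOn

/-- The increments of `Z` are dominated by those of the primitive of `n`, which is absolutely
continuous, so the same `δ` serves for both. -/
lemma absolutelyContinuousOnInterval_of_norm_sub_le {H : Type*} [NormedAddCommGroup H] {a b : ℝ}
    (hab : a ≤ b) {Z : ℝ → H} {n : ℝ → ℝ} (hn : IntervalIntegrable n volume a b)
    (hZ : ∀ s ∈ Icc a b, ∀ t ∈ Icc a b, s ≤ t → ‖Z t - Z s‖ ≤ ∫ r in s..t, n r) :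
    AbsolutelyContinuousOnInterval Z a b := by
  have h := hn.absolutelyContinuousOnInterval_intervalIntegral (left_mem_uIcc (a := a) (b := b))
  have hp : IsPrimitiveOn a b (fun t => ∫ r in a..t, n r) n := ⟨hn, fun t _ => by simp⟩
  have key : ∀ s ∈ Icc a b, ∀ t ∈ Icc a b,
      dist (Z s) (Z t) ≤ dist (∫ r in a..s, n r) (∫ r in a..t, n r) := by
    intro s hs t ht
    rcases le_total s t with hst | hst
    · rw [dist_comm, dist_comm (∫ r in a..s, n r), dist_eq_norm, dist_eq_norm, hp.sub_eq hs ht]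
      exact (hZ s hs t ht hst).trans (le_abs_self _)
    · rw [dist_eq_norm, dist_eq_norm, hp.sub_eq ht hs]
      exact (hZ t ht s hs hst).trans (le_abs_self _)
  rw [absolutelyContinuousOnInterval_iff] at h ⊢
  intro ε hε
  obtain ⟨δ, hδ, H⟩ := h ε hε
  refine ⟨δ, hδ, fun E hE hE' => (Finset.sum_le_sum fun i hi => ?_).trans_lt (H E hE hE')⟩
  have hm := hE.1 i hi
  rw [uIcc_of_le hab] at hm
  exact key _ hm.1 _ hm.2

/-- `Z` minus the integral of `z` is absolutely continuous with zero derivative almost everywhere,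
hence constant. The product and chain rules below reduce to this criterion. -/
lemma isPrimitiveOn_of_absolutelyContinuous [CompleteSpace F] {a b : ℝ} (hab : a ≤ b)
    {Z z : ℝ → F} (hZ : AbsolutelyContinuousOnInterval Z a b)
    (hz : IntervalIntegrable z volume a b)
    (hd : ∀ᵐ t ∂volume.restrict (Icc a b), HasDerivAt Z (z t) t) : IsPrimitiveOn a b Z z := by
  have hp : IsPrimitiveOn a b (fun t => ∫ r in a..t, z r) z := ⟨hz, fun t _ => by simp⟩
  have hac : AbsolutelyContinuousOnInterval (fun t => ∫ r in a..t, z r) a b :=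
    absolutelyContinuousOnInterval_of_norm_sub_le hab hz.norm
      fun s hs t ht hst => hp.norm_sub_le hs ht hst
  have h1 := (ae_restrict_iff' measurableSet_Icc).1 (hd.and (hp.ae_hasDerivAt hab))
  obtain ⟨c, hc⟩ := (hZ.sub hac).const_of_ae_hasDerivAt_zero (by
    filter_upwards [h1] with t ht hmem
    rw [uIcc_of_le hab] at hmem
    simpa using (ht hmem).1.sub (ht hmem).2)
  rw [uIcc_of_le hab] at hc
  refine ⟨hz, fun t ht => ?_⟩
  have h2 := hc t ht
  have h3 := hc a (left_mem_Icc.2 hab)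
  simp only [Pi.sub_apply, intervalIntegral.integral_same, sub_zero] at h2 h3
  rw [h3, ← h2]
  abel

namespace IsPrimitiveOn

variable [CompleteSpace F₁] [CompleteSpace F₂] [CompleteSpace F₃] {a b : ℝ}

/-- The product rule. -/
lemma bilin (hab : a ≤ b) (B : F₁ →L[ℝ] F₂ →L[ℝ] F₃) {X x : ℝ → F₁} {Y y : ℝ → F₂}
    (hX : IsPrimitiveOn a b X x) (hY : IsPrimitiveOn a b Y y) :
    IsPrimitiveOn a b (fun t => B (X t) (Y t)) (fun t => B (x t) (Y t) + B (X t) (y t)) := by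
  obtain ⟨C, hC⟩ := isCompact_Icc.exists_bound_of_continuousOn hX.continuousOn
  obtain ⟨D, hD⟩ := isCompact_Icc.exists_bound_of_continuousOn hY.continuousOn
  have hYc : ContinuousOn Y (uIoc a b) := hY.continuousOn.mono (by
    rw [uIoc_of_le hab]; exact Ioc_subset_Icc_self)
  have hXc : ContinuousOn X (uIoc a b) := hX.continuousOn.mono (by
    rw [uIoc_of_le hab]; exact Ioc_subset_Icc_self)
  have hx := hX.intervalIntegrable
  have hy := hY.intervalIntegrable
  -- `C` and `D` bound `X` and `Y` on `[a,b]`; changing one factor of `B(X, Y)` at a time produces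
  -- this majorant.
  refine isPrimitiveOn_of_absolutelyContinuous hab (absolutelyContinuousOnInterval_of_norm_sub_le
    hab (n := fun r => ‖B‖ * D * ‖x r‖ + ‖B‖ * C * ‖y r‖)
    ((hx.norm.const_mul _).add (hy.norm.const_mul _)) ?_) ?_ ?_
  · intro s hs t ht hst
    have e1 : B (X t) (Y t) - B (X s) (Y s) = B (X t - X s) (Y t) + B (X s) (Y t - Y s) := by
      simp
    rw [e1, intervalIntegral.integral_add
      ((hX.intervalIntegrable_sub hs ht).norm.const_mul _)
      ((hY.intervalIntegrable_sub hs ht).norm.const_mul _),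
      intervalIntegral.integral_const_mul, intervalIntegral.integral_const_mul]
    refine (norm_add_le _ _).trans (add_le_add ?_ ?_)
    · refine (B.le_opNorm₂ _ _).trans ?_
      have h0 : 0 ≤ D := (norm_nonneg _).trans (hD t ht)
      rw [mul_right_comm]
      exact mul_le_mul (mul_le_mul_of_nonneg_left (hD t ht) (norm_nonneg B))
        (hX.norm_sub_le hs ht hst) (norm_nonneg _) (mul_nonneg (norm_nonneg B) h0)
    · refine (B.le_opNorm₂ _ _).trans ?_
      have h0 : 0 ≤ C := (norm_nonneg _).trans (hC t ht)
      exact mul_le_mul (mul_le_mul_of_nonneg_left (hC s hs) (norm_nonneg B))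
        (hY.norm_sub_le hs ht hst) (norm_nonneg _) (mul_nonneg (norm_nonneg B) h0)
  · rw [intervalIntegrable_iff] at hx hy ⊢
    have m1 := hYc.aestronglyMeasurable measurableSet_uIoc (μ := volume)
    have m2 := hXc.aestronglyMeasurable measurableSet_uIoc (μ := volume)
    refine Integrable.add ?_ ?_
    · refine B.integrable_of_bilin_of_bdd_right D hx m1 ?_
      filter_upwards [ae_restrict_mem measurableSet_uIoc] with t ht
      rw [uIoc_of_le hab] at ht
      exact hD t (Ioc_subset_Icc_self ht)
    · refine B.integrable_of_bilin_of_bdd_left C m2 ?_ hy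
      filter_upwards [ae_restrict_mem measurableSet_uIoc] with t ht
      rw [uIoc_of_le hab] at ht
      exact hC t (Ioc_subset_Icc_self ht)
  · filter_upwards [hX.ae_hasDerivAt hab, hY.ae_hasDerivAt hab] with t h1 h2
    have := B.hasFDerivAt_of_bilinear h1.hasFDerivAt h2.hasFDerivAt
    convert this.hasDerivAt using 1
    simp [add_comm]

lemma mul {R : Type*} [NormedRing R] [NormedAlgebra ℝ R] [CompleteSpace R] (hab : a ≤ b)
    {X x Y y : ℝ → R} (hX : IsPrimitiveOn a b X x) (hY : IsPrimitiveOn a b Y y) :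
    IsPrimitiveOn a b (fun t => X t * Y t) (fun t => x t * Y t + X t * y t) :=
  bilin hab (ContinuousLinearMap.mul ℝ R) hX hY

/-- The chain rule. -/
lemma comp (hab : a ≤ b) {φ : F₁ → F₂} (hφ : ContDiff ℝ 1 φ) {X x : ℝ → F₁}
    (hX : IsPrimitiveOn a b X x) :
    IsPrimitiveOn a b (fun t => φ (X t)) (fun t => fderiv ℝ φ (X t) (x t)) := by
  have hx := hX.intervalIntegrable
  have hXc : ContinuousOn X (uIoc a b) := hX.continuousOn.mono (by
    rw [uIoc_of_le hab]; exact Ioc_subset_Icc_self)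
  have hφ' : Continuous (fderiv ℝ φ) := hφ.continuous_fderiv one_ne_zero
  obtain ⟨C, hC⟩ := isCompact_Icc.exists_bound_of_continuousOn
    (hφ'.comp_continuousOn hX.continuousOn)
  obtain ⟨K, hK⟩ : ∃ K, LipschitzOnWith K φ (X '' Icc a b) :=
    hφ.locallyLipschitz.locallyLipschitzOn.exists_lipschitzOnWith_of_compact
      (isCompact_Icc.image_of_continuousOn hX.continuousOn)
  refine isPrimitiveOn_of_absolutelyContinuous hab (absolutelyContinuousOnInterval_of_norm_sub_le
    hab (n := fun r => K * ‖x r‖) (hx.norm.const_mul _) ?_) ?_ ?_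
  · intro s hs t ht hst
    rw [intervalIntegral.integral_const_mul]
    exact (hK.norm_sub_le (mem_image_of_mem _ ht) (mem_image_of_mem _ hs)).trans
      (mul_le_mul_of_nonneg_left (hX.norm_sub_le hs ht hst) K.2)
  · rw [intervalIntegrable_iff] at hx ⊢
    have m1 := (hφ'.comp_continuousOn hXc).aestronglyMeasurable measurableSet_uIoc (μ := volume)
    refine (ContinuousLinearMap.id ℝ (F₁ →L[ℝ] F₂)).integrable_of_bilin_of_bdd_left C m1 ?_ hx
    filter_upwards [ae_restrict_mem measurableSet_uIoc] with t ht
    rw [uIoc_of_le hab] at ht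
    exact hC t (Ioc_subset_Icc_self ht)
  · filter_upwards [hX.ae_hasDerivAt hab] with t h1
    exact (hφ.differentiable one_ne_zero (X t)).hasFDerivAt.comp_hasDerivAt t h1

end IsPrimitiveOn

end Primitive

/-! ### Operators on continuous and on integrable functions -/

section Operators

/-! ### Inversion of `1 + v` in a Banach algebra -/

section Ring

variable {R E : Type*} [NormedRing R] [CompleteSpace R]

/-- `1 - (-v)^n` is invertible by the Neumann series and is the product of `1 + v` and a geometric
sum that commutes with it; a factor of a unit in a commuting product is a unit. -/
lemma isUnit_one_add_of_norm_pow_lt_one {v : R} {n : ℕ} (h : ‖v ^ n‖ < 1) : IsUnit (1 + v) := by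
  have h0 : ‖(-v) ^ n‖ < 1 := by
    rcases neg_one_pow_eq_or R n with h' | h' <;> simpa [neg_pow v, h'] using h
  have h1 : IsUnit (1 - (-v) ^ n) := (Units.oneSub _ h0).isUnit
  rw [← mul_neg_geom_sum] at h1
  have h2 : Commute (1 - -v) (∑ i ∈ Finset.range n, (-v) ^ i) :=
    Commute.sum_right _ _ _ fun i _ =>
      ((Commute.one_left _).sub_left (Commute.refl _)).pow_right i
  simpa using (h2.isUnit_mul_iff.1 h1).1

variable [NormedAlgebra ℝ R] [NormedAddCommGroup E] [NormedSpace ℝ E]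

lemma contDiff_inverse_one_add {V : E →L[ℝ] R} (hV : ∀ b, IsUnit (1 + V b))
    {n : WithTop ℕ∞} : ContDiff ℝ n fun b => Ring.inverse (1 + V b) := by
  rw [contDiff_iff_contDiffAt]
  intro b
  obtain ⟨u, hu⟩ := hV b
  have h := contDiffAt_ringInverse ℝ (n := n) u
  rw [hu] at h
  exact h.comp b (contDiffAt_const.add V.contDiff.contDiffAt)

lemma hasDerivAt_inverse_one_add {V : E →L[ℝ] R} (hV : ∀ b, IsUnit (1 + V b))
    {b : ℝ → E} {b' : E} {ε : ℝ} (hb : HasDerivAt b b' ε) :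
    HasDerivAt (fun ε => Ring.inverse (1 + V (b ε)))
      (-(Ring.inverse (1 + V (b ε)) * V b' * Ring.inverse (1 + V (b ε)))) ε := by
  obtain ⟨u, hu⟩ := hV (b ε)
  have h := hasFDerivAt_ringInverse (𝕜 := ℝ) u
  rw [hu] at h
  have h1 : HasDerivAt (fun ε => 1 + V (b ε)) (V b') ε :=
    (V.hasFDerivAt.comp_hasDerivAt ε hb).const_add 1
  refine (h.comp_hasDerivAt ε h1).congr_deriv ?_
  rw [← hu, Ring.inverse_unit]
  rfl

end Ring

variable {F F₁ F₂ F₃ : Type*} [NormedAddCommGroup F] [NormedSpace ℝ F]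
  [NormedAddCommGroup F₁] [NormedSpace ℝ F₁] [NormedAddCommGroup F₂] [NormedSpace ℝ F₂]
  [NormedAddCommGroup F₃] [NormedSpace ℝ F₃]

section Extension

variable {H : Type*} [NormedAddCommGroup H]

/-- The constant extension of a continuous function on `[0,1]` to the real line. -/
def extIcc (X : C(unitInterval, H)) : ℝ → H := IccExtend (zero_le_one' ℝ) X

lemma extIcc_coe (X : C(unitInterval, H)) (t : unitInterval) : extIcc X t = X t := by
  exact IccExtend_val _ _ t

lemma extIcc_of_mem (X : C(unitInterval, H)) {t : ℝ} (ht : t ∈ Icc (0 : ℝ) 1) :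
    extIcc X t = X ⟨t, ht⟩ := extIcc_coe X ⟨t, ht⟩

lemma continuous_extIcc (X : C(unitInterval, H)) : Continuous (extIcc X) :=
  X.continuous.Icc_extend'

lemma norm_extIcc_le (X : C(unitInterval, H)) (t : ℝ) : ‖extIcc X t‖ ≤ ‖X‖ :=
  X.norm_coe_le_norm _

end Extension

/-- Bounded continuous extension, as a linear isometry. -/
def extIccL : C(unitInterval, F) →L[ℝ] BoundedContinuousFunction ℝ F :=
  LinearMap.mkContinuous
    { toFun := fun X => BoundedContinuousFunction.ofNormedAddCommGroup (extIcc X)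
        (continuous_extIcc X) ‖X‖ (norm_extIcc_le X)
      map_add' := fun _ _ => rfl
      map_smul' := fun _ _ => rfl } 1 fun X => by
    rw [one_mul]
    exact BoundedContinuousFunction.norm_ofNormedAddCommGroup_le (continuous_extIcc X)
      (norm_nonneg X) (norm_extIcc_le X)

/-- The product of a continuous and of an integrable function with respect to a bilinear map. -/
def mulL (B : F₁ →L[ℝ] F₂ →L[ℝ] F₃) :
    C(unitInterval, F₁) →L[ℝ] Lp F₂ 1 vol01 →L[ℝ] Lp F₃ 1 vol01 :=
  (B.holderL vol01 ⊤ 1 1).comp ((BoundedContinuousFunction.toLp ⊤ vol01 ℝ).comp extIccL)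

lemma coeFn_mulL (B : F₁ →L[ℝ] F₂ →L[ℝ] F₃) (X : C(unitInterval, F₁)) (y : Lp F₂ 1 vol01) :
    mulL B X y =ᵐ[vol01] fun t => B (extIcc X t) (y t) := by
  refine (B.coeFn_holder _ y).trans ?_
  filter_upwards [BoundedContinuousFunction.coeFn_toLp ⊤ vol01 ℝ (extIccL X)] with t ht
  change B ((BoundedContinuousFunction.toLp ⊤ vol01 ℝ (extIccL X)) t) (y t) = _
  rw [ht]
  rfl

lemma intervalIntegrable_coeFn {H : Type*} [NormedAddCommGroup H] (x : Lp H 1 vol01) : IntervalIntegrable x volume 0 1 := by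
  rw [intervalIntegrable_iff_integrableOn_Icc_of_le zero_le_one]
  exact L1.integrable_coeFn x

lemma norm_eq_integral {H : Type*} [NormedAddCommGroup H] (x : Lp H 1 vol01) : ‖x‖ = ∫ t in (0 : ℝ)..1, ‖x t‖ := by
  rw [L1.norm_eq_integral_norm, intervalIntegral.integral_of_le zero_le_one,
    integral_Icc_eq_integral_Ioc]

/-- The primitive of an integrable function that vanishes at `0`. -/
def primitive (x : Lp F 1 vol01) : C(unitInterval, F) where
  toFun t := ∫ r in (0 : ℝ)..t, x r
  continuous_toFun := by
    have := intervalIntegral.continuousOn_primitive_interval'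
      (intervalIntegrable_coeFn x) left_mem_uIcc
    rw [uIcc_of_le zero_le_one] at this
    exact this.domRestrict

lemma extIcc_primitive (x : Lp F 1 vol01) {t : ℝ} (ht : t ∈ Icc (0 : ℝ) 1) :
    extIcc (primitive x) t = ∫ r in (0 : ℝ)..t, x r := extIcc_of_mem _ ht

lemma isPrimitiveOn_primitive (x : Lp F 1 vol01) :
    IsPrimitiveOn 0 1 (extIcc (primitive x)) x := by
  refine ⟨intervalIntegrable_coeFn x, fun t ht => ?_⟩
  rw [extIcc_primitive x ht, extIcc_primitive x (left_mem_Icc.2 zero_le_one)]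
  simp

/-- The operator that takes an integrable function to its primitive. -/
def primitiveL : Lp F 1 vol01 →L[ℝ] C(unitInterval, F) :=
  LinearMap.mkContinuous
    { toFun := primitive
      map_add' := fun x y => by
        ext t
        have hs : uIcc (0 : ℝ) t ⊆ uIcc 0 1 := by
          rw [uIcc_of_le t.2.1, uIcc_of_le zero_le_one]; exact Icc_subset_Icc_right t.2.2
        have h := (ae_restrict_iff' measurableSet_Icc).1 (Lp.coeFn_add x y)
        change ∫ r in (0 : ℝ)..t, (x + y : Lp F 1 vol01) r
          = (∫ r in (0 : ℝ)..t, x r) + ∫ r in (0 : ℝ)..t, y r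
        rw [← intervalIntegral.integral_add ((intervalIntegrable_coeFn x).mono_set hs)
          ((intervalIntegrable_coeFn y).mono_set hs)]
        refine intervalIntegral.integral_congr_ae ?_
        filter_upwards [h] with r hr hrt
        rw [uIoc_of_le t.2.1] at hrt
        exact hr ⟨hrt.1.le, hrt.2.trans t.2.2⟩
      map_smul' := fun c x => by
        ext t
        have h := (ae_restrict_iff' measurableSet_Icc).1 (Lp.coeFn_smul c x)
        change ∫ r in (0 : ℝ)..t, (c • x : Lp F 1 vol01) r = c • ∫ r in (0 : ℝ)..t, x r
        rw [← intervalIntegral.integral_smul]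
        refine intervalIntegral.integral_congr_ae ?_
        filter_upwards [h] with r hr hrt
        rw [uIoc_of_le t.2.1] at hrt
        exact hr ⟨hrt.1.le, hrt.2.trans t.2.2⟩ } 1 fun x => by
    rw [one_mul]
    refine (ContinuousMap.norm_le _ (norm_nonneg x)).2 fun t => ?_
    rw [norm_eq_integral x]
    refine (intervalIntegral.norm_integral_le_integral_norm t.2.1).trans ?_
    exact intervalIntegral.integral_mono_interval le_rfl t.2.1 t.2.2
      (Filter.Eventually.of_forall fun _ => norm_nonneg _) (intervalIntegrable_coeFn x).norm

/-! #### Volterra operators -/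

/-- The Volterra operator `X ↦ ∫_0^t B(b(r), X(r)) dr`. -/
def volterra (B : F₁ →L[ℝ] F →L[ℝ] F) :
    Lp F₁ 1 vol01 →L[ℝ] C(unitInterval, F) →L[ℝ] C(unitInterval, F) :=
  -- `mulL` takes the continuous factor first, hence `B.flip`; the outer `flip` makes the integrable
  -- coefficient the first argument again.
  (ContinuousLinearMap.compL ℝ _ _ _ primitiveL).comp (mulL B.flip).flip

lemma volterra_apply (B : F₁ →L[ℝ] F →L[ℝ] F) (b : Lp F₁ 1 vol01) (X : C(unitInterval, F)) :
    volterra B b X = primitive (mulL B.flip X b) := rfl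

lemma isPrimitiveOn_volterra (B : F₁ →L[ℝ] F →L[ℝ] F) (b : Lp F₁ 1 vol01)
    (X : C(unitInterval, F)) :
    IsPrimitiveOn 0 1 (extIcc (volterra B b X)) fun t => B (b t) (extIcc X t) :=
  (isPrimitiveOn_primitive _).congr_ae zero_le_one (coeFn_mulL B.flip X b)

lemma extIcc_volterra_zero (B : F₁ →L[ℝ] F →L[ℝ] F) (b : Lp F₁ 1 vol01)
    (X : C(unitInterval, F)) : extIcc (volterra B b X) 0 = 0 := by
  rw [volterra_apply, extIcc_primitive _ (left_mem_Icc.2 zero_le_one)]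
  simp

/-- The usual factorial estimate of iterated integrals: with `β` the primitive of `‖B‖ ‖b‖`, the
function `β^n / n! · β'` integrates to `β^(n+1) / (n+1)!`. It makes the Volterra operator
quasinilpotent for a merely integrable coefficient. -/
lemma norm_volterra_pow_apply_le (B : F₁ →L[ℝ] F →L[ℝ] F) (b : Lp F₁ 1 vol01)
    (X : C(unitInterval, F)) (n : ℕ) {t : ℝ} (ht : t ∈ Icc (0 : ℝ) 1) :
    ‖extIcc ((volterra B b ^ n) X) t‖ ≤ (∫ r in (0 : ℝ)..t, ‖B‖ * ‖b r‖) ^ n / n.factorial * ‖X‖ := by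
  have hb : IntervalIntegrable (fun r => ‖B‖ * ‖b r‖) volume 0 1 :=
    (intervalIntegrable_coeFn b).norm.const_mul _
  have hβ : IsPrimitiveOn 0 1 (fun t => ∫ r in (0 : ℝ)..t, ‖B‖ * ‖b r‖) fun r => ‖B‖ * ‖b r‖ :=
    ⟨hb, fun t _ => by simp⟩
  have h0 : (0 : ℝ) ∈ Icc (0 : ℝ) 1 := left_mem_Icc.2 zero_le_one
  induction n generalizing t with
  | zero => simpa using norm_extIcc_le X t
  | succ n ih =>
    set β : ℝ → ℝ := fun t => ∫ r in (0 : ℝ)..t, ‖B‖ * ‖b r‖ with hβdef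
    -- `β` is only absolutely continuous, so this antiderivative comes from the chain rule for
    -- primitives.
    have hpow : IsPrimitiveOn 0 1 (fun t => ‖X‖ / (n + 1).factorial * β t ^ (n + 1))
        fun t => β t ^ n / n.factorial * ‖X‖ * (‖B‖ * ‖b t‖) := by
      have := hβ.comp zero_le_one (φ := fun z : ℝ => ‖X‖ / (n + 1).factorial * z ^ (n + 1))
        (by fun_prop)
      refine this.congr_ae zero_le_one (Filter.Eventually.of_forall fun t => ?_)
      have hd : HasDerivAt (fun z : ℝ => ‖X‖ / (n + 1).factorial * z ^ (n + 1))
          (‖X‖ / (n + 1).factorial * (((n + 1 : ℕ) : ℝ) * β t ^ n)) (β t) := by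
        simpa using (hasDerivAt_pow (n + 1) (β t)).const_mul (‖X‖ / ((n + 1).factorial : ℝ))
      refine (congrArg (fun L => L (‖B‖ * ‖b t‖)) hd.hasFDerivAt.fderiv).trans ?_
      have h1 : ((n + 1 : ℕ) : ℝ) ≠ 0 := by positivity
      simp only [ContinuousLinearMap.toSpanSingleton_apply, smul_eq_mul]
      rw [Nat.factorial_succ, Nat.cast_mul]
      field_simp
    have hV := isPrimitiveOn_volterra B b ((volterra B b ^ n) X)
    rw [pow_succ', mul_apply_eq_comp]
    have e1 := hV.sub_eq h0 ht
    rw [extIcc_volterra_zero, sub_zero] at e1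
    have e2 := hpow.sub_eq h0 ht
    rw [e1]
    have e3 : β 0 = 0 := by simp [hβdef]
    rw [e3] at e2
    have e4 : β t ^ (n + 1) / (n + 1).factorial * ‖X‖
        = ∫ r in (0 : ℝ)..t, β r ^ n / n.factorial * ‖X‖ * (‖B‖ * ‖b r‖) := by
      rw [← e2]; simp; ring
    change _ ≤ β t ^ (n + 1) / (n + 1).factorial * ‖X‖
    rw [e4]
    refine intervalIntegral.norm_integral_le_of_norm_le ht.1
      (Filter.Eventually.of_forall fun r hr => ?_) (hpow.intervalIntegrable_sub h0 ht)
    refine (B.le_opNorm₂ _ _).trans ?_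
    rw [mul_comm]
    exact mul_le_mul_of_nonneg_right (ih ⟨hr.1.le, hr.2.trans ht.2⟩) (by positivity)

variable [CompleteSpace F]

/-- No smallness of `b` is needed: some power of the operator has norm at most `c^n / n! < 1`. -/
lemma isUnit_one_add_volterra (B : F₁ →L[ℝ] F →L[ℝ] F) (b : Lp F₁ 1 vol01) :
    IsUnit (1 + volterra B b) := by
  set V := volterra B b
  set c := ∫ r in (0 : ℝ)..1, ‖B‖ * ‖b r‖ with hc
  have hb : IntervalIntegrable (fun r => ‖B‖ * ‖b r‖) volume 0 1 :=
    (intervalIntegrable_coeFn b).norm.const_mul _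
  obtain ⟨n, hn⟩ : ∃ n : ℕ, c ^ n / n.factorial < 1 :=
    ((FloorSemiring.tendsto_pow_div_factorial_atTop c).eventually_lt_const zero_lt_one).exists
  have hc0 : 0 ≤ c := intervalIntegral.integral_nonneg zero_le_one fun _ _ => by positivity
  refine isUnit_one_add_of_norm_pow_lt_one
    (R := C(unitInterval, F) →L[ℝ] C(unitInterval, F)) (n := n) (lt_of_le_of_lt ?_ hn)
  refine ContinuousLinearMap.opNorm_le_bound _ (by positivity) fun X => ?_
  rw [ContinuousMap.norm_le _ (by positivity)]
  intro t
  rw [← extIcc_coe]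
  refine (norm_volterra_pow_apply_le B b X n t.2).trans ?_
  gcongr
  · exact intervalIntegral.integral_nonneg t.2.1 fun _ _ => by positivity
  · exact intervalIntegral.integral_mono_interval le_rfl t.2.1 t.2.2
      (Filter.Eventually.of_forall fun _ => by positivity) hb

/-- The resolvent `(1 + V_b)⁻¹` of the Volterra operator. -/
def resolvent (B : F₁ →L[ℝ] F →L[ℝ] F) (b : Lp F₁ 1 vol01) :
    C(unitInterval, F) →L[ℝ] C(unitInterval, F) := Ring.inverse (1 + volterra B b)

lemma resolvent_add_volterra (B : F₁ →L[ℝ] F →L[ℝ] F) (b : Lp F₁ 1 vol01)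
    (Y : C(unitInterval, F)) : resolvent B b Y + volterra B b (resolvent B b Y) = Y := by
  have h := Ring.mul_inverse_cancel _ (isUnit_one_add_volterra B b)
  have := congrArg (fun T => T Y) h
  simpa [resolvent] using this

lemma contDiff_resolvent (B : F₁ →L[ℝ] F →L[ℝ] F) {n : WithTop ℕ∞} :
    ContDiff ℝ n (resolvent B) :=
  contDiff_inverse_one_add (R := C(unitInterval, F) →L[ℝ] C(unitInterval, F))
    (isUnit_one_add_volterra B)

lemma hasDerivAt_resolvent (B : F₁ →L[ℝ] F →L[ℝ] F) {b : ℝ → Lp F₁ 1 vol01}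
    {b' : Lp F₁ 1 vol01} {ε : ℝ} (hb : HasDerivAt b b' ε) :
    HasDerivAt (fun ε => resolvent B (b ε))
      (-(resolvent B (b ε) * volterra B b' * resolvent B (b ε))) ε :=
  hasDerivAt_inverse_one_add (R := C(unitInterval, F) →L[ℝ] C(unitInterval, F))
    (isUnit_one_add_volterra B) hb

end Operators

/-! ### Superposition operators -/

section Superposition

universe u

variable {F₁ F₂ F₃ : Type*}
  [NormedAddCommGroup F₁] [NormedSpace ℝ F₁] [NormedAddCommGroup F₂] [NormedSpace ℝ F₂]
  [NormedAddCommGroup F₃] [NormedSpace ℝ F₃]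

/-- The pointwise product of continuous functions with respect to a bilinear map. -/
def pairL (B : F₁ →L[ℝ] F₂ →L[ℝ] F₃) :
    C(unitInterval, F₁) →L[ℝ] C(unitInterval, F₂) →L[ℝ] C(unitInterval, F₃) :=
  LinearMap.mkContinuous₂
    (LinearMap.mk₂ ℝ (fun X Y => ⟨fun t => B (X t) (Y t), by fun_prop⟩)
      (fun X X' Y => by ext; simp) (fun c X Y => by ext; simp)
      (fun X Y Y' => by ext; simp) (fun c X Y => by ext; simp)) ‖B‖ fun X Y => by
    refine (ContinuousMap.norm_le _ (by positivity)).2 fun t => ?_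
    refine (B.le_opNorm₂ _ _).trans ?_
    gcongr
    · exact X.norm_coe_le_norm t
    · exact Y.norm_coe_le_norm t

variable {W F : Type u} [NormedAddCommGroup W] [NormedAddCommGroup F]

/-- The superposition operator `γ ↦ φ ∘ γ` on continuous functions. -/
def superpose (φ : C(W, F)) (γ : C(unitInterval, W)) : C(unitInterval, F) := φ.comp γ

lemma continuous_superpose (φ : C(W, F)) : Continuous (superpose φ) :=
  ContinuousMap.continuous_postcomp φ

variable [NormedSpace ℝ W] [NormedSpace ℝ F]

/-- The mean value inequality at each parameter `t`, made uniform in `t` by the continuity in the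
sup norm of superposition with `φ'`. -/
lemma hasFDerivAt_superpose {φ : C(W, F)} {φ' : C(W, W →L[ℝ] F)}
    (h : ∀ x, HasFDerivAt φ (φ' x) x) (γ : C(unitInterval, W)) :
    HasFDerivAt (superpose φ) (pairL (ContinuousLinearMap.id ℝ (W →L[ℝ] F)) (superpose φ' γ)) γ := by
  rw [hasFDerivAt_iff_isLittleO_nhds_zero, Asymptotics.isLittleO_iff]
  intro ε hε
  have hc : ContinuousAt (superpose φ') γ := (continuous_superpose φ').continuousAt
  obtain ⟨δ, hδ, H⟩ := Metric.continuousAt_iff.1 hc ε hε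
  filter_upwards [Metric.ball_mem_nhds 0 hδ] with k hk
  rw [mem_ball_zero_iff] at hk
  refine (ContinuousMap.norm_le _ (by positivity)).2 fun t => ?_
  have key : ∀ y ∈ Metric.ball (γ t) δ, ‖φ' y - φ' (γ t)‖ ≤ ε := by
    intro y hy
    -- Translating the whole curve by the constant `y - γ t` gives a curve within `δ` of `γ` that
    -- passes through `y` at `t`.
    have h1 : dist (γ + ContinuousMap.const _ (y - γ t)) γ < δ := by
      rw [dist_eq_norm, add_sub_cancel_left]
      refine lt_of_le_of_lt ?_ (mem_ball_iff_norm.1 hy)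
      exact (ContinuousMap.norm_le _ (norm_nonneg _)).2 fun _ => le_rfl
    have h2 := ((superpose φ' (γ + ContinuousMap.const _ (y - γ t))
      - superpose φ' γ).norm_coe_le_norm t).trans (dist_eq_norm _ (superpose φ' γ) ▸ (H h1).le)
    simpa [superpose] using h2
  have hmem : γ t + k t ∈ Metric.ball (γ t) δ := by
    rw [mem_ball_iff_norm, add_sub_cancel_left]
    exact (k.norm_coe_le_norm t).trans_lt hk
  have := (convex_ball (γ t) δ).norm_image_sub_le_of_norm_hasFDerivWithin_le'
    (fun y _ => (h y).hasFDerivWithinAt) key (Metric.mem_ball_self hδ) hmem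
  rw [add_sub_cancel_left] at this
  refine le_trans ?_ (this.trans (mul_le_mul_of_nonneg_left (k.norm_coe_le_norm t) hε.le))
  rfl

/-- Induction on the order: the derivative is again a superposition operator, now with values in `W
→L[ℝ] F`. `W` and `F` share a universe so that `F` may be replaced by this space. -/
lemma contDiff_superpose (n : ℕ) {φ : C(W, F)} (h : ContDiff ℝ n φ) :
    ContDiff ℝ n (superpose φ) := by
  induction n generalizing F with
  | zero => exact contDiff_zero.2 (continuous_superpose φ)
  | succ n ih =>
    have h' : ContDiff ℝ n (fderiv ℝ φ) := h.fderiv_right (by simp)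
    let φ' : C(W, W →L[ℝ] F) := ⟨fderiv ℝ φ, h'.continuous⟩
    rw [Nat.cast_add, Nat.cast_one, contDiff_succ_iff_hasFDerivAt]
    refine ⟨fun γ => pairL (ContinuousLinearMap.id ℝ (W →L[ℝ] F)) (superpose φ' γ),
      (ContinuousLinearMap.contDiff _).comp (ih (φ := φ') h'), hasFDerivAt_superpose fun x => ?_⟩
    exact (h.differentiable (by simp) x).hasFDerivAt

end Superposition

/-! ### Linear differential equations with integrable coefficients -/

section Propagator

variable {R : Type*} [NormedRing R] [NormedAlgebra ℝ R] [CompleteSpace R]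

/-- The solution of `P' = -b P`, `P(0) = 1`. -/
def propagator (b : Lp R 1 vol01) : C(unitInterval, R) := resolvent (ContinuousLinearMap.mul ℝ R) b 1

/-- The solution of `Q' = Q b`, `Q(0) = 1`. -/
def coPropagator (b : Lp R 1 vol01) : C(unitInterval, R) :=
  resolvent (-(ContinuousLinearMap.mul ℝ R).flip) b 1

lemma extIcc_resolvent (B : R →L[ℝ] R →L[ℝ] R) (b : Lp R 1 vol01) (Y : C(unitInterval, R))
    (t : ℝ) : extIcc (resolvent B b Y) t
      = extIcc Y t - extIcc (volterra B b (resolvent B b Y)) t :=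
  eq_sub_of_add_eq (congrArg (fun X => extIcc X t) (resolvent_add_volterra B b Y))

lemma isPrimitiveOn_resolvent (B : R →L[ℝ] R →L[ℝ] R) (b : Lp R 1 vol01)
    {Y : C(unitInterval, R)} {y : ℝ → R} (hY : IsPrimitiveOn 0 1 (extIcc Y) y) :
    IsPrimitiveOn 0 1 (extIcc (resolvent B b Y))
      fun t => y t + -B (b t) (extIcc (resolvent B b Y) t) :=
  (hY.add (isPrimitiveOn_volterra B b (resolvent B b Y)).neg).congr_left fun t _ => by
    rw [extIcc_resolvent, sub_eq_add_neg]

lemma isPrimitiveOn_propagator (b : Lp R 1 vol01) :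
    IsPrimitiveOn 0 1 (extIcc (propagator b)) fun t => -(b t * extIcc (propagator b) t) := by
  have := isPrimitiveOn_resolvent (ContinuousLinearMap.mul ℝ R) b
    (Y := 1) (IsPrimitiveOn.const (1 : R))
  simpa [propagator] using this

lemma isPrimitiveOn_coPropagator (b : Lp R 1 vol01) :
    IsPrimitiveOn 0 1 (extIcc (coPropagator b)) fun t => extIcc (coPropagator b) t * b t := by
  have := isPrimitiveOn_resolvent (-(ContinuousLinearMap.mul ℝ R).flip) b
    (Y := 1) (IsPrimitiveOn.const (1 : R))
  simpa [coPropagator] using this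

lemma extIcc_propagator_zero (b : Lp R 1 vol01) : extIcc (propagator b) 0 = 1 := by
  rw [propagator, extIcc_resolvent, extIcc_volterra_zero, sub_zero]
  rfl

lemma extIcc_coPropagator_zero (b : Lp R 1 vol01) : extIcc (coPropagator b) 0 = 1 := by
  rw [coPropagator, extIcc_resolvent, extIcc_volterra_zero, sub_zero]
  rfl

/-- `(QP)' = QbP - QbP = 0`. The other order of the factors follows when one-sided inverses are
two-sided, as for matrices. -/
lemma coPropagator_mul_propagator (b : Lp R 1 vol01) {t : ℝ} (ht : t ∈ Icc (0 : ℝ) 1) :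
    extIcc (coPropagator b) t * extIcc (propagator b) t = 1 := by
  have h := (isPrimitiveOn_coPropagator b).mul zero_le_one (isPrimitiveOn_propagator b)
  have := h.eq_add t ht
  simpa [mul_assoc, extIcc_propagator_zero, extIcc_coPropagator_zero] using this

variable [IsDedekindFiniteMonoid R]

lemma propagator_mul_coPropagator (b : Lp R 1 vol01) {t : ℝ} (ht : t ∈ Icc (0 : ℝ) 1) :
    extIcc (propagator b) t * extIcc (coPropagator b) t = 1 :=
  mul_eq_one_comm.1 (coPropagator_mul_propagator b ht)

/-- Variation of constants. -/
lemma extIcc_resolvent_mul (b : Lp R 1 vol01) {Y : C(unitInterval, R)} {y : ℝ → R}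
    (hY : IsPrimitiveOn 0 1 (extIcc Y) y) (hY0 : extIcc Y 0 = 0) {t : ℝ} (ht : t ∈ Icc (0 : ℝ) 1) :
    extIcc (resolvent (ContinuousLinearMap.mul ℝ R) b Y) t
      = extIcc (propagator b) t * ∫ r in (0 : ℝ)..t, extIcc (coPropagator b) r * y r := by
  have h := (isPrimitiveOn_coPropagator b).mul zero_le_one
    (isPrimitiveOn_resolvent (ContinuousLinearMap.mul ℝ R) b hY)
  have h1 := h.eq_add t ht
  have h0 : extIcc (resolvent (ContinuousLinearMap.mul ℝ R) b Y) 0 = 0 := by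
    rw [extIcc_resolvent, extIcc_volterra_zero, hY0, sub_zero]
  rw [h0, mul_zero, zero_add] at h1
  -- The terms that contain `b` cancel in the derivative of `Q` times the solution.
  have h2 : ∀ r, extIcc (coPropagator b) r * b r
        * extIcc (resolvent (ContinuousLinearMap.mul ℝ R) b Y) r
      + extIcc (coPropagator b) r * (y r + -(ContinuousLinearMap.mul ℝ R (b r))
        (extIcc (resolvent (ContinuousLinearMap.mul ℝ R) b Y) r))
      = extIcc (coPropagator b) r * y r := fun r => by
    simp only [ContinuousLinearMap.mul_apply']
    noncomm_ring
  simp_rw [h2] at h1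
  rw [← h1, ← mul_assoc, propagator_mul_coPropagator b ht, one_mul]

/-- Uniqueness in the Carathéodory sense without Gronwall: `(Qu)' = Qcu - Qcu = 0` on `[s,1]`, so
`Qu` keeps the value `Q(s)`. -/
lemma eq_propagator_mul_coPropagator {c u : ℝ → R} {b : Lp R 1 vol01} (hc : c =ᵐ[vol01] b)
    {s : ℝ} (hs : s ∈ Icc (0 : ℝ) 1) (hu : ContinuousOn u (Icc s 1))
    (hu' : ∀ t ∈ Icc s 1, u t = 1 - ∫ r in s..t, c r * u r) {t : ℝ} (ht : t ∈ Icc s 1) :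
    u t = extIcc (propagator b) t * extIcc (coPropagator b) s := by
  have ht' : t ∈ Icc (0 : ℝ) 1 := ⟨hs.1.trans ht.1, ht.2⟩
  have h1 : (1 : ℝ) ∈ Icc (0 : ℝ) 1 := right_mem_Icc.2 zero_le_one
  have hQ : IsPrimitiveOn s 1 _ _ := ((isPrimitiveOn_coPropagator b).congr_ae zero_le_one
    (y := fun t => extIcc (coPropagator b) t * c t)
    (by filter_upwards [hc] with t ht; rw [ht])).mono hs h1
  have hint : IntervalIntegrable c volume s 1 := by
    have h := (intervalIntegrable_coeFn b).congr_ae (g := c)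
      (ae_restrict_of_ae_restrict_of_subset
        (by rw [uIoc_of_le zero_le_one]; exact Ioc_subset_Icc_self) hc.symm)
    exact h.mono_set (by
      rw [uIcc_of_le hs.2, uIcc_of_le zero_le_one]; exact Icc_subset_Icc_left hs.1)
  have hus : u s = 1 := by
    rw [hu' s (left_mem_Icc.2 hs.2)]; simp
  have hup : IsPrimitiveOn s 1 u fun r => -(c r * u r) := by
    refine ⟨?_, fun t ht => ?_⟩
    · refine (hint.mul_continuousOn ?_).neg
      rwa [uIcc_of_le hs.2]
    · rw [hus, hu' t ht, intervalIntegral.integral_neg, sub_eq_add_neg]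
  have h := (hQ.mul hs.2 hup).eq_add t ht
  simp only [mul_neg, mul_assoc, add_neg_cancel, intervalIntegral.integral_zero, add_zero, hus,
    mul_one] at h
  rw [← h, ← mul_assoc, propagator_mul_coPropagator b ht', one_mul]

end Propagator

/-! ### Existence and uniqueness of the evolution family -/

section Transport

variable {d N : ℕ} {G : Subgroup (Matrix.unitaryGroup (Fin N) ℂ)} {A : Connection d G}
  {γ : ℝ → Vec d} {b : Lp (Matrix (Fin N) (Fin N) ℂ) 1 vol01}

/-- `P(t) P(s)⁻¹` is the evolution family, and `P⁻¹` is the copropagator; existence is reduced to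
the two resolvents. -/
lemma isTransport_propagator (hb : along A.form γ =ᵐ[vol01] b) :
    IsTransport A γ fun t s => extIcc (propagator b) t * extIcc (coPropagator b) s := by
  have hP : IsPrimitiveOn 0 1 _ _ := (isPrimitiveOn_propagator b).congr_ae zero_le_one
    (y := fun t => -(along A.form γ t * extIcc (propagator b) t))
    (by filter_upwards [hb] with t ht; rw [ht])
  have hQ : IsPrimitiveOn 0 1 _ _ := (isPrimitiveOn_coPropagator b).congr_ae zero_le_one
    (y := fun t => extIcc (coPropagator b) t * along A.form γ t)
    (by filter_upwards [hb] with t ht; rw [ht])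
  refine ⟨fun s _ => ?_, fun t _ => ?_, fun s hs t ht => ?_, fun t ht s hs => ?_,
    fun s hs t ht => ?_⟩
  · exact ((continuous_extIcc _).mul continuous_const).continuousOn
  · exact (continuous_const.mul (continuous_extIcc _)).continuousOn
  · have ht' : t ∈ Icc (0 : ℝ) 1 := ⟨hs.1.trans ht.1, ht.2⟩
    have h := (hP.mul zero_le_one (.const (extIcc (coPropagator b) s))).sub_eq hs ht'
    rw [propagator_mul_coPropagator b hs] at h
    rw [← sub_add_cancel (extIcc (propagator b) t * _) 1, h]
    simp only [mul_zero, add_zero, neg_mul, intervalIntegral.integral_neg, mul_assoc]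
    abel
  · have hs' : s ∈ Icc (0 : ℝ) 1 := ⟨hs.1, hs.2.trans ht.2⟩
    have h := ((IsPrimitiveOn.const (extIcc (propagator b) t)).mul zero_le_one hQ).sub_eq hs' ht
    rw [propagator_mul_coPropagator b ht] at h
    rw [← sub_sub_cancel 1 (extIcc (propagator b) t * extIcc (coPropagator b) s), h]
    simp only [zero_mul, zero_add, mul_assoc]
  · have ht' : t ∈ Icc (0 : ℝ) 1 := ⟨hs.1.trans ht.1, ht.2⟩
    refine (Matrix.inv_eq_left_inv ?_).symm
    rw [mul_assoc, ← mul_assoc (extIcc (coPropagator b) t), coPropagator_mul_propagator b ht',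
      one_mul, propagator_mul_coPropagator b hs]

lemma IsTransport.eq_propagator (hb : along A.form γ =ᵐ[vol01] b)
    {U : ℝ → ℝ → Matrix (Fin N) (Fin N) ℂ} (hU : IsTransport A γ U) {s t : ℝ}
    (hs : s ∈ Icc (0 : ℝ) 1) (ht : t ∈ Icc s 1) :
    U t s = extIcc (propagator b) t * extIcc (coPropagator b) s :=
  eq_propagator_mul_coPropagator hb hs (hU.continuous_left s hs) (hU.forward s hs) ht

/-- By uniqueness the family selected in `transport` is the explicit one, whatever the choice. -/
lemma transport_eq (hb : along A.form γ =ᵐ[vol01] b) {s t : ℝ}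
    (hs : s ∈ Icc (0 : ℝ) 1) (ht : t ∈ Icc s 1) :
    transport A γ t s = extIcc (propagator b) t * extIcc (coPropagator b) s := by
  have h : ∃ U, IsTransport A γ U := ⟨_, isTransport_propagator hb⟩
  rw [transport, dif_pos h]
  exact h.choose_spec.eq_propagator hb hs ht

lemma transport_zero_right (hb : along A.form γ =ᵐ[vol01] b) {t : ℝ} (ht : t ∈ Icc (0 : ℝ) 1) :
    transport A γ t 0 = extIcc (propagator b) t := by
  rw [transport_eq hb (left_mem_Icc.2 zero_le_one) ht, extIcc_coPropagator_zero, mul_one]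

lemma transport_one_left (hb : along A.form γ =ᵐ[vol01] b) {t : ℝ} (ht : t ∈ Icc (0 : ℝ) 1) :
    transport A γ 1 t = extIcc (propagator b) 1 * extIcc (coPropagator b) t :=
  transport_eq hb ht (right_mem_Icc.2 ht.2)

end Transport

/-! ### The holonomy of a 1-form as a function of the velocity of the curve -/

section Calculus

variable {F F₁ F₂ F₃ : Type*} [NormedAddCommGroup F] [NormedSpace ℝ F]
  [NormedAddCommGroup F₁] [NormedSpace ℝ F₁] [NormedAddCommGroup F₂] [NormedSpace ℝ F₂]
  [NormedAddCommGroup F₃] [NormedSpace ℝ F₃]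

lemma contDiff_primitiveL {n : WithTop ℕ∞} :
    ContDiff ℝ n (primitiveL : Lp F 1 vol01 →L[ℝ] C(unitInterval, F)) :=
  ContinuousLinearMap.contDiff (E := Lp F 1 vol01) (F := C(unitInterval, F)) primitiveL

lemma hasDerivAt_primitiveL {x : ℝ → Lp F 1 vol01} {x' : Lp F 1 vol01} {ε : ℝ}
    (hx : HasDerivAt x x' ε) : HasDerivAt (fun ε => primitiveL (x ε)) (primitiveL x') ε :=
  (ContinuousLinearMap.hasFDerivAt (E := Lp F 1 vol01) (F := C(unitInterval, F))
    primitiveL).comp_hasDerivAt ε hx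

lemma hasDerivAt_pairL (B : F₁ →L[ℝ] F₂ →L[ℝ] F₃) {X : ℝ → C(unitInterval, F₁)}
    {X' : C(unitInterval, F₁)} {ε : ℝ} (hX : HasDerivAt X X' ε) (Y : C(unitInterval, F₂)) :
    HasDerivAt (fun ε => pairL B (X ε) Y) (pairL B X' Y) ε :=
  (ContinuousLinearMap.hasFDerivAt (E := C(unitInterval, F₁)) (F := C(unitInterval, F₃))
    ((pairL B).flip Y)).comp_hasDerivAt ε hX

lemma hasDerivAt_mulL (B : F₁ →L[ℝ] F₂ →L[ℝ] F₃) {X : ℝ → C(unitInterval, F₁)}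
    {X' : C(unitInterval, F₁)} {y : ℝ → Lp F₂ 1 vol01} {y' : Lp F₂ 1 vol01} {ε : ℝ}
    (hX : HasDerivAt X X' ε) (hy : HasDerivAt y y' ε) :
    HasDerivAt (fun ε => mulL B (X ε) (y ε)) (mulL B X' (y ε) + mulL B (X ε) y') ε :=
  ((ContinuousLinearMap.hasFDerivAt (E := C(unitInterval, F₁))
    (F := Lp F₂ 1 vol01 →L[ℝ] Lp F₃ 1 vol01) (mulL B)).comp_hasDerivAt ε hX).clm_apply hy

lemma hasDerivAt_volterra (B : F₁ →L[ℝ] F →L[ℝ] F) {b : ℝ → Lp F₁ 1 vol01}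
    {b' : Lp F₁ 1 vol01} {X : ℝ → C(unitInterval, F)} {X' : C(unitInterval, F)} {ε : ℝ}
    (hb : HasDerivAt b b' ε) (hX : HasDerivAt X X' ε) :
    HasDerivAt (fun ε => volterra B (b ε) (X ε)) (volterra B b' (X ε) + volterra B (b ε) X') ε :=
  HasDerivAt.clm_apply (F := C(unitInterval, F)) (G := C(unitInterval, F))
    ((ContinuousLinearMap.hasFDerivAt (E := Lp F₁ 1 vol01)
    (F := C(unitInterval, F) →L[ℝ] C(unitInterval, F)) (volterra B)).comp_hasDerivAt ε hb) hX

lemma hasDerivAt_resolvent_apply [CompleteSpace F] (B : F₁ →L[ℝ] F →L[ℝ] F)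
    {b : ℝ → Lp F₁ 1 vol01} {b' : Lp F₁ 1 vol01} {X : ℝ → C(unitInterval, F)}
    {X' : C(unitInterval, F)} {ε : ℝ} (hb : HasDerivAt b b' ε) (hX : HasDerivAt X X' ε) :
    HasDerivAt (fun ε => resolvent B (b ε) (X ε))
      (-(resolvent B (b ε) (volterra B b' (resolvent B (b ε) (X ε))))
        + resolvent B (b ε) X') ε :=
  HasDerivAt.clm_apply (F := C(unitInterval, F)) (G := C(unitInterval, F))
    (hasDerivAt_resolvent B hb) hX

lemma hasDerivAt_apply_one {X : ℝ → C(unitInterval, F)} {X' : C(unitInterval, F)} {ε : ℝ}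
    (hX : HasDerivAt X X' ε) : HasDerivAt (fun ε => X ε 1) (X' 1) ε :=
  (ContinuousLinearMap.hasFDerivAt (E := C(unitInterval, F)) (F := F)
    (ContinuousMap.evalCLM ℝ (1 : unitInterval))).comp_hasDerivAt ε hX

end Calculus

/-! ### Derivatives of the pullback and of the holonomy -/

section Holonomy

universe u

variable {W F : Type u} [NormedAddCommGroup W] [NormedSpace ℝ W]
  [NormedAddCommGroup F] [NormedSpace ℝ F]

/-- The evaluation map, as a bilinear map. -/
abbrev evalL (W F : Type*) [NormedAddCommGroup W] [NormedSpace ℝ W] [NormedAddCommGroup F]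
    [NormedSpace ℝ F] : (W →L[ℝ] F) →L[ℝ] W →L[ℝ] F := ContinuousLinearMap.id ℝ (W →L[ℝ] F)

lemma hasDerivAt_line (x u : Lp W 1 vol01) : HasDerivAt (fun ε : ℝ => x + ε • u) u 0 := by
  simpa using ((hasDerivAt_id (0 : ℝ)).smul_const u).const_add x

lemma hasDerivAt_superpose {φ : C(W, F)} {φ' : C(W, W →L[ℝ] F)}
    (h : ∀ y, HasFDerivAt φ (φ' y) y) (x u : Lp W 1 vol01) :
    HasDerivAt (fun ε : ℝ => superpose φ (primitiveL (x + ε • u)))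
      (pairL (evalL W F) (superpose φ' (primitiveL x)) (primitiveL u)) 0 := by
  have := (hasFDerivAt_superpose h (primitiveL (x + (0 : ℝ) • u))).comp_hasDerivAt 0
    (hasDerivAt_primitiveL (hasDerivAt_line x u))
  rw [zero_smul, add_zero] at this
  exact this

/-- The pullback `𝒜(γ) γ'` of a 1-form by the primitive `γ` of `x`. -/
def pullback (a : C(W, W →L[ℝ] F)) (x : Lp W 1 vol01) : Lp F 1 vol01 :=
  mulL (evalL W F) (superpose a (primitiveL x)) x

/-- The first derivative of the pullback. -/
def pullback₁ (a : C(W, W →L[ℝ] F)) (a' : C(W, W →L[ℝ] W →L[ℝ] F)) (x u : Lp W 1 vol01) :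
    Lp F 1 vol01 :=
  mulL (evalL W F) (pairL (evalL W _) (superpose a' (primitiveL x)) (primitiveL u)) x
    + mulL (evalL W F) (superpose a (primitiveL x)) u

/-- The second derivative of the pullback. -/
def pullback₂ (a' : C(W, W →L[ℝ] W →L[ℝ] F)) (a'' : C(W, W →L[ℝ] W →L[ℝ] W →L[ℝ] F))
    (x u v : Lp W 1 vol01) : Lp F 1 vol01 :=
  mulL (evalL W F) (pairL (evalL W _) (pairL (evalL W _)
      (superpose a'' (primitiveL x)) (primitiveL u)) (primitiveL v)) x
    + mulL (evalL W F) (pairL (evalL W _) (superpose a' (primitiveL x)) (primitiveL v)) u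
    + mulL (evalL W F) (pairL (evalL W _) (superpose a' (primitiveL x)) (primitiveL u)) v

lemma contDiff_pullback {a : C(W, W →L[ℝ] F)} {n : ℕ} (h : ContDiff ℝ n a) :
    ContDiff ℝ n (pullback a) := by
  have h1 : ContDiff ℝ n fun x : Lp W 1 vol01 => superpose a (primitiveL x) :=
    (contDiff_superpose n h).comp contDiff_primitiveL
  exact ((ContinuousLinearMap.contDiff (E := C(unitInterval, W →L[ℝ] F))
    (F := Lp W 1 vol01 →L[ℝ] Lp F 1 vol01) (mulL (evalL W F))).comp h1).clm_apply contDiff_id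

lemma hasDerivAt_pullback {a : C(W, W →L[ℝ] F)} {a' : C(W, W →L[ℝ] W →L[ℝ] F)}
    (h : ∀ y, HasFDerivAt a (a' y) y) (x u : Lp W 1 vol01) :
    HasDerivAt (fun ε : ℝ => pullback a (x + ε • u)) (pullback₁ a a' x u) 0 := by
  have := hasDerivAt_mulL (evalL W F) (hasDerivAt_superpose h x u) (hasDerivAt_line x u)
  rw [zero_smul, add_zero] at this
  exact this

lemma hasDerivAt_pullback₁ {a : C(W, W →L[ℝ] F)} {a' : C(W, W →L[ℝ] W →L[ℝ] F)}
    {a'' : C(W, W →L[ℝ] W →L[ℝ] W →L[ℝ] F)} (h : ∀ y, HasFDerivAt a (a' y) y)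
    (h' : ∀ y, HasFDerivAt a' (a'' y) y) (x u v : Lp W 1 vol01) :
    HasDerivAt (fun ε : ℝ => pullback₁ a a' (x + ε • u) v) (pullback₂ a' a'' x u v) 0 := by
  have h3 := hasDerivAt_mulL (evalL W F) (hasDerivAt_superpose h x u) (hasDerivAt_const (0 : ℝ) v)
  have k3 := hasDerivAt_mulL (evalL W F) (hasDerivAt_pairL (evalL W _)
    (hasDerivAt_superpose h' x u) (primitiveL v)) (hasDerivAt_line x u)
  have := k3.add h3
  rw [zero_smul, add_zero, map_zero, add_zero] at this
  exact this

variable {R : Type u} [NormedRing R] [NormedAlgebra ℝ R] [CompleteSpace R]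

/-- The value at `1` of the solution of `P' = -𝒜(γ) γ' P`, `P(0) = 1` for the primitive `γ` of
`x`. -/
def holonomy (a : C(W, W →L[ℝ] R)) (x : Lp W 1 vol01) : R := propagator (pullback a x) 1

set_option maxSynthPendingDepth 5

variable {a : C(W, W →L[ℝ] R)} {a' : C(W, W →L[ℝ] W →L[ℝ] R)}
  {a'' : C(W, W →L[ℝ] W →L[ℝ] W →L[ℝ] R)}

/-- A composition of smooth maps: the pullback, the resolvent applied to the constant `1`, and
evaluation at the end point. -/
lemma contDiff_holonomy {n : ℕ} (h : ContDiff ℝ n a) : ContDiff ℝ n (holonomy a) :=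
  (ContinuousLinearMap.contDiff (E := C(unitInterval, R)) (F := R)
    (ContinuousMap.evalCLM ℝ (1 : unitInterval))).comp
    (ContDiff.clm_apply (F := C(unitInterval, R)) (G := C(unitInterval, R))
      ((contDiff_resolvent (ContinuousLinearMap.mul ℝ R)).comp (contDiff_pullback h))
      (contDiff_const (c := 1)))

/-- Differentiability being known, the derivative may be computed on the line `x + ε u`; it comes
from the derivative `-R V' R` of the resolvent `R`. -/
lemma fderiv_holonomy (h1 : ContDiff ℝ 1 a) (h : ∀ y, HasFDerivAt a (a' y) y)
    (x u : Lp W 1 vol01) :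
    fderiv ℝ (holonomy a) x u = (-(resolvent (ContinuousLinearMap.mul ℝ R) (pullback a x)
        (volterra (ContinuousLinearMap.mul ℝ R) (pullback₁ a a' x u)
        (resolvent (ContinuousLinearMap.mul ℝ R) (pullback a x) 1)))) 1 := by
  have e : HasDerivAt _ _ _ :=
    ((contDiff_holonomy (n := 1) h1).differentiable (by simp) x).hasFDerivAt.hasLineDerivAt u
  have k := hasDerivAt_apply_one (hasDerivAt_resolvent_apply (ContinuousLinearMap.mul ℝ R)
    (hasDerivAt_pullback h x u) (hasDerivAt_const (0 : ℝ) (1 : C(unitInterval, R))))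
  rw [zero_smul, add_zero, map_zero, add_zero] at k
  exact HasDerivAt.unique e k

/-- Differentiation of the first derivative in direction `v` along `x + ε u`: each of the two
resolvents contributes an iterated term, and the coefficient of the Volterra operator contributes
the term with `pullback₂`. -/
lemma secondDeriv_holonomy_eq (h2 : ContDiff ℝ 2 a) (h : ∀ y, HasFDerivAt a (a' y) y)
    (h' : ∀ y, HasFDerivAt a' (a'' y) y) (x u v : Lp W 1 vol01) :
    secondDeriv (holonomy a) x u v =
      (resolvent (ContinuousLinearMap.mul ℝ R) (pullback a x)
        (volterra (ContinuousLinearMap.mul ℝ R) (pullback₁ a a' x u)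
          (resolvent (ContinuousLinearMap.mul ℝ R) (pullback a x)
            (volterra (ContinuousLinearMap.mul ℝ R) (pullback₁ a a' x v)
              (propagator (pullback a x)))))
      + resolvent (ContinuousLinearMap.mul ℝ R) (pullback a x)
        (volterra (ContinuousLinearMap.mul ℝ R) (pullback₁ a a' x v)
          (resolvent (ContinuousLinearMap.mul ℝ R) (pullback a x)
            (volterra (ContinuousLinearMap.mul ℝ R) (pullback₁ a a' x u)
              (propagator (pullback a x)))))
      - resolvent (ContinuousLinearMap.mul ℝ R) (pullback a x)
        (volterra (ContinuousLinearMap.mul ℝ R) (pullback₂ a' a'' x u v)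
          (propagator (pullback a x)))) 1 := by
  have h1 : ContDiff ℝ 1 a := h2.of_le (by norm_num)
  have e0 : ContDiff ℝ 1 (fderiv ℝ (holonomy a)) :=
    (contDiff_holonomy (n := 2) h2).fderiv_right (by norm_num)
  have e : HasDerivAt (fun ε : ℝ => fderiv ℝ (holonomy a) (x + ε • u)) _ 0 :=
    ((e0.differentiable (by simp) x).hasFDerivAt.hasLineDerivAt u)
  have e1 : HasDerivAt (fun ε : ℝ => fderiv ℝ (holonomy a) (x + ε • u) v)
      (secondDeriv (holonomy a) x u v) 0 := by
    have := HasDerivAt.clm_apply e (hasDerivAt_const (0 : ℝ) v)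
    rw [map_zero, add_zero] at this
    exact this
  simp_rw [fderiv_holonomy h1 h] at e1
  have b := hasDerivAt_pullback h x u
  have k0 := hasDerivAt_resolvent_apply (ContinuousLinearMap.mul ℝ R) b
    (hasDerivAt_const (0 : ℝ) (1 : C(unitInterval, R)))
  have k1 := hasDerivAt_volterra (ContinuousLinearMap.mul ℝ R) (hasDerivAt_pullback₁ h h' x u v) k0
  have k2 := hasDerivAt_resolvent_apply (ContinuousLinearMap.mul ℝ R) b k1
  have k3 := hasDerivAt_apply_one k2.neg
  rw [zero_smul, add_zero, map_zero, add_zero] at k3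
  refine (HasDerivAt.unique e1 k3).trans (congrArg (fun X : C(unitInterval, R) => X 1) ?_)
  simp only [map_add, map_neg, propagator]
  abel

variable [IsDedekindFiniteMonoid R]

lemma extIcc_resolvent_volterra (b c : Lp R 1 vol01) (Z : C(unitInterval, R)) {t : ℝ}
    (ht : t ∈ Icc (0 : ℝ) 1) :
    extIcc (resolvent (ContinuousLinearMap.mul ℝ R) b
      (volterra (ContinuousLinearMap.mul ℝ R) c Z)) t
      = extIcc (propagator b) t
        * ∫ r in (0 : ℝ)..t, extIcc (coPropagator b) r * (c r * extIcc Z r) :=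
  extIcc_resolvent_mul b (isPrimitiveOn_volterra _ c Z) (extIcc_volterra_zero _ c Z) ht

/-- The second derivative of the holonomy. -/
lemma secondDeriv_holonomy (h2 : ContDiff ℝ 2 a) (h : ∀ y, HasFDerivAt a (a' y) y)
    (h' : ∀ y, HasFDerivAt a' (a'' y) y) (x u v : Lp W 1 vol01) {P Q : ℝ → R}
    (hP : P = extIcc (propagator (pullback a x))) (hQ : Q = extIcc (coPropagator (pullback a x))) :
    secondDeriv (holonomy a) x u v = P 1 * (
      (∫ t in (0 : ℝ)..1, Q t * pullback₁ a a' x u t * P t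
          * ∫ s in (0 : ℝ)..t, Q s * pullback₁ a a' x v s * P s)
      + (∫ t in (0 : ℝ)..1, Q t * pullback₁ a a' x v t * P t
          * ∫ s in (0 : ℝ)..t, Q s * pullback₁ a a' x u s * P s)
      - ∫ t in (0 : ℝ)..1, Q t * pullback₂ a' a'' x u v t * P t) := by
  have h1 : (1 : ℝ) ∈ Icc (0 : ℝ) 1 := right_mem_Icc.2 zero_le_one
  -- Variation of constants, applied to the outer and to the inner resolvent, turns the composition
  -- into an iterated integral.
  have key : ∀ c c' : Lp R 1 vol01, resolvent (ContinuousLinearMap.mul ℝ R) (pullback a x)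
      (volterra (ContinuousLinearMap.mul ℝ R) c (resolvent (ContinuousLinearMap.mul ℝ R)
        (pullback a x) (volterra (ContinuousLinearMap.mul ℝ R) c' (propagator (pullback a x))))) 1
      = P 1 * ∫ t in (0 : ℝ)..1, Q t * c t * P t * ∫ s in (0 : ℝ)..t, Q s * c' s * P s := by
    intro c c'
    have := extIcc_resolvent_volterra (pullback a x) c (resolvent (ContinuousLinearMap.mul ℝ R)
        (pullback a x) (volterra (ContinuousLinearMap.mul ℝ R) c' (propagator (pullback a x)))) h1
    rw [extIcc_of_mem _ h1] at this
    refine this.trans ?_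
    rw [← hP, ← hQ]
    congr 1
    refine intervalIntegral.integral_congr fun t ht => ?_
    rw [uIcc_of_le zero_le_one] at ht
    rw [extIcc_resolvent_volterra _ _ _ ht, ← hP, ← hQ]
    simp only [mul_assoc]
  have key' : ∀ c : Lp R 1 vol01, resolvent (ContinuousLinearMap.mul ℝ R) (pullback a x)
      (volterra (ContinuousLinearMap.mul ℝ R) c (propagator (pullback a x))) 1
      = P 1 * ∫ t in (0 : ℝ)..1, Q t * c t * P t := by
    intro c
    have := extIcc_resolvent_volterra (pullback a x) c (propagator (pullback a x)) h1
    rw [extIcc_of_mem _ h1] at this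
    refine this.trans ?_
    rw [← hP, ← hQ]
    simp only [mul_assoc]
  rw [secondDeriv_holonomy_eq h2 h h' x u v]
  simp only [ContinuousMap.add_apply, ContinuousMap.sub_apply,
    key, key']
  noncomm_ring

end Holonomy

/-! ### The second variation of the holonomy at curves with fixed end points -/

section Curvature

set_option maxSynthPendingDepth 5

variable {W R : Type*} [NormedAddCommGroup W] [NormedSpace ℝ W]
  [NormedRing R] [NormedAlgebra ℝ R]

/-- The curvature of a connection form from its 1-jet at a point, on two tangent vectors. -/
def curv (a : W →L[ℝ] R) (a' : W →L[ℝ] W →L[ℝ] R) (y z : W) : R :=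
  a' y z - a' z y + (a y * a z - a z * a y)

/-- The covariant derivative of the curvature from the 2-jet of a connection form at a point. -/
def covCurv (a : W →L[ℝ] R) (a' : W →L[ℝ] W →L[ℝ] R) (a'' : W →L[ℝ] W →L[ℝ] W →L[ℝ] R)
    (e y z : W) : R :=
  a'' e y z - a'' e z y + (a' e y * a z + a y * a' e z - (a' e z * a y + a z * a' e y))
    + (a e * curv a a' y z - curv a a' y z * a e)

variable {a : W →L[ℝ] R} {a' : W →L[ℝ] W →L[ℝ] R} {a'' : W →L[ℝ] W →L[ℝ] W →L[ℝ] R}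

/-- The integrand of the second variation is, up to a total derivative, of the form required of the
local kernels; `U`, `V` are the two variations, `u`, `v` their velocities and `x` is the velocity of
the curve. -/
lemma second_variation_algebra (h : ∀ y z, a'' y z = a'' z y) (x u v U V : W) :
    (a x * a U + (a' x U + a u) - a U * a x) * a V
      + (a x * a V + (a' x V + a v) - a V * a x) * a U
      + (curv a a' U x * a V - a V * curv a a' U x) + (curv a a' V x * a U - a U * curv a a' V x)
      - (a'' U V x + a' V u + a' U v)
    = (1 / 2 : ℝ) • (
      (a x * (a U * a V + a V * a U - (a' V U + a' U V))
        + ((a' x U + a u) * a V + a U * (a' x V + a v)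
          + ((a' x V + a v) * a U + a V * (a' x U + a u))
          - (a'' x V U + a' v U + a' V u + (a'' x U V + a' u V + a' U v)))
        - (a U * a V + a V * a U - (a' V U + a' U V)) * a x)
      - (covCurv a a' a'' U V x + covCurv a a' a'' V U x)
      + (curv a a' u V + curv a a' v U)) := by
  set M := (a x * a U + (a' x U + a u) - a U * a x) * a V
      + (a x * a V + (a' x V + a v) - a V * a x) * a U
      + (curv a a' U x * a V - a V * curv a a' U x) + (curv a a' V x * a U - a U * curv a a' V x)
      - (a'' U V x + a' V u + a' U v) with hM
  -- Doubling removes the fractions, so that an identity with integer coefficients is left.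
  have : M = (1 / 2 : ℝ) • (M + M) := by module
  rw [this]
  congr 1
  rw [hM]
  simp only [covCurv, curv]
  -- The symmetry of the second derivative is needed only for these three pairs of directions; the
  -- rest holds in any ring.
  rw [h V U, h x U, h x V]
  noncomm_ring

lemma curv_swap (y z : W) : curv a a' y z = -curv a a' z y := by
  simp only [curv]
  abel

/-- Conjugation of the preceding identity with `p = q⁻¹`, completed by the total derivatives of
products with primitives of the curvature. -/
lemma conj_second_variation {p q cu cv fu fv aU aV Φu Φv m D K S : R} (hpq : p * q = 1)
    (hm : cu * aV + cv * aU + (fu * aV - aV * fu) + (fv * aU - aU * fv) - m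
      = (1 / 2 : ℝ) • (D - K + S)) :
    q * (cu + fu) * p * (q * aV * p + Φv) + q * (cv + fv) * p * (q * aU * p + Φu) - q * m * p
      = q * fu * p * Φv + q * fv * p * Φu + (-(1 / 2) : ℝ) • (q * K * p)
        + (1 / 2 : ℝ) • (q * S * p)
        + (q * cu * p * Φv + q * aU * p * (q * fv * p)
          + (q * cv * p * Φu + q * aV * p * (q * fu * p)) + (1 / 2 : ℝ) • (q * D * p)) := by
  have e : ∀ y z, q * y * p * (q * z * p) = q * (y * z) * p := fun y z => by
    rw [mul_assoc q z p, mul_assoc (q * y) p, ← mul_assoc p q, hpq, one_mul]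
    simp only [mul_assoc]
  have h1 : q * (cu * aV + cv * aU + (fu * aV - aV * fu) + (fv * aU - aU * fv) - m) * p
      = (1 / 2 : ℝ) • (q * D * p) + (-(1 / 2) : ℝ) • (q * K * p) + (1 / 2 : ℝ) • (q * S * p) := by
    rw [hm, mul_smul_comm, smul_mul_assoc, mul_add, mul_sub, add_mul, sub_mul]
    module
  have h2 : q * (cu + fu) * p * (q * aV * p + Φv) + q * (cv + fv) * p * (q * aU * p + Φu)
      - q * m * p = q * (cu * aV + cv * aU + (fu * aV - aV * fu) + (fv * aU - aU * fv) - m) * p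
      + q * fu * p * Φv + q * fv * p * Φu
      + (q * cu * p * Φv + q * (aU * fv) * p + (q * cv * p * Φu + q * (aV * fu) * p)) := by
    rw [mul_add (q * (cu + fu) * p), mul_add (q * (cv + fv) * p), e, e]
    noncomm_ring
  rw [h2, h1, e, e]
  abel

end Curvature

/-! ### Integrability of contractions with a velocity -/

section Analysis

variable {F F₁ : Type*} [NormedAddCommGroup F] [NormedSpace ℝ F]
  [NormedAddCommGroup F₁] [NormedSpace ℝ F₁]

lemma intervalIntegrable_clm_apply {L : ℝ → F →L[ℝ] F₁} (hL : Continuous L) {x : ℝ → F}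
    (hx : IntervalIntegrable x volume 0 1) :
    IntervalIntegrable (fun t => L t (x t)) volume 0 1 := by
  obtain ⟨C, hC⟩ := isCompact_Icc.exists_bound_of_continuousOn (s := Icc (0 : ℝ) 1) hL.continuousOn
  rw [intervalIntegrable_iff] at hx ⊢
  refine (ContinuousLinearMap.id ℝ (F →L[ℝ] F₁)).integrable_of_bilin_of_bdd_left C
    hL.aestronglyMeasurable ?_ hx
  filter_upwards [ae_restrict_mem measurableSet_uIoc] with t ht
  rw [uIoc_of_le zero_le_one] at ht
  exact hC t (Ioc_subset_Icc_self ht)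

lemma intervalIntegrable_apply_continuous {L : ℝ → F →L[ℝ] F₁}
    (hL : IntervalIntegrable L volume 0 1) {x : ℝ → F} (hx : Continuous x) :
    IntervalIntegrable (fun t => L t (x t)) volume 0 1 := by
  refine intervalIntegrable_clm_apply (L := fun t => ContinuousLinearMap.apply ℝ F₁ (x t)) ?_ hL
  exact (ContinuousLinearMap.apply ℝ F₁).continuous.comp hx

variable [CompleteSpace F] [CompleteSpace F₁] {a b : ℝ}

lemma IsPrimitiveOn.comp_hasFDerivAt (hab : a ≤ b) {φ : F → F₁} {φ' : F → F →L[ℝ] F₁}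
    (h : ∀ y, HasFDerivAt φ (φ' y) y) (hφ' : Continuous φ') {X x : ℝ → F}
    (hX : IsPrimitiveOn a b X x) :
    IsPrimitiveOn a b (fun t => φ (X t)) (fun t => φ' (X t) (x t)) := by
  have := hX.comp hab (contDiff_one_iff_hasFDerivAt.2 ⟨_, hφ', h⟩)
  simp_rw [fun y => (h y).fderiv] at this
  exact this

lemma IsPrimitiveOn.clm_apply (hab : a ≤ b) {L l : ℝ → F →L[ℝ] F₁} {X x : ℝ → F}
    (hL : IsPrimitiveOn a b L l) (hX : IsPrimitiveOn a b X x) :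
    IsPrimitiveOn a b (fun t => L t (X t)) (fun t => l t (X t) + L t (x t)) :=
  bilin hab (ContinuousLinearMap.id ℝ (F →L[ℝ] F₁)) hL hX

end Analysis

section CurvatureIntegrable

set_option maxSynthPendingDepth 5

variable {W R : Type*} [NormedAddCommGroup W] [NormedSpace ℝ W]
  [NormedRing R] [NormedAlgebra ℝ R] {α : ℝ → W →L[ℝ] R} {α' : ℝ → W →L[ℝ] W →L[ℝ] R}
  {α'' : ℝ → W →L[ℝ] W →L[ℝ] W →L[ℝ] R}

lemma continuous_curv (hα : Continuous α) (hα' : Continuous α') {Y Z : ℝ → W}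
    (hY : Continuous Y) (hZ : Continuous Z) :
    Continuous fun t => curv (α t) (α' t) (Y t) (Z t) :=
  (((hα'.clm_apply hY).clm_apply hZ).sub ((hα'.clm_apply hZ).clm_apply hY)).add
    (((hα.clm_apply hY).mul (hα.clm_apply hZ)).sub ((hα.clm_apply hZ).mul (hα.clm_apply hY)))

lemma intervalIntegrable_curv (hα : Continuous α) (hα' : Continuous α') {Z z : ℝ → W}
    (hZ : Continuous Z) (hz : IntervalIntegrable z volume 0 1) :
    IntervalIntegrable (fun t => curv (α t) (α' t) (Z t) (z t)) volume 0 1 := by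
  refine .add (.sub ?_ ?_) (.sub ?_ ?_)
  · exact intervalIntegrable_clm_apply (hα'.clm_apply hZ) hz
  · exact intervalIntegrable_apply_continuous (intervalIntegrable_clm_apply hα' hz) hZ
  · exact (intervalIntegrable_clm_apply hα hz).continuousOn_mul (hα.clm_apply hZ).continuousOn
  · exact (intervalIntegrable_clm_apply hα hz).mul_continuousOn (hα.clm_apply hZ).continuousOn

lemma intervalIntegrable_covCurv (hα : Continuous α) (hα' : Continuous α') (hα'' : Continuous α'')
    {Y Z z : ℝ → W} (hY : Continuous Y) (hZ : Continuous Z)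
    (hz : IntervalIntegrable z volume 0 1) :
    IntervalIntegrable (fun t => covCurv (α t) (α' t) (α'' t) (Y t) (Z t) (z t)) volume 0 1 := by
  have iz := intervalIntegrable_clm_apply hα hz
  have iz' := intervalIntegrable_clm_apply (hα'.clm_apply hY) hz
  have cY := (hα.clm_apply hY).continuousOn (s := uIcc 0 1)
  have cZ := (hα.clm_apply hZ).continuousOn (s := uIcc 0 1)
  have cZ' := ((hα'.clm_apply hY).clm_apply hZ).continuousOn (s := uIcc 0 1)
  have icurv := intervalIntegrable_curv hα hα' hZ hz
  exact (((intervalIntegrable_clm_apply ((hα''.clm_apply hY).clm_apply hZ) hz).sub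
    (intervalIntegrable_apply_continuous
      (intervalIntegrable_clm_apply (hα''.clm_apply hY) hz) hZ)).add
    (((iz.continuousOn_mul cZ').add (iz'.continuousOn_mul cZ)).sub
      ((iz'.mul_continuousOn cZ).add (iz.mul_continuousOn cZ')))).add
    ((icurv.continuousOn_mul cY).sub (icurv.mul_continuousOn cY))

end CurvatureIntegrable

section Pullback

universe u

variable {W F : Type u} [NormedAddCommGroup W] [NormedSpace ℝ W]
  [NormedAddCommGroup F] [NormedSpace ℝ F] {a : C(W, W →L[ℝ] F)} {a' : C(W, W →L[ℝ] W →L[ℝ] F)}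
  {a'' : C(W, W →L[ℝ] W →L[ℝ] W →L[ℝ] F)}

lemma coeFn_pullback (x : Lp W 1 vol01) :
    pullback a x =ᵐ[vol01] fun t => a (extIcc (primitive x) t) (x t) :=
  coeFn_mulL _ _ _

lemma coeFn_pullback₁ (x u : Lp W 1 vol01) :
    pullback₁ a a' x u =ᵐ[vol01] fun t => a' (extIcc (primitive x) t) (extIcc (primitive u) t) (x t)
      + a (extIcc (primitive x) t) (u t) := by
  refine (Lp.coeFn_add _ _).trans ?_
  filter_upwards [coeFn_mulL (evalL W F) (pairL (evalL W _) (superpose a' (primitiveL x))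
    (primitiveL u)) x, coeFn_mulL (evalL W F) (superpose a (primitiveL x)) u] with t h1 h2
  rw [Pi.add_apply, h1, h2]
  rfl

lemma coeFn_pullback₂ (x u v : Lp W 1 vol01) :
    pullback₂ a' a'' x u v =ᵐ[vol01] fun t =>
      a'' (extIcc (primitive x) t) (extIcc (primitive u) t) (extIcc (primitive v) t) (x t)
      + a' (extIcc (primitive x) t) (extIcc (primitive v) t) (u t)
      + a' (extIcc (primitive x) t) (extIcc (primitive u) t) (v t) := by
  have h := (Lp.coeFn_add _ _).trans (((Lp.coeFn_add _ _).trans ((coeFn_mulL (evalL W F)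
    (pairL (evalL W _) (pairL (evalL W _) (superpose a'' (primitiveL x)) (primitiveL u))
      (primitiveL v)) x).add
    (coeFn_mulL (evalL W F) (pairL (evalL W _) (superpose a' (primitiveL x)) (primitiveL v)) u))).add
    (coeFn_mulL (evalL W F) (pairL (evalL W _) (superpose a' (primitiveL x)) (primitiveL u)) v))
  exact h

end Pullback

/-! ### Integration by parts in the second variation -/

section Variation

set_option maxSynthPendingDepth 5

universe u

variable {W R : Type u} [NormedAddCommGroup W] [NormedSpace ℝ W] [CompleteSpace W]
  [NormedRing R] [NormedAlgebra ℝ R] [CompleteSpace R] [IsDedekindFiniteMonoid R]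
  {a : C(W, W →L[ℝ] R)} {a' : C(W, W →L[ℝ] W →L[ℝ] R)}
  {a'' : C(W, W →L[ℝ] W →L[ℝ] W →L[ℝ] R)}

/-- Integration by parts in the second variation. -/
lemma second_variation (ha : ∀ y, HasFDerivAt a (a' y) y) (ha' : ∀ y, HasFDerivAt a' (a'' y) y)
    (hsymm : ∀ y z w, a'' y z w = a'' y w z) (x u v : Lp W 1 vol01) {P Q : ℝ → R} {γ U V : ℝ → W}
    (hP : P = extIcc (propagator (pullback a x))) (hQ : Q = extIcc (coPropagator (pullback a x)))
    (hγ : γ = extIcc (primitive x)) (hU : U = extIcc (primitive u))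
    (hV : V = extIcc (primitive v)) (hU1 : U 1 = 0) (hV1 : V 1 = 0) :
    (∫ t in (0 : ℝ)..1, Q t * (a' (γ t) (U t) (x t) + a (γ t) (u t)) * P t
          * ∫ s in (0 : ℝ)..t, Q s * (a' (γ s) (V s) (x s) + a (γ s) (v s)) * P s)
      + (∫ t in (0 : ℝ)..1, Q t * (a' (γ t) (V t) (x t) + a (γ t) (v t)) * P t
          * ∫ s in (0 : ℝ)..t, Q s * (a' (γ s) (U s) (x s) + a (γ s) (u s)) * P s)
      - (∫ t in (0 : ℝ)..1, Q t * (a'' (γ t) (U t) (V t) (x t) + a' (γ t) (V t) (u t)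
          + a' (γ t) (U t) (v t)) * P t)
    = (∫ t in (0 : ℝ)..1, Q t * curv (a (γ t)) (a' (γ t)) (U t) (x t) * P t
          * ∫ s in (0 : ℝ)..t, Q s * curv (a (γ s)) (a' (γ s)) (V s) (x s) * P s)
      + (∫ t in (0 : ℝ)..1, Q t * curv (a (γ t)) (a' (γ t)) (V t) (x t) * P t
          * ∫ s in (0 : ℝ)..t, Q s * curv (a (γ s)) (a' (γ s)) (U s) (x s) * P s)
      + (∫ t in (0 : ℝ)..1, (-(1 / 2) : ℝ) • (Q t * (covCurv (a (γ t)) (a' (γ t)) (a'' (γ t)) (U t) (V t) (x t)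
          + covCurv (a (γ t)) (a' (γ t)) (a'' (γ t)) (V t) (U t) (x t)) * P t))
      + (1 / 2 : ℝ) • ∫ t in (0 : ℝ)..1, Q t * (curv (a (γ t)) (a' (γ t)) (u t) (V t)
          + curv (a (γ t)) (a' (γ t)) (v t) (U t)) * P t := by
  have I0 : (0 : ℝ) ∈ Icc (0 : ℝ) 1 := left_mem_Icc.2 zero_le_one
  have I1 : (1 : ℝ) ∈ Icc (0 : ℝ) 1 := right_mem_Icc.2 zero_le_one
  have hU0 : U 0 = 0 := by rw [hU, extIcc_primitive _ I0]; simp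
  have hV0 : V 0 = 0 := by rw [hV, extIcc_primitive _ I0]; simp
  have cγ : Continuous γ := hγ ▸ continuous_extIcc _
  have cU : Continuous U := hU ▸ continuous_extIcc _
  have cV : Continuous V := hV ▸ continuous_extIcc _
  have cP : Continuous P := hP ▸ continuous_extIcc _
  have cQ : Continuous Q := hQ ▸ continuous_extIcc _
  have ca : Continuous fun t => a (γ t) := a.continuous.comp cγ
  have ca' : Continuous fun t => a' (γ t) := a'.continuous.comp cγ
  have ca'' : Continuous fun t => a'' (γ t) := a''.continuous.comp cγ
  have pγ : IsPrimitiveOn 0 1 γ x := hγ ▸ isPrimitiveOn_primitive x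
  have pU : IsPrimitiveOn 0 1 U u := hU ▸ isPrimitiveOn_primitive u
  have pV : IsPrimitiveOn 0 1 V v := hV ▸ isPrimitiveOn_primitive v
  have ix : IntervalIntegrable x volume 0 1 := intervalIntegrable_coeFn x
  have iu : IntervalIntegrable u volume 0 1 := intervalIntegrable_coeFn u
  have iv : IntervalIntegrable v volume 0 1 := intervalIntegrable_coeFn v
  have hPQ : ∀ t ∈ Icc (0 : ℝ) 1, P t * Q t = 1 := fun t ht => by
    rw [hP, hQ, propagator_mul_coPropagator _ ht]
  have hb : pullback a x =ᵐ[vol01] fun t => a (γ t) (x t) := hγ ▸ coeFn_pullback x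
  have pP : IsPrimitiveOn 0 1 P fun t => -(a (γ t) (x t) * P t) :=
    hP ▸ (isPrimitiveOn_propagator (pullback a x)).congr_ae zero_le_one
      (by filter_upwards [hb] with t ht; rw [ht])
  have pQ : IsPrimitiveOn 0 1 Q fun t => Q t * a (γ t) (x t) :=
    hQ ▸ (isPrimitiveOn_coPropagator (pullback a x)).congr_ae zero_le_one
      (by filter_upwards [hb] with t ht; rw [ht])
  -- Conjugation by the transport turns the derivative into the covariant derivative along the
  -- curve.
  have conj : ∀ {M m : ℝ → R}, IsPrimitiveOn 0 1 M m → IsPrimitiveOn 0 1 (fun t => Q t * M t * P t)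
      fun t => Q t * (a (γ t) (x t) * M t + m t - M t * a (γ t) (x t)) * P t := fun hM =>
    ((pQ.mul zero_le_one hM).mul zero_le_one pP).congr_ae zero_le_one
      (Filter.Eventually.of_forall fun t => by noncomm_ring)
  have iconj : ∀ {m : ℝ → R}, IntervalIntegrable m volume 0 1 →
      IntervalIntegrable (fun t => Q t * m t * P t) volume 0 1 := fun hm =>
    (hm.continuousOn_mul cQ.continuousOn).mul_continuousOn cP.continuousOn
  have paγ : IsPrimitiveOn 0 1 (fun t => a (γ t)) fun t => a' (γ t) (x t) :=
    pγ.comp_hasFDerivAt zero_le_one ha a'.continuous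
  have pa'γ : IsPrimitiveOn 0 1 (fun t => a' (γ t)) fun t => a'' (γ t) (x t) :=
    pγ.comp_hasFDerivAt zero_le_one ha' a''.continuous
  have pw : ∀ {Z : ℝ → W} {z : Lp W 1 vol01}, IsPrimitiveOn 0 1 Z z →
      IsPrimitiveOn 0 1 (fun t => Q t * a (γ t) (Z t) * P t) fun t => Q t * (a (γ t) (x t)
        * a (γ t) (Z t) + (a' (γ t) (x t) (Z t) + a (γ t) (z t))
        - a (γ t) (Z t) * a (γ t) (x t)) * P t :=
    fun hZ => conj (paγ.clm_apply zero_le_one hZ)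
  have icurv : ∀ {Z : ℝ → W} {z : ℝ → W}, Continuous Z → IntervalIntegrable z volume 0 1 →
      IntervalIntegrable (fun t => curv (a (γ t)) (a' (γ t)) (Z t) (z t)) volume 0 1 :=
    fun hZ hz => intervalIntegrable_curv ca ca' hZ hz
  -- The first variation `a'(Z) γ' + a(Z')` of the potential is the covariant derivative of `a(Z)`
  -- plus the curvature on `(Z, γ')`; the first part integrates to the boundary value `Q a(Z) P`, as
  -- `Z 0 = 0`.
  have pW : ∀ {Z : ℝ → W} {z : Lp W 1 vol01}, Continuous Z → IsPrimitiveOn 0 1 Z z → Z 0 = 0 →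
      IntervalIntegrable (fun t => Q t * (a' (γ t) (Z t) (x t) + a (γ t) (z t)) * P t) volume 0 1 ∧
      ∀ t ∈ Icc (0 : ℝ) 1,
        ∫ s in (0 : ℝ)..t, Q s * (a' (γ s) (Z s) (x s) + a (γ s) (z s)) * P s
          = Q t * a (γ t) (Z t) * P t
            + ∫ s in (0 : ℝ)..t, Q s * curv (a (γ s)) (a' (γ s)) (Z s) (x s) * P s := by
    intro Z z cZ pZ hZ0
    refine ⟨iconj ((intervalIntegrable_clm_apply (ca'.clm_apply cZ) ix).add
      (intervalIntegrable_clm_apply ca (intervalIntegrable_coeFn z))), fun t ht => ?_⟩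
    have pΦ : IsPrimitiveOn 0 1 (fun t => ∫ s in (0 : ℝ)..t,
        Q s * curv (a (γ s)) (a' (γ s)) (Z s) (x s) * P s) _ := ⟨iconj (icurv cZ ix), fun t _ => by simp⟩
    have := ((pw pZ).add pΦ).eq_add t ht
    simp only [hZ0, map_zero, mul_zero, zero_mul, intervalIntegral.integral_same, add_zero,
      zero_add] at this
    rw [this]
    refine intervalIntegral.integral_congr fun s _ => ?_
    simp only [curv]
    noncomm_ring
  obtain ⟨iWU, eWU⟩ := pW cU pU hU0
  obtain ⟨iWV, eWV⟩ := pW cV pV hV0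
  have iφU := iconj (icurv cU ix)
  have iφV := iconj (icurv cV ix)
  have pΦU : IsPrimitiveOn 0 1 (fun t => ∫ s in (0 : ℝ)..t,
    Q s * curv (a (γ s)) (a' (γ s)) (U s) (x s) * P s) _ := ⟨iφU, fun t _ => by simp⟩
  have pΦV : IsPrimitiveOn 0 1 (fun t => ∫ s in (0 : ℝ)..t,
    Q s * curv (a (γ s)) (a' (γ s)) (V s) (x s) * P s) _ := ⟨iφV, fun t _ => by simp⟩
  have pS := conj ((((paγ.clm_apply zero_le_one pU).mul zero_le_one
      (paγ.clm_apply zero_le_one pV)).add ((paγ.clm_apply zero_le_one pV).mul zero_le_one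
      (paγ.clm_apply zero_le_one pU))).add
    (((pa'γ.clm_apply zero_le_one pV).clm_apply zero_le_one pU).add
      ((pa'γ.clm_apply zero_le_one pU).clm_apply zero_le_one pV)).neg)
  -- The total derivative left over by the pointwise identity. Every term of its primitive has a
  -- factor `U` or `V`, so it vanishes at `0` and at `1`.
  have pT := ((((pw pU).mul zero_le_one pΦV).add ((pw pV).mul zero_le_one pΦU)).add
    (pS.const_smul (1 / 2)))
  have hT := pT.sub_eq I0 I1
  simp only [hU0, hV0, hU1, hV1, map_zero, mul_zero, zero_mul, add_zero, neg_zero, smul_zero,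
    sub_zero] at hT
  have icov : ∀ {Y Z : ℝ → W}, Continuous Y → Continuous Z → IntervalIntegrable (fun t =>
      covCurv (a (γ t)) (a' (γ t)) (a'' (γ t)) (Y t) (Z t) (x t)) volume 0 1 :=
    fun hY hZ => intervalIntegrable_covCurv ca ca' ca'' hY hZ ix
  have ilocal : IntervalIntegrable (fun t => (-(1 / 2) : ℝ) • (Q t *
      (covCurv (a (γ t)) (a' (γ t)) (a'' (γ t)) (U t) (V t) (x t)
      + covCurv (a (γ t)) (a' (γ t)) (a'' (γ t)) (V t) (U t) (x t)) * P t)) volume 0 1 :=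
    (iconj ((icov cU cV).add (icov cV cU))).smul (-(1 / 2) : ℝ)
  have ising : IntervalIntegrable (fun t => Q t * (curv (a (γ t)) (a' (γ t)) (u t) (V t)
      + curv (a (γ t)) (a' (γ t)) (v t) (U t)) * P t) volume 0 1 := by
    refine iconj (.add ?_ ?_)
    · simp_rw [fun t => curv_swap (a := a (γ t)) (a' := a' (γ t)) (u t) (V t)]
      exact (icurv cV iu).neg
    · simp_rw [fun t => curv_swap (a := a (γ t)) (a' := a' (γ t)) (v t) (U t)]
      exact (icurv cU iv).neg
  have ising' : IntervalIntegrable (fun t => (1 / 2 : ℝ) • (Q t *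
      (curv (a (γ t)) (a' (γ t)) (u t) (V t) + curv (a (γ t)) (a' (γ t)) (v t) (U t)) * P t))
      volume 0 1 := ising.smul (1 / 2 : ℝ)
  have isecond : IntervalIntegrable (fun t => Q t * (a'' (γ t) (U t) (V t) (x t)
      + a' (γ t) (V t) (u t) + a' (γ t) (U t) (v t)) * P t) volume 0 1 :=
    iconj (((intervalIntegrable_clm_apply ((ca''.clm_apply cU).clm_apply cV) ix).add
      (intervalIntegrable_clm_apply (ca'.clm_apply cV) iu)).add
      (intervalIntegrable_clm_apply (ca'.clm_apply cU) iv))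
  have contP : ∀ {z : ℝ → R}, IntervalIntegrable z volume 0 1 →
      ContinuousOn (fun t => ∫ s in (0 : ℝ)..t, z s) (uIcc 0 1) := fun hz => by
    rw [uIcc_of_le zero_le_one]
    exact IsPrimitiveOn.continuousOn ⟨hz, fun t _ => by simp⟩
  -- Both sides become single integrals, the zero integral of that total derivative being added on
  -- the right; the integrands are then equal at every point of `[0,1]`.
  rw [← intervalIntegral.integral_add (iWU.mul_continuousOn (contP iWV))
      (iWV.mul_continuousOn (contP iWU)), ← intervalIntegral.integral_sub
      ((iWU.mul_continuousOn (contP iWV)).add (iWV.mul_continuousOn (contP iWU))) isecond,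
    ← intervalIntegral.integral_smul (1 / 2 : ℝ),
    ← intervalIntegral.integral_add (iφU.mul_continuousOn (contP iφV))
      (iφV.mul_continuousOn (contP iφU)),
    ← intervalIntegral.integral_add ((iφU.mul_continuousOn (contP iφV)).add
      (iφV.mul_continuousOn (contP iφU))) ilocal,
    ← intervalIntegral.integral_add (((iφU.mul_continuousOn (contP iφV)).add
      (iφV.mul_continuousOn (contP iφU))).add ilocal) ising',
    ← add_zero (∫ t in (0 : ℝ)..1, _ + _), hT, ← intervalIntegral.integral_add
      ((((iφU.mul_continuousOn (contP iφV)).add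
      (iφV.mul_continuousOn (contP iφU))).add ilocal).add ising') pT.intervalIntegrable]
  refine intervalIntegral.integral_congr fun t ht => ?_
  rw [uIcc_of_le zero_le_one] at ht
  rw [eWU t ht, eWV t ht]
  have hcu : ∀ (Z z : W), a' (γ t) Z (x t) + a (γ t) z = (a (γ t) (x t) * a (γ t) Z
      + (a' (γ t) (x t) Z + a (γ t) z) - a (γ t) Z * a (γ t) (x t))
      + curv (a (γ t)) (a' (γ t)) Z (x t) := fun Z z => by
    simp only [curv]
    noncomm_ring
  rw [hcu (U t) (u t), hcu (V t) (v t)]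
  refine (conj_second_variation (hPQ t ht)
    (second_variation_algebra (hsymm (γ t)) (x t) (u t) (v t) (U t) (V t))).trans ?_
  simp only [sub_eq_add_neg]
  rfl

end Variation

/-! ### The Volterra, Lévy and singular kernels of the holonomy -/

section Triangle

variable {R : Type*} [NormedRing R]

lemma integral_vol01 {F : Type*} [NormedAddCommGroup F] [NormedSpace ℝ F] (f : ℝ → F) :
    ∫ t, f t ∂vol01 = ∫ t in (0 : ℝ)..1, f t := by
  rw [intervalIntegral.integral_of_le zero_le_one, integral_Icc_eq_integral_Ioc]

lemma integrable_vol01 {F : Type*} [NormedAddCommGroup F] {f : ℝ → F} :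
    Integrable f vol01 ↔ IntervalIntegrable f volume 0 1 :=
  (intervalIntegrable_iff_integrableOn_Icc_of_le zero_le_one).symm

lemma ite_eq_indicator_add {f g : ℝ → R} (z : ℝ × ℝ) :
    (if z.2 ≤ z.1 then f z.1 * g z.2 else g z.2 * f z.1)
      = {z : ℝ × ℝ | z.2 ≤ z.1}.indicator (fun z => f z.1 * g z.2) z
        + {z : ℝ × ℝ | z.1 < z.2}.indicator (fun z => g z.2 * f z.1) z := by
  by_cases h : z.2 ≤ z.1
  · simp [h]
  · simp [h, not_le.1 h]

lemma integrable_triangle {f g : ℝ → R} (hf : Integrable f vol01) (hg : Integrable g vol01) :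
    Integrable (fun z : ℝ × ℝ => if z.2 ≤ z.1 then f z.1 * g z.2 else g z.2 * f z.1)
      (vol01.prod vol01) := by
  simp_rw [ite_eq_indicator_add]
  exact ((hf.mul_prod hg).indicator (measurableSet_le measurable_snd measurable_fst)).add
    ((hg.mul_prod hf).swap.indicator (measurableSet_lt measurable_fst measurable_snd))

variable [NormedAlgebra ℝ R]

/-- Fubini on the two triangles of the square, with the larger parameter as outer variable. The
factors do not commute: the one at the later time stands on the left in both triangles, as in a
time-ordered product. -/
lemma integral_triangle {f g : ℝ → R} (hf : Integrable f vol01) (hg : Integrable g vol01) :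
    ∫ z, (if z.2 ≤ z.1 then f z.1 * g z.2 else g z.2 * f z.1) ∂(vol01.prod vol01)
      = (∫ t in (0 : ℝ)..1, f t * ∫ s in (0 : ℝ)..t, g s)
        + ∫ t in (0 : ℝ)..1, g t * ∫ s in (0 : ℝ)..t, f s := by
  have m1 : MeasurableSet {z : ℝ × ℝ | z.2 ≤ z.1} := measurableSet_le measurable_snd measurable_fst
  have m2 : MeasurableSet {z : ℝ × ℝ | z.1 < z.2} := measurableSet_lt measurable_fst measurable_snd
  have i1 := (hf.mul_prod hg).indicator m1
  have i2 : Integrable ({z : ℝ × ℝ | z.1 < z.2}.indicator fun z => g z.2 * f z.1)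
    (vol01.prod vol01) := (hg.mul_prod hf).swap.indicator m2
  simp_rw [ite_eq_indicator_add]
  rw [integral_add i1 i2, integral_prod _ i1, integral_prod_symm _ i2, ← integral_vol01,
    ← integral_vol01]
  congr 1
  · refine setIntegral_congr_fun measurableSet_Icc fun t ht => ?_
    have e : ∀ s, {z : ℝ × ℝ | z.2 ≤ z.1}.indicator (fun z => f z.1 * g z.2) (t, s)
        = (Iic t).indicator (fun s => f t * g s) s := fun s => by
      by_cases h : s ≤ t <;> simp [h]
    simp only [e]
    rw [integral_indicator measurableSet_Iic, Measure.restrict_restrict measurableSet_Iic,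
      integral_const_mul_of_integrable 
        (hg.mono_measure (Measure.restrict_mono inter_subset_right le_rfl)),
      intervalIntegral.integral_of_le ht.1, ← integral_Icc_eq_integral_Ioc]
    congr 3
    ext s
    exact ⟨fun h => ⟨h.2.1, h.1⟩, fun h => ⟨h.2, h.1, h.2.trans ht.2⟩⟩
  · refine setIntegral_congr_fun measurableSet_Icc fun t ht => ?_
    have e : ∀ s, {z : ℝ × ℝ | z.1 < z.2}.indicator (fun z => g z.2 * f z.1) (s, t)
        = (Iio t).indicator (fun s => g t * f s) s := fun s => by
      by_cases h : s < t <;> simp [h]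
    simp only [e]
    rw [integral_indicator measurableSet_Iio, Measure.restrict_restrict measurableSet_Iio,
      integral_const_mul_of_integrable 
        (hf.mono_measure (Measure.restrict_mono inter_subset_right le_rfl)),
      intervalIntegral.integral_of_le ht.1, ← integral_Ico_eq_integral_Ioc]
    congr 3
    ext s
    exact ⟨fun h => ⟨h.2.1, h.1⟩, fun h => ⟨h.2, h.1, h.2.le.trans ht.2⟩⟩

end Triangle

/-! ### Curvature as a bilinear map and its coordinates -/

section Bilinear

set_option maxSynthPendingDepth 5

variable {W R : Type*} [NormedAddCommGroup W] [NormedSpace ℝ W]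
  [NormedRing R] [NormedAlgebra ℝ R]

/-- The curvature as a bilinear map. -/
def curvL (a : W →L[ℝ] R) (a' : W →L[ℝ] W →L[ℝ] R) : W →ₗ[ℝ] W →ₗ[ℝ] R :=
  LinearMap.mk₂ ℝ (curv a a')
    (fun y y' z => by simp only [curv, map_add, add_apply]; noncomm_ring)
    (fun c y z => by simp [curv, smul_sub, smul_add])
    (fun y z z' => by simp only [curv, map_add, add_apply]; noncomm_ring)
    (fun c y z => by simp [curv, smul_sub, smul_add])

/-- The covariant derivative of the curvature as a bilinear map of its first two arguments. -/
def covCurvL (a : W →L[ℝ] R) (a' : W →L[ℝ] W →L[ℝ] R) (a'' : W →L[ℝ] W →L[ℝ] W →L[ℝ] R) (x : W) :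
    W →ₗ[ℝ] W →ₗ[ℝ] R :=
  LinearMap.mk₂ ℝ (fun e y => covCurv a a' a'' e y x)
    (fun y y' z => by simp only [covCurv, curv, map_add, add_apply]; noncomm_ring)
    (fun c y z => by simp [covCurv, curv, smul_sub, smul_add])
    (fun y z z' => by simp only [covCurv, curv, map_add, add_apply]; noncomm_ring)
    (fun c y z => by
      simp only [covCurv, curv, map_smul, smul_apply, mul_smul_comm, smul_mul_assoc, mul_sub,
        mul_add, sub_mul, add_mul, smul_sub, smul_add])

@[simp] lemma covCurvL_apply (a : W →L[ℝ] R) (a' : W →L[ℝ] W →L[ℝ] R)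
    (a'' : W →L[ℝ] W →L[ℝ] W →L[ℝ] R) (x e y : W) :
    covCurvL a a' a'' x e y = covCurv a a' a'' e y x := rfl

end Bilinear

section Coordinates

variable {d : ℕ} {F : Type*} [AddCommGroup F] [Module ℝ F]

/-- The coordinate vectors of `ℝ^d`. -/
abbrev basisVec (μ : Fin d) : Vec d := EuclideanSpace.single μ 1

lemma sum_smul_basisVec (u : Vec d) : ∑ μ, u μ • basisVec μ = u := by
  simpa using (EuclideanSpace.basisFun (Fin d) ℝ).sum_repr u

lemma linear_eq_sum (L : Vec d →ₗ[ℝ] F) (u : Vec d) : L u = ∑ μ, u μ • L (basisVec μ) := by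
  conv_lhs => rw [← sum_smul_basisVec u]
  simp only [map_sum, map_smul]

lemma bilinear_eq_sum (B : Vec d →ₗ[ℝ] Vec d →ₗ[ℝ] F) (u v : Vec d) :
    B u v = ∑ μ, ∑ ν, (u μ * v ν) • B (basisVec μ) (basisVec ν) := by
  rw [linear_eq_sum B u, LinearMap.sum_apply]
  refine Finset.sum_congr rfl fun μ _ => ?_
  rw [LinearMap.smul_apply, linear_eq_sum (B (basisVec μ)) v, Finset.smul_sum]
  simp only [smul_smul]

end Coordinates

/-! ### Kernels of the second derivative -/

section Kernels

set_option maxSynthPendingDepth 5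

variable {d : ℕ} {E R : Type} [NormedAddCommGroup E] [NormedSpace ℝ E]
  [NormedRing R] [NormedAlgebra ℝ R]

/-- `T` is, up to null sets, the velocity of the curves of a space `E`, and the curves start at the
origin. -/
structure IsVelocityMap (path : E → ℝ → Vec d) (T : E →L[ℝ] Lp (Vec d) 1 vol01) : Prop where
  path_eq : ∀ σ, ∀ t ∈ Icc (0 : ℝ) 1, path σ t = extIcc (primitive (T σ)) t
  velocity_eq : ∀ σ, velocity (path σ) =ᵐ[vol01] T σ

/-- `T` is linear, so the chain rule has no term with a second derivative of `T`. This transfers the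
calculus on `L_1` to each space of curves. -/
lemma secondDeriv_comp {H V : Type*} [NormedAddCommGroup H] [NormedSpace ℝ H]
    [NormedAddCommGroup V] [NormedSpace ℝ V] {φ : H → V} (hφ : ContDiff ℝ 2 φ) (T : E →L[ℝ] H)
    (σ u v : E) :
    secondDeriv (fun σ => φ (T σ)) σ u v = secondDeriv φ (T σ) (T u) (T v) := by
  have h1 : ∀ σ, fderiv ℝ (fun σ => φ (T σ)) σ = (fderiv ℝ φ (T σ)).comp T := fun σ =>
    ((hφ.differentiable two_ne_zero (T σ)).hasFDerivAt.comp σ T.hasFDerivAt).fderiv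
  have h2 : ContDiff ℝ 1 (fderiv ℝ φ) := hφ.fderiv_right (by norm_num)
  have h3 := (h2.differentiable one_ne_zero (T σ)).hasFDerivAt.comp σ T.hasFDerivAt
  have h4 := (ContinuousLinearMap.precomp V T).hasFDerivAt.comp σ h3
  have h5 : fderiv ℝ (fun σ => φ (T σ)) = fun σ => (fderiv ℝ φ (T σ)).comp T := funext h1
  rw [secondDeriv, h5]
  have h6 := h4.fderiv
  change fderiv ℝ (fun σ => (fderiv ℝ φ (T σ)).comp T) σ = _ at h6
  rw [h6]
  rfl

variable (a : C(Vec d, Vec d →L[ℝ] R)) (a' : C(Vec d, Vec d →L[ℝ] Vec d →L[ℝ] R))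
  (a'' : C(Vec d, Vec d →L[ℝ] Vec d →L[ℝ] Vec d →L[ℝ] R)) (x : Lp (Vec d) 1 vol01)

/-- `Q(t) M P(t)` with `P`, `Q` the solutions of `P' = -a(γ) γ' P`, `Q' = Q a(γ) γ'` along the
primitive `γ` of `x`. -/
def conjP (t : ℝ) (M : R) : R :=
  extIcc (coPropagator (pullback a x)) t * M * extIcc (propagator (pullback a x)) t

/-- `F(e_μ, γ')` conjugated by the parallel transport. -/
def curvDensity (μ : Fin d) (t : ℝ) : R :=
  conjP a x t (curv (a (extIcc (primitive x) t)) (a' (extIcc (primitive x) t)) (basisVec μ) (x t))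

/-- The Volterra kernel of the holonomy. -/
def volterraKernel (μ ν : Fin d) (z : ℝ × ℝ) : R :=
  extIcc (propagator (pullback a x)) 1 *
    if z.2 ≤ z.1 then curvDensity a a' x μ z.1 * curvDensity a a' x ν z.2
    else curvDensity a a' x ν z.2 * curvDensity a a' x μ z.1

/-- The Lévy kernel of the holonomy. -/
def levyKernel (μ ν : Fin d) (t : ℝ) : R :=
  extIcc (propagator (pullback a x)) 1 * ((-(1 / 2) : ℝ) • conjP a x t
    (covCurv (a (extIcc (primitive x) t)) (a' (extIcc (primitive x) t)) (a'' (extIcc (primitive x) t))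
      (basisVec μ) (basisVec ν) (x t)
    + covCurv (a (extIcc (primitive x) t)) (a' (extIcc (primitive x) t))
      (a'' (extIcc (primitive x) t)) (basisVec ν) (basisVec μ) (x t)))

/-- The singular kernel of the holonomy. -/
def singularKernel (μ ν : Fin d) (t : ℝ) : R :=
  extIcc (propagator (pullback a x)) 1 * conjP a x t
    (curv (a (extIcc (primitive x) t)) (a' (extIcc (primitive x) t)) (basisVec μ) (basisVec ν))

variable {a a' a'' x}

lemma intervalIntegrable_conjP {m : ℝ → R} (hm : IntervalIntegrable m volume 0 1) :
    IntervalIntegrable (fun t => conjP a x t (m t)) volume 0 1 :=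
  (hm.continuousOn_mul (continuous_extIcc _).continuousOn).mul_continuousOn
    (continuous_extIcc _).continuousOn

lemma intervalIntegrable_curvDensity (μ : Fin d) :
    IntervalIntegrable (curvDensity a a' x μ) volume 0 1 :=
  intervalIntegrable_conjP (intervalIntegrable_curv (a.continuous.comp (continuous_extIcc _))
    (a'.continuous.comp (continuous_extIcc _)) continuous_const (intervalIntegrable_coeFn x))

/-- `M ↦ Q(t) M P(t)` as a linear map. -/
def conjL (a : C(Vec d, Vec d →L[ℝ] R)) (x : Lp (Vec d) 1 vol01) (t : ℝ) : R →ₗ[ℝ] R :=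
  (ContinuousLinearMap.mulLeftRight ℝ R (extIcc (coPropagator (pullback a x)) t)
    (extIcc (propagator (pullback a x)) t)).toLinearMap

lemma intervalIntegral_congr_vol01 {F : Type*} [NormedAddCommGroup F] [NormedSpace ℝ F]
    {f g : ℝ → F} (h : f =ᵐ[vol01] g) {t : ℝ} (ht : t ∈ Icc (0 : ℝ) 1) :
    ∫ s in (0 : ℝ)..t, f s = ∫ s in (0 : ℝ)..t, g s := by
  refine intervalIntegral.integral_congr_ae ?_
  filter_upwards [(ae_restrict_iff' measurableSet_Icc).1 h] with r hr hrt
  rw [uIoc_of_le ht.1] at hrt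
  exact hr ⟨hrt.1.le, hrt.2.trans ht.2⟩

lemma sum_smul_volterraKernel (u v : Vec d) (z : ℝ × ℝ) :
    ∑ μ, ∑ ν, (u μ * v ν) • volterraKernel a a' x μ ν z
      = extIcc (propagator (pullback a x)) 1 *
        if z.2 ≤ z.1 then
          conjP a x z.1 (curv (a (extIcc (primitive x) z.1)) (a' (extIcc (primitive x) z.1)) u (x z.1))
          * conjP a x z.2 (curv (a (extIcc (primitive x) z.2)) (a' (extIcc (primitive x) z.2)) v (x z.2))
        else
          conjP a x z.2 (curv (a (extIcc (primitive x) z.2)) (a' (extIcc (primitive x) z.2)) v (x z.2))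
          * conjP a x z.1
            (curv (a (extIcc (primitive x) z.1)) (a' (extIcc (primitive x) z.1)) u (x z.1)) := by
  have e : ∀ (w : Vec d) (t : ℝ),
      conjP a x t (curv (a (extIcc (primitive x) t)) (a' (extIcc (primitive x) t)) w (x t))
        = ∑ μ, w μ • curvDensity a a' x μ t := fun w t =>
    linear_eq_sum ((conjL a x t).comp ((curvL (a (extIcc (primitive x) t))
      (a' (extIcc (primitive x) t))).flip (x t))) w
  rw [e u, e v]
  simp only [volterraKernel, ← mul_smul_comm, ← Finset.mul_sum]
  congr 1
  split_ifs
  · simp only [Finset.sum_mul_sum, smul_mul_smul_comm]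
  -- On this triangle the factor with `v` comes first, so the order of summation is exchanged.
  · rw [Finset.sum_comm]
    simp only [Finset.sum_mul_sum, smul_mul_smul_comm, mul_comm]

lemma sum_smul_levyKernel (u v : Vec d) (t : ℝ) :
    ∑ μ, ∑ ν, (u μ * v ν) • levyKernel a a' a'' x μ ν t
      = extIcc (propagator (pullback a x)) 1 * ((-(1 / 2) : ℝ) • conjP a x t
        (covCurv (a (extIcc (primitive x) t)) (a' (extIcc (primitive x) t))
          (a'' (extIcc (primitive x) t)) u v (x t)
        + covCurv (a (extIcc (primitive x) t)) (a' (extIcc (primitive x) t))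
          (a'' (extIcc (primitive x) t)) v u (x t))) := by
  set B := covCurvL (a (extIcc (primitive x) t)) (a' (extIcc (primitive x) t))
          (a'' (extIcc (primitive x) t)) (x t)
  exact (bilinear_eq_sum ((B + B.flip).compr₂ ((LinearMap.mulLeft ℝ
    (extIcc (propagator (pullback a x)) 1)).comp ((-(1 / 2) : ℝ) • conjL a x t))) u v).symm

lemma sum_smul_singularKernel (u v u' v' : Vec d) (t : ℝ) :
    ∑ μ, ∑ ν, (u' μ * v ν + v' μ * u ν) • singularKernel a a' x μ ν t
      = extIcc (propagator (pullback a x)) 1 * conjP a x t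
        (curv (a (extIcc (primitive x) t)) (a' (extIcc (primitive x) t)) u' v
        + curv (a (extIcc (primitive x) t)) (a' (extIcc (primitive x) t)) v' u) := by
  set L := (LinearMap.mulLeft ℝ (extIcc (propagator (pullback a x)) 1)).comp (conjL a x t) with hL
  set B := curvL (a (extIcc (primitive x) t)) (a' (extIcc (primitive x) t))
  have e : ∀ y z : Vec d, L (B y z) = ∑ μ, ∑ ν, (y μ * z ν) • singularKernel a a' x μ ν t :=
    fun y z => bilinear_eq_sum (B.compr₂ L) y z
  simp only [add_smul, Finset.sum_add_distrib, ← e, ← map_add]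
  rfl

/-- The kernels represent the second derivative of the holonomy. -/
theorem isKernelRep_holonomy [CompleteSpace R] [IsDedekindFiniteMonoid R]
    (h2 : ContDiff ℝ 2 a)
    (ha : ∀ y, HasFDerivAt a (a' y) y)
    (ha' : ∀ y, HasFDerivAt a' (a'' y) y) (hsymm : ∀ y z w, a'' y z w = a'' y w z)
    {path : E → ℝ → Vec d} {T : E →L[ℝ] Lp (Vec d) 1 vol01} (hT : IsVelocityMap path T) (σ : E) :
    IsKernelRep path (secondDeriv (fun σ => holonomy a (T σ)) σ)
      (volterraKernel a a' (T σ)) (levyKernel a a' a'' (T σ)) (singularKernel a a' (T σ)) where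
  integrable_volterra μ ν :=
    (integrable_triangle (integrable_vol01.2 (intervalIntegrable_curvDensity μ))
      (integrable_vol01.2 (intervalIntegrable_curvDensity ν))).const_mul _
  integrable_levy μ ν :=
    have c1 := a.continuous.comp (continuous_extIcc (primitive (T σ)))
    have c2 := a'.continuous.comp (continuous_extIcc (primitive (T σ)))
    have c3 := a''.continuous.comp (continuous_extIcc (primitive (T σ)))
    (integrable_vol01.2 ((intervalIntegrable_conjP
      ((intervalIntegrable_covCurv c1 c2 c3 continuous_const continuous_const
        (intervalIntegrable_coeFn _)).add
      (intervalIntegrable_covCurv c1 c2 c3 continuous_const continuous_const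
        (intervalIntegrable_coeFn _)))).smul (-(1 / 2) : ℝ))).const_mul _
  bounded_singular μ ν := by
    -- Unlike the other two kernels this one does not contain the velocity, so it is continuous and
    -- therefore bounded on `[0,1]`.
    have hc : Continuous (singularKernel a a' (T σ) μ ν) :=
      continuous_const.mul (((continuous_extIcc _).mul (continuous_curv
        (a.continuous.comp (continuous_extIcc _)) (a'.continuous.comp (continuous_extIcc _))
        continuous_const continuous_const)).mul (continuous_extIcc _))
    obtain ⟨C, hC⟩ := isCompact_Icc.exists_bound_of_continuousOn (s := Icc (0 : ℝ) 1)
      hc.continuousOn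
    refine memLp_top_of_bound hc.aestronglyMeasurable C ?_
    filter_upwards [ae_restrict_mem measurableSet_Icc] with t ht using hC t ht
  symm_levy μ ν := .of_forall fun t => by
    rw [levyKernel, levyKernel, add_comm]
  antisymm_singular μ ν := .of_forall fun t => by
    rw [Pi.neg_apply, singularKernel, singularKernel, curv_swap]
    simp [conjP]
  repr u v hu hv := by
    set x := T σ with hx
    set P := extIcc (propagator (pullback a x)) with hP
    set Q := extIcc (coPropagator (pullback a x)) with hQ
    set γ := extIcc (primitive x) with hγ
    set U := extIcc (primitive (T u)) with hU
    set V := extIcc (primitive (T v)) with hV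
    have I1 : (1 : ℝ) ∈ Icc (0 : ℝ) 1 := right_mem_Icc.2 zero_le_one
    have hU1 : U 1 = 0 := by rw [hU, ← hT.path_eq u 1 I1, hu]
    have hV1 : V 1 = 0 := by rw [hV, ← hT.path_eq v 1 I1, hv]
    -- Elements of `L_1` have their pointwise formulas only almost everywhere; they are substituted
    -- under the integrals before the integration by parts.
    have hb : ∀ y : Lp (Vec d) 1 vol01, (fun t => Q t * pullback₁ a a' x y t * P t) =ᵐ[vol01]
        fun t => Q t * (a' (γ t) (extIcc (primitive y) t) (x t) + a (γ t) (y t)) * P t := fun y => by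
      filter_upwards [coeFn_pullback₁ (a := a) (a' := a') x y] with t ht
      rw [ht]
    have hbb : ∀ y z : Lp (Vec d) 1 vol01,
        ∫ t in (0 : ℝ)..1, Q t * pullback₁ a a' x y t * P t
          * ∫ s in (0 : ℝ)..t, Q s * pullback₁ a a' x z s * P s
        = ∫ t in (0 : ℝ)..1, Q t * (a' (γ t) (extIcc (primitive y) t) (x t) + a (γ t) (y t)) * P t
          * ∫ s in (0 : ℝ)..t,
            Q s * (a' (γ s) (extIcc (primitive z) s) (x s) + a (γ s) (z s)) * P s := fun y z => by
      refine intervalIntegral_congr_vol01 ?_ I1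
      filter_upwards [hb y, ae_restrict_mem measurableSet_Icc] with t h1 h2
      rw [h1, intervalIntegral_congr_vol01 (hb z) h2]
    have hb2 : ∫ t in (0 : ℝ)..1, Q t * pullback₂ a' a'' x (T u) (T v) t * P t
        = ∫ t in (0 : ℝ)..1, Q t * (a'' (γ t) (U t) (V t) (x t) + a' (γ t) (V t) (T u t)
          + a' (γ t) (U t) (T v t)) * P t := by
      refine intervalIntegral_congr_vol01 ?_ I1
      filter_upwards [coeFn_pullback₂ (a' := a') (a'' := a'') x (T u) (T v)] with t ht
      rw [ht]
    have c1 := a.continuous.comp (continuous_extIcc (primitive (T σ)))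
    have c2 := a'.continuous.comp (continuous_extIcc (primitive (T σ)))
    have c3 := a''.continuous.comp (continuous_extIcc (primitive (T σ)))
    have cU : Continuous U := continuous_extIcc _
    have cV : Continuous V := continuous_extIcc _
    have ix := intervalIntegrable_coeFn x
    have icurv : ∀ {Z : ℝ → Vec d} {z : ℝ → Vec d}, Continuous Z → IntervalIntegrable z volume 0 1 →
        IntervalIntegrable (fun t => curv (a (γ t)) (a' (γ t)) (Z t) (z t)) volume 0 1 :=
      fun hZ hz => intervalIntegrable_curv c1 c2 hZ hz
    have ilocal : IntervalIntegrable (fun t => (-(1 / 2) : ℝ) • conjP a x t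
        (covCurv (a (γ t)) (a' (γ t)) (a'' (γ t)) (U t) (V t) (x t)
        + covCurv (a (γ t)) (a' (γ t)) (a'' (γ t)) (V t) (U t) (x t))) volume 0 1 :=
      (intervalIntegrable_conjP ((intervalIntegrable_covCurv c1 c2 c3 cU cV ix).add
        (intervalIntegrable_covCurv c1 c2 c3 cV cU ix))).smul (-(1 / 2) : ℝ)
    have ising : IntervalIntegrable (fun t => conjP a x t (curv (a (γ t)) (a' (γ t)) (T u t) (V t)
        + curv (a (γ t)) (a' (γ t)) (T v t) (U t))) volume 0 1 := by
      refine intervalIntegrable_conjP (.add ?_ ?_)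
      · simp_rw [fun t => curv_swap (a := a (γ t)) (a' := a' (γ t)) (T u t) (V t)]
        exact (icurv cV (intervalIntegrable_coeFn _)).neg
      · simp_rw [fun t => curv_swap (a := a (γ t)) (a' := a' (γ t)) (T v t) (U t)]
        exact (icurv cU (intervalIntegrable_coeFn _)).neg
    have iφ : ∀ {Z : ℝ → Vec d}, Continuous Z → Integrable (fun t => conjP a x t
        (curv (a (γ t)) (a' (γ t)) (Z t) (x t))) vol01 :=
      fun hZ => integrable_vol01.2 (intervalIntegrable_conjP (icurv hZ ix))
    have t1 : ∫ z, ∑ μ, ∑ ν, (path u z.1 μ * path v z.2 ν) • volterraKernel a a' x μ ν z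
        ∂(vol01.prod vol01) = P 1 * ((∫ t in (0 : ℝ)..1, conjP a x t
          (curv (a (γ t)) (a' (γ t)) (U t) (x t)) * ∫ s in (0 : ℝ)..t, conjP a x s
          (curv (a (γ s)) (a' (γ s)) (V s) (x s))) + ∫ t in (0 : ℝ)..1, conjP a x t
          (curv (a (γ t)) (a' (γ t)) (V t) (x t)) * ∫ s in (0 : ℝ)..t, conjP a x s
          (curv (a (γ s)) (a' (γ s)) (U s) (x s))) := by
      rw [← integral_triangle (iφ cU) (iφ cV),
        ← integral_const_mul_of_integrable (integrable_triangle (iφ cU) (iφ cV))]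
      refine integral_congr_ae ?_
      rw [Measure.prod_restrict]
      filter_upwards [ae_restrict_mem (measurableSet_Icc.prod measurableSet_Icc)] with z hz
      rw [hT.path_eq u _ hz.1, hT.path_eq v _ hz.2, sum_smul_volterraKernel]
    have t2 : ∫ t, ∑ μ, ∑ ν, (path u t μ * path v t ν) • levyKernel a a' a'' x μ ν t ∂vol01
        = P 1 * ∫ t in (0 : ℝ)..1, (-(1 / 2) : ℝ) • conjP a x t
        (covCurv (a (γ t)) (a' (γ t)) (a'' (γ t)) (U t) (V t) (x t)
        + covCurv (a (γ t)) (a' (γ t)) (a'' (γ t)) (V t) (U t) (x t)) := by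
      rw [← integral_vol01, ← integral_const_mul_of_integrable (integrable_vol01.2 ilocal)]
      refine integral_congr_ae ?_
      filter_upwards [ae_restrict_mem measurableSet_Icc] with t ht
      rw [hT.path_eq u _ ht, hT.path_eq v _ ht, sum_smul_levyKernel]
    have t3 : ∫ t, ∑ μ, ∑ ν, (velocity (path u) t μ * path v t ν
          + velocity (path v) t μ * path u t ν) • singularKernel a a' x μ ν t ∂vol01
        = P 1 * ∫ t in (0 : ℝ)..1, conjP a x t (curv (a (γ t)) (a' (γ t)) (T u t) (V t)
        + curv (a (γ t)) (a' (γ t)) (T v t) (U t)) := by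
      rw [← integral_vol01, ← integral_const_mul_of_integrable (integrable_vol01.2 ising)]
      refine integral_congr_ae ?_
      filter_upwards [ae_restrict_mem measurableSet_Icc, hT.velocity_eq u, hT.velocity_eq v]
        with t ht h1 h2
      rw [hT.path_eq u _ ht, hT.path_eq v _ ht, h1, h2, sum_smul_singularKernel]
    rw [t1, t2, t3, secondDeriv_comp (contDiff_holonomy (n := 2) h2) T σ u v,
      secondDeriv_holonomy h2 ha ha' x (T u) (T v) hP hQ, hbb, hbb, hb2,
      second_variation ha ha' hsymm x (T u) (T v) hP hQ hγ hU hV hU1 hV1]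
    rw [mul_add, mul_add _ _ (∫ t in (0 : ℝ)..1, _), mul_smul_comm]
    rfl

end Kernels

/-! ### The Lévy trace of the second derivative of the parallel transport -/

section FDeriv

variable {W R : Type*} [NormedAddCommGroup W] [NormedSpace ℝ W] [NormedRing R] [NormedAlgebra ℝ R]

/-- The product rule produces the part of `covCurv` without the commutator with `a e`. This
identifies the algebraic expression in the 2-jet with an actual covariant derivative of the
curvature. -/
lemma fderiv_curv {a : W → W →L[ℝ] R} {a' : W → W →L[ℝ] W →L[ℝ] R}
    {a'' : W →L[ℝ] W →L[ℝ] W →L[ℝ] R} {x : W} (ha : HasFDerivAt a (a' x) x)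
    (ha' : HasFDerivAt a' a'' x) (e y z : W) :
    fderiv ℝ (fun x => curv (a x) (a' x) y z) x e
      + (a x e * curv (a x) (a' x) y z - curv (a x) (a' x) y z * a x e)
      = covCurv (a x) (a' x) a'' e y z := by
  have h1 : ∀ w, HasFDerivAt (fun x => a x w) ((a' x).flip w) x := fun w => by
    simpa using ha.clm_apply (hasFDerivAt_const w x)
  have h2 : ∀ w w', HasFDerivAt (fun x => a' x w w') ((a''.flip w).flip w') x := fun w w' => by
    have := (ha'.clm_apply (hasFDerivAt_const w x)).clm_apply (hasFDerivAt_const w' x)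
    refine this.congr_fderiv ?_
    ext u
    simp
  have h3 := ((h2 y z).sub (h2 z y)).add
    (((h1 y).mul' (h1 z)).sub ((h1 z).mul' (h1 y)))
  have h4 : HasFDerivAt (fun x => curv (a x) (a' x) y z) _ x := h3
  rw [h4.fderiv, covCurv]
  simp
  abel

lemma covCurv_swap (a : W →L[ℝ] R) (a' : W →L[ℝ] W →L[ℝ] R)
    (a'' : W →L[ℝ] W →L[ℝ] W →L[ℝ] R) (e y z : W) :
    covCurv a a' a'' e y z = -covCurv a a' a'' e z y := by
  simp only [covCurv, curv]
  noncomm_ring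

/-- `covCurvL` records linearity in the first two arguments only; antisymmetry carries it over to
the third. -/
lemma covCurv_eq_sum {d : ℕ} (a : Vec d →L[ℝ] R) (a' : Vec d →L[ℝ] Vec d →L[ℝ] R)
    (a'' : Vec d →L[ℝ] Vec d →L[ℝ] Vec d →L[ℝ] R) (e y z : Vec d) :
    covCurv a a' a'' e y z = ∑ ν, z ν • covCurv a a' a'' e y (basisVec ν) := by
  have h := linear_eq_sum (covCurvL a a' a'' y e) z
  simp only [covCurvL_apply] at h
  rw [covCurv_swap, h, ← Finset.sum_neg_distrib]
  refine Finset.sum_congr rfl fun ν _ => ?_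
  rw [covCurv_swap a a' a'' e y, smul_neg]

end FDeriv

/-! ### A connection form and its derivatives as continuous maps -/

section Jets

set_option maxSynthPendingDepth 5

variable {d : ℕ} {R : Type} [NormedRing R] [NormedAlgebra ℝ R] {B : Vec d → Fin d → R}

/-- The value at a point of the 1-form with components `B_ν`, as a linear map. -/
def formClm (B : Vec d → Fin d → R) (x : Vec d) : Vec d →L[ℝ] R :=
  ∑ ν, (EuclideanSpace.proj ν : Vec d →L[ℝ] ℝ).smulRight (B x ν)

lemma formClm_apply (x v : Vec d) : formClm B x v = ∑ ν, v ν • B x ν := by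
  simp [formClm]

lemma formClm_basisVec (x : Vec d) (ν : Fin d) : formClm B x (basisVec ν) = B x ν := by
  simp [formClm_apply]

lemma contDiff_formClm (hB : ∀ ν, ContDiff ℝ ∞ fun x => B x ν) : ContDiff ℝ ∞ (formClm B) :=
  ContDiff.sum fun ν _ => ((ContinuousLinearMap.smulRightL ℝ (Vec d) R
    (EuclideanSpace.proj ν)).contDiff).comp (hB ν)

lemma contDiff_fderiv_formClm (hB : ∀ ν, ContDiff ℝ ∞ fun x => B x ν) :
    ContDiff ℝ ∞ (fderiv ℝ (formClm B)) :=
  (contDiff_formClm hB).fderiv_right (by exact_mod_cast le_rfl)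

lemma contDiff_fderiv_fderiv_formClm (hB : ∀ ν, ContDiff ℝ ∞ fun x => B x ν) :
    ContDiff ℝ ∞ (fderiv ℝ (fderiv ℝ (formClm B))) :=
  (contDiff_fderiv_formClm hB).fderiv_right (by exact_mod_cast le_rfl)

/-- A smooth 1-form as a continuous map. -/
def jet₀ (hB : ∀ ν, ContDiff ℝ ∞ fun x => B x ν) : C(Vec d, Vec d →L[ℝ] R) :=
  ⟨formClm B, (contDiff_formClm hB).continuous⟩

/-- The first derivative of a smooth 1-form. -/
def jet₁ (hB : ∀ ν, ContDiff ℝ ∞ fun x => B x ν) : C(Vec d, Vec d →L[ℝ] Vec d →L[ℝ] R) :=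
  ⟨fderiv ℝ (formClm B), (contDiff_fderiv_formClm hB).continuous⟩

/-- The second derivative of a smooth 1-form. -/
def jet₂ (hB : ∀ ν, ContDiff ℝ ∞ fun x => B x ν) :
    C(Vec d, Vec d →L[ℝ] Vec d →L[ℝ] Vec d →L[ℝ] R) :=
  ⟨fderiv ℝ (fderiv ℝ (formClm B)), (contDiff_fderiv_fderiv_formClm hB).continuous⟩

variable (hB : ∀ ν, ContDiff ℝ ∞ fun x => B x ν)

lemma jet₀_basisVec (x : Vec d) (ν : Fin d) : jet₀ hB x (basisVec ν) = B x ν :=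
  formClm_basisVec x ν

lemma jet₀_apply (x v : Vec d) : jet₀ hB x v = ∑ ν, v ν • B x ν :=
  formClm_apply x v

lemma contDiff_jet₀ : ContDiff ℝ 2 (jet₀ hB) :=
  (contDiff_formClm hB).of_le (WithTop.coe_le_coe.2 (le_top : (2 : ℕ∞) ≤ ⊤))

lemma hasFDerivAt_jet₀ (y : Vec d) : HasFDerivAt (jet₀ hB) (jet₁ hB y) y :=
  ((contDiff_formClm hB).differentiable (by simp) y).hasFDerivAt

lemma hasFDerivAt_jet₁ (y : Vec d) : HasFDerivAt (jet₁ hB) (jet₂ hB y) y :=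
  ((contDiff_fderiv_formClm hB).differentiable (by simp) y).hasFDerivAt

lemma jet₂_symm (y z w : Vec d) : jet₂ hB y z w = jet₂ hB y w z :=
  second_derivative_symmetric (hasFDerivAt_jet₀ hB) (hasFDerivAt_jet₁ hB y) z w

lemma fderiv_form (μ ν : Fin d) (x : Vec d) :
    fderiv ℝ (fun y => B y ν) x (basisVec μ) = jet₁ hB x (basisVec μ) (basisVec ν) := by
  have h := (hasFDerivAt_jet₀ hB x).clm_apply (hasFDerivAt_const (basisVec ν) x)
  have h' : HasFDerivAt (fun y => B y ν) _ x :=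
    h.congr_of_eventuallyEq (.of_forall fun y => (formClm_basisVec y ν).symm)
  rw [h'.fderiv]
  simp

lemma continuous_covCurv_jet (u v w : Vec d) :
    Continuous fun x => covCurv (jet₀ hB x) (jet₁ hB x) (jet₂ hB x) u v w := by
  have c0 : ∀ v, Continuous fun x => jet₀ hB x v := fun v =>
    (jet₀ hB).continuous.clm_apply continuous_const
  have c1 : ∀ v w, Continuous fun x => jet₁ hB x v w := fun v w =>
    ((jet₁ hB).continuous.clm_apply continuous_const).clm_apply continuous_const
  have c2 : ∀ u v w, Continuous fun x => jet₂ hB x u v w := fun u v w =>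
    (((jet₂ hB).continuous.clm_apply continuous_const).clm_apply continuous_const).clm_apply
      continuous_const
  unfold covCurv curv
  fun_prop

/-- Contraction with a symmetric matrix makes the two halves of the symmetrised Lévy kernel equal,
so its factor `-1/2` becomes `-1`. -/
lemma sum_smul_conj {R : Type} [NormedRing R] [NormedAlgebra ℝ R]
    {a : C(Vec d, Vec d →L[ℝ] R)} {a' : C(Vec d, Vec d →L[ℝ] Vec d →L[ℝ] R)}
    {a'' : C(Vec d, Vec d →L[ℝ] Vec d →L[ℝ] Vec d →L[ℝ] R)} {x : Lp (Vec d) 1 vol01}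
    {h : Matrix (Fin d) (Fin d) ℝ} (hh : h.IsSymm) (t : ℝ) :
    ∑ μ, ∑ ν, h μ ν • levyKernel a a' a'' x μ ν t
      = -(extIcc (propagator (pullback a x)) 1 * conjP a x t (∑ ρ, x t ρ • ∑ μ, ∑ ν, h μ ν •
        covCurv (a (extIcc (primitive x) t)) (a' (extIcc (primitive x) t))
          (a'' (extIcc (primitive x) t)) (basisVec μ) (basisVec ν) (basisVec ρ))) := by
  set L := (LinearMap.mulLeft ℝ (extIcc (propagator (pullback a x)) 1)).comp (conjL a x t) with hL
  set D := fun y z w => covCurv (a (extIcc (primitive x) t)) (a' (extIcc (primitive x) t))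
          (a'' (extIcc (primitive x) t)) y z w with hD
  have e : ∀ μ ν, levyKernel a a' a'' x μ ν t = (-(1 / 2) : ℝ) •
      (L (D (basisVec μ) (basisVec ν) (x t)) + L (D (basisVec ν) (basisVec μ) (x t))) := by
    intro μ ν
    rw [← map_add, ← map_smul, hL, LinearMap.comp_apply, map_smul]
    rfl
  have s : ∑ μ, ∑ ν, h μ ν • L (D (basisVec ν) (basisVec μ) (x t))
      = ∑ μ, ∑ ν, h μ ν • L (D (basisVec μ) (basisVec ν) (x t)) := by
    rw [Finset.sum_comm]
    simp_rw [fun μ ν => hh.apply μ ν]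
  have r : ∑ ρ, x t ρ • ∑ μ, ∑ ν, h μ ν • D (basisVec μ) (basisVec ν) (basisVec ρ)
      = ∑ μ, ∑ ν, h μ ν • D (basisVec μ) (basisVec ν) (x t) := by
    simp_rw [Finset.smul_sum, smul_comm (x t _)]
    rw [Finset.sum_comm]
    refine Finset.sum_congr rfl fun μ _ => ?_
    rw [Finset.sum_comm]
    refine Finset.sum_congr rfl fun ν _ => ?_
    rw [← Finset.smul_sum, hD]
    simp only [← covCurv_eq_sum]
  change _ = -(L _)
  rw [r]
  simp only [e, smul_comm (h _ _), smul_add, ← Finset.smul_sum, Finset.sum_add_distrib, s, map_sum,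
    map_smul]
  module


end Jets

/-! ### The divergence of the curvature as a Lévy trace -/

section Form

set_option maxSynthPendingDepth 5

variable {d N : ℕ} {G : Subgroup (Matrix.unitaryGroup (Fin N) ℂ)} (A : Connection d G)

lemma curvature_eq_curv (μ ν : Fin d) (x : Vec d) :
    curvature A μ ν x
      = curv (jet₀ A.smooth x) (jet₁ A.smooth x) (basisVec μ) (basisVec ν) := by
  unfold curv
  rw [← fderiv_form A.smooth, ← fderiv_form A.smooth, jet₀_basisVec, jet₀_basisVec]
  rfl

lemma covD_curvature (l μ ν : Fin d) (x : Vec d) :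
    covD A l (curvature A μ ν) x
      = covCurv (jet₀ A.smooth x) (jet₁ A.smooth x) (jet₂ A.smooth x)
        (basisVec l) (basisVec μ) (basisVec ν) := by
  rw [← fderiv_curv (hasFDerivAt_jet₀ A.smooth x) (hasFDerivAt_jet₁ A.smooth x), jet₀_basisVec,
    ← curvature_eq_curv, ← funext (curvature_eq_curv A μ ν)]
  rfl

/-- The 1-form `h^{λμ} ∇_λ F_{μν}`. -/
def divCurvature (h : Matrix (Fin d) (Fin d) ℝ) (x : Vec d) (ν : Fin d) :
    Matrix (Fin N) (Fin N) ℂ :=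
  ∑ l, ∑ μ, h l μ • covD A l (curvature A μ ν) x

lemma continuous_divCurvature (h : Matrix (Fin d) (Fin d) ℝ) (ν : Fin d) :
    Continuous fun x => divCurvature A h x ν := by
  refine continuous_finsetSum _ fun l _ => continuous_finsetSum _ fun μ _ => ?_
  simp only [covD_curvature]
  exact (continuous_covCurv_jet A.smooth _ _ _).const_smul (h l μ)

variable {A}

lemma along_ae_eq {γ : ℝ → Vec d} {x : Lp (Vec d) 1 vol01}
    (hγ : ∀ t ∈ Icc (0 : ℝ) 1, γ t = extIcc (primitive x) t) (hv : velocity γ =ᵐ[vol01] x) :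
    along A.form γ =ᵐ[vol01] pullback (jet₀ A.smooth) x := by
  filter_upwards [coeFn_pullback (a := jet₀ A.smooth) x, hv, ae_restrict_mem measurableSet_Icc]
    with t h1 h2 h3
  rw [h1, ← hγ t h3, along, h2]
  exact (jet₀_apply A.smooth _ _).symm

variable {E : Type} [NormedAddCommGroup E] [NormedSpace ℝ E]
  {path : E → ℝ → Vec d} {T : E →L[ℝ] Lp (Vec d) 1 vol01}

lemma transport_eq_holonomy (hT : IsVelocityMap path T) :
    (fun σ => transport A (path σ) 1 0) = fun σ => holonomy (jet₀ A.smooth) (T σ) := by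
  funext σ
  rw [transport_zero_right (along_ae_eq (hT.path_eq σ) (hT.velocity_eq σ))
    (right_mem_Icc.2 zero_le_one), holonomy]
  exact extIcc_coe _ 1

lemma contDiff_transport (hT : IsVelocityMap path T) :
    ContDiff ℝ 2 fun σ => transport A (path σ) 1 0 := by
  rw [transport_eq_holonomy hT]
  exact (contDiff_holonomy (n := 2) (contDiff_jet₀ A.smooth)).comp
    T.contDiff

/-- The trace of the explicit Lévy kernel is the current integral of the divergence of the
curvature, since `U_{1,t} = P(1) Q(t)` and `U_{t,0} = P(t)`. No field equation enters. -/
lemma hasLevyTrace_transport (hT : IsVelocityMap path T) {g : Matrix (Fin d) (Fin d) ℝ}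
    (hg : g⁻¹.IsSymm) (σ : E) :
    HasLevyTrace g path (secondDeriv (fun σ => transport A (path σ) 1 0) σ)
      (currentIntegral A (divCurvature A g⁻¹) (path σ)) := by
  have hb := along_ae_eq (A := A) (hT.path_eq σ) (hT.velocity_eq σ)
  refine ⟨volterraKernel (jet₀ A.smooth) (jet₁ A.smooth) (T σ), levyKernel (jet₀ A.smooth) (jet₁ A.smooth) (jet₂ A.smooth) (T σ),
    singularKernel (jet₀ A.smooth) (jet₁ A.smooth) (T σ), ?_, ?_⟩
  · rw [transport_eq_holonomy hT]
    exact isKernelRep_holonomy (contDiff_jet₀ A.smooth)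
      (hasFDerivAt_jet₀ A.smooth) (hasFDerivAt_jet₁ A.smooth) (jet₂_symm A.smooth) hT σ
  · rw [currentIntegral, ← integral_vol01, ← integral_neg]
    refine integral_congr_ae ?_
    filter_upwards [hT.velocity_eq σ, ae_restrict_mem measurableSet_Icc] with t h1 ht
    rw [sum_smul_conj hg, transport_one_left hb ht, transport_zero_right hb ht, along, h1,
      hT.path_eq σ t ht]
    simp only [divCurvature, covD_curvature, conjP, mul_assoc]

end Form

/-! ### Uniqueness of the Lévy trace -/

/-! ### Limits of oscillating integrals -/

section RiemannLebesgue

open Filter Topology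

variable {F : Type*} [NormedAddCommGroup F] [NormedSpace ℂ F]

lemma tendsto_neg_cocompact {w : ℕ → ℝ} (hw : Tendsto w atTop (cocompact ℝ)) :
    Tendsto (fun n => -w n) atTop (cocompact ℝ) :=
  (Homeomorph.neg ℝ).isClosedEmbedding.tendsto_cocompact.comp hw

/-- The Riemann–Lebesgue lemma below is applied for the real structure induced from `ℂ`, whereas the
target may carry its own; compatibility of the scalars forces the two to agree. -/
lemma eq_complexToReal {iR : NormedSpace ℝ F} (h : IsScalarTower ℝ ℂ F) :
    iR = NormedSpace.complexToReal := by
  have : iR.toModule = NormedSpace.complexToReal.toModule := by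
    ext r x
    exact (algebraMap_smul ℂ r x).symm
  cases iR
  congr

lemma tendsto_integral_exp_mul_smul {iR : NormedSpace ℝ F} [hR : IsScalarTower ℝ ℂ F] (f : ℝ → F) {w : ℕ → ℝ} (hw : Tendsto w atTop (cocompact ℝ)) :
    Tendsto (fun n => ∫ t, Complex.exp (2 * Real.pi * w n * t * Complex.I) • f t ∂vol01)
      atTop (𝓝 0) := by
  obtain rfl := eq_complexToReal hR
  -- The Fourier character carries a minus sign, hence the frequencies `-w n`.
  have h := (Real.tendsto_integral_exp_smul_cocompact ((Icc (0 : ℝ) 1).indicator f)).comp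
    (tendsto_neg_cocompact hw)
  refine h.congr fun n => ?_
  rw [← integral_indicator measurableSet_Icc]
  refine integral_congr_ae (.of_forall fun t => ?_)
  simp only [indicator]
  split_ifs
  · rw [Circle.smul_def, Real.fourierChar_apply]
    congr 2
    push_cast
    ring
  · simp

lemma integrable_exp_mul_smul {f : ℝ → F} (hf : Integrable f vol01) (w : ℝ) :
    Integrable (fun t : ℝ => Complex.exp (2 * Real.pi * w * t * Complex.I) • f t) vol01 := by
  refine hf.bdd_smul (C := 1) (Continuous.aestronglyMeasurable (by fun_prop)) (.of_forall fun t => ?_)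
  have : 2 * Real.pi * w * t * Complex.I = ((2 * Real.pi * w * t : ℝ) : ℂ) * Complex.I := by
    push_cast; ring
  rw [this, Complex.norm_exp_ofReal_mul_I]

variable [NormedSpace ℝ F] [IsScalarTower ℝ ℂ F]

lemma tendsto_integral_cos_smul {f : ℝ → F} (hf : Integrable f vol01) {w : ℕ → ℝ}
    (hw : Tendsto w atTop (cocompact ℝ)) :
    Tendsto (fun n => ∫ t, Real.cos (2 * Real.pi * w n * t) • f t ∂vol01) atTop (𝓝 0) := by
  have h := ((tendsto_integral_exp_mul_smul f hw).add (tendsto_integral_exp_mul_smul f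
    (tendsto_neg_cocompact hw))).const_smul (1 / 2 : ℂ)
  rw [add_zero, smul_zero] at h
  refine h.congr fun n => ?_
  rw [← integral_add (integrable_exp_mul_smul hf _) (integrable_exp_mul_smul hf _),
    ← integral_smul]
  refine integral_congr_ae (.of_forall fun t => ?_)
  simp only
  rw [← add_smul, smul_smul, ← algebraMap_smul ℂ (_ : ℝ) (f t), Complex.coe_algebraMap, Complex.ofReal_cos, Complex.cos]
  congr 1
  push_cast
  ring_nf

lemma tendsto_integral_sin_smul {f : ℝ → F} (hf : Integrable f vol01) {w : ℕ → ℝ}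
    (hw : Tendsto w atTop (cocompact ℝ)) :
    Tendsto (fun n => ∫ t, Real.sin (2 * Real.pi * w n * t) • f t ∂vol01) atTop (𝓝 0) := by
  have h := ((tendsto_integral_exp_mul_smul f (tendsto_neg_cocompact hw)).sub
    (tendsto_integral_exp_mul_smul f hw)).const_smul (Complex.I / 2 : ℂ)
  rw [sub_zero, smul_zero] at h
  refine h.congr fun n => ?_
  rw [← integral_sub (integrable_exp_mul_smul hf _) (integrable_exp_mul_smul hf _),
    ← integral_smul]
  refine integral_congr_ae (.of_forall fun t => ?_)
  simp only
  rw [← sub_smul, smul_smul, ← algebraMap_smul ℂ (_ : ℝ) (f t), Complex.coe_algebraMap, Complex.ofReal_sin, Complex.sin]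
  congr 1
  push_cast
  ring_nf

/-- `sin² θ = (1 - cos 2θ) / 2`, and the cosine part tends to zero. The mean value `1/2` is what
detects the Lévy kernel. -/
lemma tendsto_integral_sin_sq_smul {f : ℝ → F} (hf : Integrable f vol01) {w : ℕ → ℝ}
    (hw : Tendsto w atTop (cocompact ℝ)) :
    Tendsto (fun n => ∫ t, (Real.sin (2 * Real.pi * w n * t) * Real.sin (2 * Real.pi * w n * t)) • f t
      ∂vol01) atTop (𝓝 ((1 / 2 : ℝ) • ∫ t, f t ∂vol01)) := by
  have hw2 : Tendsto (fun n => 2 * w n) atTop (cocompact ℝ) :=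
    (Homeomorph.mulLeft₀ (2 : ℝ) two_ne_zero).isClosedEmbedding.tendsto_cocompact.comp hw
  have h := ((tendsto_const_nhds (x := ∫ t, f t ∂vol01)).sub
    (tendsto_integral_cos_smul hf hw2)).const_smul (1 / 2 : ℝ)
  rw [sub_zero] at h
  refine h.congr fun n => ?_
  have hi : Integrable (fun t => Real.cos (2 * Real.pi * (2 * w n) * t) • f t) vol01 :=
    hf.bdd_smul (C := 1) (Continuous.aestronglyMeasurable (by fun_prop)) (.of_forall fun t => by
      simpa using Real.abs_cos_le_one _)
  rw [← integral_sub hf hi, ← integral_smul]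
  refine integral_congr_ae (.of_forall fun t => ?_)
  simp only
  have e : 2 * Real.pi * (2 * w n) * t = 2 * (2 * Real.pi * w n * t) := by ring
  rw [e, Real.cos_two_mul', ← one_smul ℝ (f t), smul_smul, smul_smul, ← sub_smul, smul_smul]
  congr 1
  have := Real.sin_sq_add_cos_sq (2 * Real.pi * w n * t)
  linear_combination (-(1 / 2) : ℝ) * this

/-- By Fubini the inner integral tends to zero for almost every `t`, and it is dominated by `∫ ‖K(t,
s)‖ ds`. -/
lemma tendsto_integral_sin_mul_sin_smul {K : ℝ × ℝ → F} (hK : Integrable K (vol01.prod vol01))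
    {w : ℕ → ℝ} (hw : Tendsto w atTop (cocompact ℝ)) :
    Tendsto (fun n => ∫ z, (Real.sin (2 * Real.pi * w n * z.1) * Real.sin (2 * Real.pi * w n * z.2))
      • K z ∂(vol01.prod vol01)) atTop (𝓝 0) := by
  have hi : ∀ n, Integrable (fun z : ℝ × ℝ =>
      (Real.sin (2 * Real.pi * w n * z.1) * Real.sin (2 * Real.pi * w n * z.2)) • K z)
      (vol01.prod vol01) := fun n =>
    hK.bdd_smul (C := 1) (Continuous.aestronglyMeasurable (by fun_prop)) (.of_forall fun z => by
      rw [norm_mul]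
      exact mul_le_one₀ (Real.abs_sin_le_one _) (norm_nonneg _) (Real.abs_sin_le_one _))
  have e : ∀ n, ∫ z, (Real.sin (2 * Real.pi * w n * z.1) * Real.sin (2 * Real.pi * w n * z.2))
      • K z ∂(vol01.prod vol01) = ∫ t, Real.sin (2 * Real.pi * w n * t) •
        ∫ s, Real.sin (2 * Real.pi * w n * s) • K (t, s) ∂vol01 ∂vol01 := fun n => by
    rw [integral_prod _ (hi n)]
    simp only [mul_smul, integral_smul]
  simp only [e]
  rw [show (0 : F) = ∫ t, (0 : F) ∂vol01 by simp]
  refine tendsto_integral_of_dominated_convergence (fun t => ∫ s, ‖K (t, s)‖ ∂vol01)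
    (fun n => ?_) hK.integral_norm_prod_left (fun n => ?_) ?_
  · have := (hi n).integral_prod_left.aestronglyMeasurable
    simpa only [mul_smul, integral_smul] using this
  · filter_upwards [hK.prod_right_ae] with t ht
    rw [norm_smul]
    refine (mul_le_of_le_one_left (norm_nonneg _) (Real.abs_sin_le_one _)).trans ?_
    refine norm_integral_le_of_norm_le ht.norm (.of_forall fun s => ?_)
    rw [norm_smul]
    exact mul_le_of_le_one_left (norm_nonneg _) (Real.abs_sin_le_one _)
  · filter_upwards [hK.prod_right_ae] with t ht
    refine squeeze_zero_norm (fun n => ?_) (tendsto_zero_iff_norm_tendsto_zero.1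
      (tendsto_integral_sin_smul ht hw))
    rw [norm_smul]
    exact mul_le_of_le_one_left (norm_nonneg _) (Real.abs_sin_le_one _)

end RiemannLebesgue

/-! ### Independence of the trace from the kernels -/

section Uniqueness

open Filter Topology

variable {d : ℕ} {E V : Type*} [NormedAddCommGroup E] [NormedSpace ℝ E]
  [NormedAddCommGroup V] [NormedSpace ℝ V] {path : E → ℝ → Vec d}

/-- All smooth curves that start at the origin are, on `[0,1]`, curves of the space. -/
def AttainsSmooth (path : E → ℝ → Vec d) : Prop :=
  ∀ γ : ℝ → Vec d, ContDiff ℝ ∞ γ → γ 0 = 0 → ∃ σ, ∀ t ∈ Icc (0 : ℝ) 1, path σ t = γ t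

lemma velocity_congr {γ δ : ℝ → Vec d} (h : ∀ t ∈ Icc (0 : ℝ) 1, γ t = δ t) {t : ℝ}
    (ht : t ∈ Icc (0 : ℝ) 1) : velocity γ t = velocity δ t :=
  derivWithin_congr h (h t ht)

/-- A variation in one coordinate direction sees only diagonal entries of the kernels, and the
diagonal entries of the antisymmetric singular kernel vanish almost everywhere. -/
lemma IsKernelRep.apply_self {Q : E →L[ℝ] E →L[ℝ] V} {KV : Fin d → Fin d → ℝ × ℝ → V}
    {KL KS : Fin d → Fin d → ℝ → V} (hQ : IsKernelRep path Q KV KL KS) {φ : ℝ → ℝ}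
    (hφ : Differentiable ℝ φ) (hφ1 : φ 1 = 0) {u : E} {κ : Fin d}
    (hu : ∀ t ∈ Icc (0 : ℝ) 1, path u t = φ t • basisVec κ) :
    Q u u = (∫ z, (φ z.1 * φ z.2) • KV κ κ z ∂(vol01.prod vol01))
      + ∫ t, (φ t * φ t) • KL κ κ t ∂vol01 := by
  have hu1 : path u 1 = 0 := by rw [hu 1 (right_mem_Icc.2 zero_le_one), hφ1, zero_smul]
  have hc : ∀ t ∈ Icc (0 : ℝ) 1, ∀ μ, path u t μ = if μ = κ then φ t else 0 := fun t ht μ => by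
    rw [hu t ht]
    simp [PiLp.single_apply]
  have hv : ∀ t ∈ Icc (0 : ℝ) 1, ∀ μ, velocity (path u) t μ
      = if μ = κ then derivWithin φ (Icc 0 1) t else 0 := fun t ht μ => by
    rw [velocity_congr hu ht, velocity,
      derivWithin_smul_const (hφ t).differentiableWithinAt]
    simp [PiLp.single_apply]
  rw [hQ.repr u u hu1 hu1]
  have e1 : ∫ z, ∑ μ, ∑ ν, (path u z.1 μ * path u z.2 ν) • KV μ ν z ∂(vol01.prod vol01)
      = ∫ z, (φ z.1 * φ z.2) • KV κ κ z ∂(vol01.prod vol01) := by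
    refine integral_congr_ae ?_
    rw [Measure.prod_restrict]
    filter_upwards [ae_restrict_mem (measurableSet_Icc.prod measurableSet_Icc)] with z hz
    simp [hc _ hz.1, hc _ hz.2]
  have e2 : ∫ t, ∑ μ, ∑ ν, (path u t μ * path u t ν) • KL μ ν t ∂vol01
      = ∫ t, (φ t * φ t) • KL κ κ t ∂vol01 := by
    refine integral_congr_ae ?_
    filter_upwards [ae_restrict_mem measurableSet_Icc] with t ht
    simp [hc _ ht]
  have e3 : ∫ t, ∑ μ, ∑ ν, (velocity (path u) t μ * path u t ν
      + velocity (path u) t μ * path u t ν) • KS μ ν t ∂vol01 = 0 := by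
    rw [show (0 : V) = ∫ t, (0 : V) ∂vol01 by simp]
    refine integral_congr_ae ?_
    filter_upwards [ae_restrict_mem measurableSet_Icc, hQ.antisymm_singular κ κ] with t ht h
    have h0 : (2 : ℝ) • KS κ κ t = 0 := by rw [two_smul]; exact add_eq_zero_iff_eq_neg.2 h
    have h0 : KS κ κ t = 0 := (smul_eq_zero.1 h0).resolve_left two_ne_zero
    simp [hc _ ht, hv _ ht, add_smul, Finset.sum_add_distrib, h0]
  rw [e1, e2, e3, smul_zero, add_zero]

/-- The Lévy trace does not depend on the kernels. -/
theorem HasLevyTrace.unique {F : Type*} [NormedAddCommGroup F] [NormedSpace ℂ F] [NormedSpace ℝ F]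
    [IsScalarTower ℝ ℂ F] {g : Matrix (Fin d) (Fin d) ℝ}
    (hg : ∀ μ ν, μ ≠ ν → g⁻¹ μ ν = 0) (hpath : AttainsSmooth path) {Q : E →L[ℝ] E →L[ℝ] F}
    {c c' : F} (hc : HasLevyTrace g path Q c) (hc' : HasLevyTrace g path Q c') : c = c' := by
  have hφ : ∀ n : ℕ, ContDiff ℝ ∞ fun t => Real.sin (2 * Real.pi * (n / 2 : ℝ) * t) := fun n =>
    Real.contDiff_sin.comp (contDiff_const.mul contDiff_id)
  have hs : ∀ (n : ℕ) (κ : Fin d), ∃ u : E, ∀ t ∈ Icc (0 : ℝ) 1,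
      path u t = Real.sin (2 * Real.pi * (n / 2 : ℝ) * t) • basisVec κ := fun n κ =>
    hpath _ ((hφ n).smul contDiff_const) (by simp)
  choose s hs using hs
  -- Frequency `n / 2` gives `sin(nπt)`, which vanishes at both ends.
  have hw : Tendsto (fun n : ℕ => (n / 2 : ℝ)) atTop (cocompact ℝ) :=
    (tendsto_natCast_atTop_atTop.atTop_div_const two_pos).mono_right atTop_le_cocompact
  -- The trace is a limit of quantities that involve `Q` but no kernel. The factor `2` compensates
  -- the mean value of `sin²`.
  suffices H : ∀ c, HasLevyTrace g path Q c →
      Tendsto (fun n => ∑ κ, (2 * g⁻¹ κ κ) • Q (s n κ) (s n κ)) atTop (𝓝 c) from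
    tendsto_nhds_unique (H c hc) (H c' hc')
  rintro c ⟨KV, KL, KS, hQ, rfl⟩
  have e : ∫ t, ∑ μ, ∑ ν, g⁻¹ μ ν • KL μ ν t ∂vol01
      = ∑ κ, (2 * g⁻¹ κ κ) • (0 + (1 / 2 : ℝ) • ∫ t, KL κ κ t ∂vol01) := by
    have e1 : ∀ t, ∑ μ, ∑ ν, g⁻¹ μ ν • KL μ ν t = ∑ κ, g⁻¹ κ κ • KL κ κ t := fun t =>
      Finset.sum_congr rfl fun μ _ => Finset.sum_eq_single μ
        (fun ν _ h => by rw [hg μ ν h.symm, zero_smul]) (fun h => absurd (Finset.mem_univ μ) h)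
    have e2 : ∫ t, ∑ κ, g⁻¹ κ κ • KL κ κ t ∂vol01 = ∑ κ, ∫ t, g⁻¹ κ κ • KL κ κ t ∂vol01 :=
      integral_finsetSum _ fun κ _ => (hQ.integrable_levy κ κ).smul (g⁻¹ κ κ)
    simp only [e1]
    rw [e2]
    refine Finset.sum_congr rfl fun κ _ => ?_
    rw [integral_smul, zero_add, smul_smul]
    congr 1
    ring
  rw [e]
  refine tendsto_finsetSum _ fun κ _ => Tendsto.const_smul ?_ _
  have hq : ∀ n, Q (s n κ) (s n κ) = _ := fun n =>
    hQ.apply_self ((hφ n).differentiable (by simp)) (by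
      rw [show 2 * Real.pi * (n / 2 : ℝ) * 1 = n * Real.pi by ring, Real.sin_nat_mul_pi]) (hs n κ)
  simp only [hq]
  exact (tendsto_integral_sin_mul_sin_smul (hQ.integrable_volterra κ κ) hw).add
    (tendsto_integral_sin_sq_smul (hQ.integrable_levy κ κ) hw)

end Uniqueness

/-! ### The current is determined by its integrals -/

section Rescale

variable {R : Type} [NormedRing R] [NormedAlgebra ℝ R] [CompleteSpace R]

/-- The substitution `rt` turns the hypothesis into `M ∫_0^r G = 0`, and `N` cancels `M`. The
primitive of `G` is thus zero on `[0,1]`, and so is its one-sided derivative at `1`. -/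
lemma apply_one_eq_zero_of_integral {G : ℝ → R} (hG : Continuous G)
    (h : ∀ r ∈ Icc (0 : ℝ) 1, ∃ M N : R, N * M = 1 ∧
      ∫ t in (0 : ℝ)..1, M * (r • G (r * t)) = 0) : G 1 = 0 := by
  have h0 : ∀ r ∈ Icc (0 : ℝ) 1, ∫ t in (0 : ℝ)..r, G t = 0 := by
    intro r hr
    obtain ⟨M, N, hNM, hM⟩ := h r hr
    have hc : Continuous fun t => r • G (r * t) := by fun_prop
    have hi : Integrable (fun t => r • G (r * t)) vol01 :=
      integrable_vol01.2 (hc.intervalIntegrable 0 1)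
    rw [← integral_vol01, integral_const_mul_of_integrable hi, integral_vol01,
      intervalIntegral.integral_smul, intervalIntegral.smul_integral_comp_mul_left, mul_zero,
      mul_one] at hM
    rw [← one_mul (∫ t in (0 : ℝ)..r, G t), ← hNM, mul_assoc, hM, mul_zero]
  have h1 : HasDerivWithinAt (fun r => ∫ t in (0 : ℝ)..r, G t) (G 1) (Icc 0 1) 1 :=
    (hG.integral_hasStrictDerivAt 0 1).hasDerivAt.hasDerivWithinAt
  have h2 : HasDerivWithinAt (fun r => ∫ t in (0 : ℝ)..r, G t) 0 (Icc 0 1) 1 :=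
    (hasDerivWithinAt_const (1 : ℝ) (Icc (0 : ℝ) 1) (0 : R)).congr_of_mem h0
      (right_mem_Icc.2 zero_le_one)
  exact (uniqueDiffOn_Icc zero_lt_one 1 (right_mem_Icc.2 zero_le_one)).eq_deriv _ h1 h2

variable [IsDedekindFiniteMonoid R]

/-- `t ↦ P(rt)` solves the equation with coefficient `r c(rt)`, so uniqueness applies: running along
the rescaled curve is stopping at time `r`. -/
lemma extIcc_propagator_rescale {c : ℝ → R} {b b' : Lp R 1 vol01} {r : ℝ}
    (hr : r ∈ Icc (0 : ℝ) 1) (hb : c =ᵐ[vol01] b) (hb' : (fun t => r • c (r * t)) =ᵐ[vol01] b')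
    {t : ℝ} (ht : t ∈ Icc (0 : ℝ) 1) :
    extIcc (propagator b') t = extIcc (propagator b) (r * t) := by
  have hP : IsPrimitiveOn 0 1 _ _ := (isPrimitiveOn_propagator b).congr_ae zero_le_one
    (y := fun t => -(c t * extIcc (propagator b) t)) (by filter_upwards [hb] with t ht; rw [ht])
  have h := eq_propagator_mul_coPropagator (u := fun t => extIcc (propagator b) (r * t)) hb'
    (left_mem_Icc.2 zero_le_one) ((continuous_extIcc _).comp (continuous_const_mul r)).continuousOn
    (fun t ht => ?_) ht
  · rw [h, extIcc_coPropagator_zero, mul_one]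
  · simp only [smul_mul_assoc]
    rw [intervalIntegral.integral_smul,
      intervalIntegral.smul_integral_comp_mul_left (fun t => c t * extIcc (propagator b) t),
      hP.eq_add (r * t) ⟨mul_nonneg hr.1 ht.1, mul_le_one₀ hr.2 ht.1 ht.2⟩,
      extIcc_propagator_zero, intervalIntegral.integral_neg, mul_zero, sub_eq_add_neg]

lemma extIcc_coPropagator_rescale {c : ℝ → R} {b b' : Lp R 1 vol01} {r : ℝ}
    (hr : r ∈ Icc (0 : ℝ) 1) (hb : c =ᵐ[vol01] b) (hb' : (fun t => r • c (r * t)) =ᵐ[vol01] b')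
    {t : ℝ} (ht : t ∈ Icc (0 : ℝ) 1) :
    extIcc (coPropagator b') t = extIcc (coPropagator b) (r * t) := by
  have h := propagator_mul_coPropagator b
    (t := r * t) ⟨mul_nonneg hr.1 ht.1, mul_le_one₀ hr.2 ht.1 ht.2⟩
  rw [← mul_one (extIcc (coPropagator b') t), ← h, ← extIcc_propagator_rescale hr hb hb' ht,
    ← mul_assoc, coPropagator_mul_propagator b' ht, one_mul]

end Rescale

/-! ### Recovering a 1-form from its transported integrals -/

section Current

variable {d N : ℕ} {G : Subgroup (Matrix.unitaryGroup (Fin N) ℂ)} {A : Connection d G}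
  {E : Type} [NormedAddCommGroup E] [NormedSpace ℝ E]
  {path : E → ℝ → Vec d} {T : E →L[ℝ] Lp (Vec d) 1 vol01}

/-- A curve from the origin that arrives at `x` with velocity `w`. -/
def arrival {d : ℕ} (x w : Vec d) (t : ℝ) : Vec d := t • x + (t ^ 2 - t) • (w - x)

lemma contDiff_arrival (x w : Vec d) : ContDiff ℝ ∞ (arrival x w) := by
  unfold arrival
  fun_prop

lemma hasDerivAt_arrival (x w : Vec d) (t : ℝ) :
    HasDerivAt (arrival x w) (x + (2 * t - 1) • (w - x)) t := by
  have h : HasDerivAt (arrival x w) _ t := ((hasDerivAt_id t).smul_const x).add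
    ((((hasDerivAt_id t).pow 2).sub (hasDerivAt_id t)).smul_const (w - x))
  exact h.congr_deriv (by simp)

lemma velocity_eq_of_hasDerivAt {γ δ : ℝ → Vec d} (h : ∀ t ∈ Icc (0 : ℝ) 1, γ t = δ t) {t : ℝ}
    (ht : t ∈ Icc (0 : ℝ) 1) {v : Vec d} (hδ : HasDerivAt δ v t) : velocity γ t = v :=
  (velocity_congr h ht).trans
    (hδ.hasDerivWithinAt.derivWithin (uniqueDiffOn_Icc zero_lt_one t ht))

/-- Testing on `t ↦ γ(rt)`, where `γ` arrives at `x` with velocity `w`, truncates the integral at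
time `r`; the transports rescale accordingly, and differentiation at `r = 1` isolates the end point.
-/
lemma eq_zero_of_integral_eq_zero (hT : IsVelocityMap path T) (hpath : AttainsSmooth path)
    {J : Vec d → Fin d → Matrix (Fin N) (Fin N) ℂ} (hJ : ∀ ν, Continuous fun x => J x ν)
    (h : ∀ σ, ∫ t in (0 : ℝ)..1,
      transport A (path σ) 1 t * along J (path σ) t * transport A (path σ) t 0 = 0)
    (x w : Vec d) : ∑ ν, w ν • J x ν = 0 := by
  set γ := arrival x w with hγ
  set v : ℝ → Vec d := fun t => x + (2 * t - 1) • (w - x) with hv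
  have hs : ∀ r : ℝ, ∃ σ : E, ∀ t ∈ Icc (0 : ℝ) 1, path σ t = γ (r * t) := fun r =>
    hpath (fun t => γ (r * t)) ((contDiff_arrival x w).comp (contDiff_const.mul contDiff_id))
      (by simp [hγ, arrival])
  choose s hs using hs
  set c : (Vec d → Fin d → Matrix (Fin N) (Fin N) ℂ) → ℝ → Matrix (Fin N) (Fin N) ℂ :=
    fun B t => ∑ ν, v t ν • B (γ t) ν with hc
  have halong : ∀ B r, ∀ t ∈ Icc (0 : ℝ) 1, along B (path (s r)) t = r • c B (r * t) := by
    intro B r t ht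
    have hd : HasDerivAt (fun t => γ (r * t)) (r • v (r * t)) t :=
      (hasDerivAt_arrival x w (r * t)).scomp t (by simpa using (hasDerivAt_id t).const_mul r)
    rw [along, velocity_eq_of_hasDerivAt (hs r) ht hd, hs r t ht, hc, Finset.smul_sum]
    simp [smul_smul]
  have hb := fun r => along_ae_eq (A := A) (hT.path_eq (s r)) (hT.velocity_eq (s r))
  set b := fun r => pullback (jet₀ A.smooth) (T (s r)) with hb_def
  have hb1 : c A.form =ᵐ[vol01] b 1 := by
    filter_upwards [hb 1, ae_restrict_mem measurableSet_Icc] with t h1 ht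
    rw [← h1, halong _ _ t ht, one_smul, one_mul]
  have hbr : ∀ r, (fun t => r • c A.form (r * t)) =ᵐ[vol01] b r := fun r => by
    filter_upwards [hb r, ae_restrict_mem measurableSet_Icc] with t h1 ht
    rw [← h1, halong _ _ t ht]
  have I1 : (1 : ℝ) ∈ Icc (0 : ℝ) 1 := right_mem_Icc.2 zero_le_one
  have hcJ : Continuous (c J) := by
    refine continuous_finsetSum _ fun ν _ => ?_
    have h1 : Continuous fun t => v t ν := by
      simp only [hv]
      fun_prop
    exact h1.smul ((hJ ν).comp (contDiff_arrival x w).continuous)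
  -- For each `r` the transport to time `1` along the rescaled curve serves as the invertible factor
  -- `M`; what is left under the integral depends on `r` only through `rt`.
  have hG := apply_one_eq_zero_of_integral (G := fun t => extIcc (coPropagator (b 1)) t * c J t
    * extIcc (propagator (b 1)) t)
    (((continuous_extIcc _).mul hcJ).mul (continuous_extIcc _)) fun r hr =>
      ⟨extIcc (propagator (b r)) 1, extIcc (coPropagator (b r)) 1,
        coPropagator_mul_propagator (b r) I1, ?_⟩
  · have h1 : c J 1 = 0 := by
      -- `Q(1) J P(1) = 0` gives `J = 0` on multiplying by `P(1)` on the left and by `Q(1)` on the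
      -- right.
      have h2 := congrArg (fun M => extIcc (propagator (b 1)) 1 * M
        * extIcc (coPropagator (b 1)) 1) hG
      simp only [mul_zero, zero_mul, mul_assoc, propagator_mul_coPropagator (b 1) I1, mul_one] at h2
      rwa [← mul_assoc, propagator_mul_coPropagator (b 1) I1, one_mul] at h2
    have e1 : v 1 = w := by simp only [hv]; module
    have e2 : γ 1 = x := by simp [hγ, arrival]
    simpa only [hc, e1, e2] using h1
  · rw [← h (s r)]
    refine intervalIntegral.integral_congr fun t ht => ?_
    rw [uIcc_of_le zero_le_one] at ht
    rw [transport_one_left (hb r) ht, transport_zero_right (hb r) ht, halong J r t ht,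
      ← extIcc_propagator_rescale hr hb1 (hbr r) ht,
      ← extIcc_coPropagator_rescale hr hb1 (hbr r) ht]
    simp only [mul_assoc, smul_mul_assoc, mul_smul_comm]
    rfl

end Current

/-! ### The equivalence for a general space of curves -/

section General

variable {d N : ℕ} {G : Subgroup (Matrix.unitaryGroup (Fin N) ℂ)} {A : Connection d G}

lemma continuous_formClm {R : Type} [NormedRing R] [NormedAlgebra ℝ R] {B : Vec d → Fin d → R}
    (hB : ∀ ν, Continuous fun x => B x ν) : Continuous (formClm B) :=
  continuous_finsetSum _ fun ν _ => ((ContinuousLinearMap.smulRightL ℝ (Vec d) R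
    (EuclideanSpace.proj ν)).continuous).comp (hB ν)

lemma minkowski_inv (d : ℕ) : (minkowski d)⁻¹ = minkowski d := by
  refine Matrix.inv_eq_right_inv ?_
  rw [minkowski, Matrix.diagonal_mul_diagonal, ← Matrix.diagonal_one]
  congr 1
  funext μ
  split_ifs <;> norm_num

/-- A diagonal inverse metric is symmetric, as the trace formula requires, and is determined by the
diagonal entries that the sine test reaches. -/
lemma exists_inv_eq_diagonal {g : Matrix (Fin d) (Fin d) ℝ} (hg : g = 1 ∨ g = minkowski d) :
    ∃ v, g⁻¹ = Matrix.diagonal v := by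
  rcases hg with rfl | rfl
  · exact ⟨1, by rw [inv_one]; exact Matrix.diagonal_one.symm⟩
  · exact ⟨_, minkowski_inv d⟩

variable {E : Type} [NormedAddCommGroup E] [NormedSpace ℝ E]
  {path : E → ℝ → Vec d} {T : E →L[ℝ] Lp (Vec d) 1 vol01}

/-- The integral of a difference splits because a continuous 1-form contracted with an integrable
velocity is integrable. -/
lemma integral_conjP_sub {R : Type} [NormedRing R] [NormedAlgebra ℝ R]
    {a : C(Vec d, Vec d →L[ℝ] R)} {B B' : Vec d → Fin d → R} (hB : ∀ ν, Continuous fun x => B x ν)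
    (hB' : ∀ ν, Continuous fun x => B' x ν) (x : Lp (Vec d) 1 vol01) (M : R) :
    ∫ t in (0 : ℝ)..1, M * conjP a x t (formClm (fun y ν => B y ν - B' y ν)
        (extIcc (primitive x) t) (x t))
      = (∫ t in (0 : ℝ)..1, M * conjP a x t (formClm B (extIcc (primitive x) t) (x t)))
        - ∫ t in (0 : ℝ)..1, M * conjP a x t (formClm B' (extIcc (primitive x) t) (x t)) := by
  have hi : ∀ {B : Vec d → Fin d → R}, (∀ ν, Continuous fun x => B x ν) → IntervalIntegrable
      (fun t => M * conjP a x t (formClm B (extIcc (primitive x) t) (x t))) volume 0 1 := fun hB =>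
    (intervalIntegrable_conjP (intervalIntegrable_clm_apply
      ((continuous_formClm hB).comp (continuous_extIcc _)) (intervalIntegrable_coeFn _))).const_mul _
  rw [← intervalIntegral.integral_sub (hi hB) (hi hB')]
  simp only [formClm_apply, smul_sub, Finset.sum_sub_distrib, conjP, mul_sub, sub_mul]

lemma integral_transport_along (hT : IsVelocityMap path T)
    (J : Vec d → Fin d → Matrix (Fin N) (Fin N) ℂ) (σ : E) :
    ∫ t in (0 : ℝ)..1, transport A (path σ) 1 t * along J (path σ) t * transport A (path σ) t 0
      = ∫ t in (0 : ℝ)..1, extIcc (propagator (pullback (jet₀ A.smooth) (T σ))) 1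
        * conjP (jet₀ A.smooth) (T σ) t (formClm J (extIcc (primitive (T σ)) t) (T σ t)) := by
  have hb := along_ae_eq (A := A) (hT.path_eq σ) (hT.velocity_eq σ)
  refine intervalIntegral_congr_vol01 ?_ (right_mem_Icc.2 zero_le_one)
  filter_upwards [hT.velocity_eq σ, ae_restrict_mem measurableSet_Icc] with t h1 ht
  rw [transport_one_left hb ht, transport_zero_right hb ht, along, h1, hT.path_eq σ t ht,
    formClm_apply, conjP]
  simp only [mul_assoc]

/-- The equivalence of the Yang–Mills equations and the equation `D^2_{tr_L^g} U_{1,0} = -∫ U j U` for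
the parallel transport, on a space of absolutely continuous curves that contains the smooth ones. -/
theorem inLevyDomain_and_yangMills_iff (hT : IsVelocityMap path T) (hpath : AttainsSmooth path)
    {g : Matrix (Fin d) (Fin d) ℝ} (hg : g = 1 ∨ g = minkowski d)
    {j : Vec d → Fin d → Matrix (Fin N) (Fin N) ℂ} (hj : ∀ ν, Continuous fun x => j x ν) :
    InLevyDomain g path (fun σ => transport A (path σ) 1 0) ∧
      (YangMills g A j ↔ HasLevyD2 g path (fun σ => transport A (path σ) 1 0)
        fun σ => currentIntegral A j (path σ)) := by
  obtain ⟨v, hv⟩ := exists_inv_eq_diagonal hg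
  have htr := hasLevyTrace_transport (A := A) hT (g := g) (by rw [hv]; exact Matrix.isSymm_diagonal v)
  refine ⟨⟨contDiff_transport hT, fun σ => ⟨_, htr σ⟩⟩, fun hYM => ⟨contDiff_transport hT, ?_⟩,
    fun h => ?_⟩
  · have : divCurvature A g⁻¹ = j := funext fun x => funext fun ν => hYM x ν
    rwa [this] at htr
  · have hdiag : ∀ μ ν, μ ≠ ν → g⁻¹ μ ν = 0 := fun μ ν hne => by
      rw [hv, Matrix.diagonal_apply_ne _ hne]
    have hD := continuous_divCurvature A g⁻¹
    have hJ : ∀ ν, Continuous fun x => divCurvature A g⁻¹ x ν - j x ν := fun ν =>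
      (hD ν).sub (hj ν)
    -- The second derivative has as trace both the integral of the divergence of the curvature and
    -- that of `j`; by uniqueness the integrals agree on every curve.
    have key := eq_zero_of_integral_eq_zero (A := A) hT hpath hJ fun σ => by
      have hu : currentIntegral A (divCurvature A g⁻¹) (path σ) = currentIntegral A j (path σ) :=
        (htr σ).unique hdiag hpath (h.2 σ)
      rw [currentIntegral, currentIntegral, neg_inj] at hu
      rw [integral_transport_along hT, integral_transport_along hT] at hu
      rw [integral_transport_along hT, integral_conjP_sub hD hj, hu, sub_self]
    intro x ν
    have := key x (basisVec ν)
    simp only [PiLp.single_apply, ite_smul, one_smul, zero_smul, Finset.sum_ite_eq',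
      Finset.mem_univ, if_true] at this
    exact sub_eq_zero.1 this

end General

/-! ### The three spaces of curves -/

section Spaces

variable {d : ℕ}

/-- Total mass one gives the inclusions of `L_2` and of bounded functions in `L_1` norm at most `1`.
-/
instance isProbabilityMeasure_vol01 : IsProbabilityMeasure vol01 := ⟨by simp⟩

lemma ae_hasDerivAt_velocity {γ : ℝ → Vec d} (h : AbsolutelyContinuousOnInterval γ 0 1) :
    ∀ᵐ t ∂vol01, HasDerivAt γ (velocity γ t) t := by
  have h2 : ∀ᵐ t ∂vol01, t ≠ 0 := ae_restrict_of_ae (by simp [ae_iff])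
  have h3 : ∀ᵐ t ∂vol01, t ≠ 1 := ae_restrict_of_ae (by simp [ae_iff])
  filter_upwards [ae_differentiableWithinAt h, h2, h3, ae_restrict_mem measurableSet_Icc]
    with t ht h0 h1 hm
  exact ht.hasDerivWithinAt.hasDerivAt
    (Icc_mem_nhds (lt_of_le_of_ne hm.1 h0.symm) (lt_of_le_of_ne hm.2 h1))

lemma W10.path_zero {p : ENNReal} (σ : W10 p d) : σ.path 0 = 0 :=
  (ext_apply σ.1 0).trans σ.2.2.1

/-- The embedding of `W^{1,1}_0` into `L_1` by the velocity, as a continuous linear map. -/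
def W10.embedL (d : ℕ) : W10 1 d →L[ℝ] Lp (Vec d) 1 vol01 :=
  (W10.embed 1 d).mkContinuous 1 fun σ => (one_mul ‖σ‖).ge

/-- An absolutely continuous curve that starts at the origin is the integral of its almost
everywhere derivative. -/
lemma W10.isVelocityMap_embedL : IsVelocityMap W10.path (W10.embedL d) := by
  have hv : ∀ σ : W10 1 d, velocity σ.path =ᵐ[vol01] W10.embedL d σ := fun σ =>
    σ.memLp.coeFn_toLp.symm
  refine ⟨fun σ t ht => ?_, hv⟩
  have hp := isPrimitiveOn_of_absolutelyContinuous zero_le_one σ.ac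
    (integrable_vol01.1 (memLp_one_iff_integrable.1 σ.memLp)) (ae_hasDerivAt_velocity σ.ac)
  rw [hp.eq_add t ht, σ.path_zero, zero_add, extIcc_primitive _ ht]
  exact intervalIntegral_congr_vol01 (hv σ) ht

lemma IsVelocityMap.comp {E F : Type} [NormedAddCommGroup E] [NormedSpace ℝ E]
    [NormedAddCommGroup F] [NormedSpace ℝ F] {pathE : E → ℝ → Vec d} {pathF : F → ℝ → Vec d}
    {T : F →L[ℝ] Lp (Vec d) 1 vol01} (hT : IsVelocityMap pathF T) (L : E →L[ℝ] F)
    (hL : ∀ σ, pathF (L σ) = pathE σ) : IsVelocityMap pathE (T.comp L) where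
  path_eq σ := by rw [← hL]; exact hT.path_eq (L σ)
  velocity_eq σ := by rw [← hL]; exact hT.velocity_eq (L σ)

lemma norm_W10 {p : ENNReal} [Fact (1 ≤ p)] (σ : W10 p d) :
    ‖σ‖ = (eLpNorm (velocity σ.path) p vol01).toReal :=
  Lp.norm_toLp _ σ.memLp

/-- The inclusion of `W^{1,2}_0` in `W^{1,1}_0`. -/
def W10.ofTwo (d : ℕ) : W10 2 d →L[ℝ] W10 1 d :=
  LinearMap.mkContinuous
    { toFun := fun σ => ⟨σ.1, σ.2.1, σ.2.2.1, σ.2.2.2.mono_exponent one_le_two⟩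
      map_add' := fun _ _ => rfl
      map_smul' := fun _ _ => rfl } 1 fun σ => by
    rw [one_mul, norm_W10, norm_W10]
    exact ENNReal.toReal_mono σ.memLp.eLpNorm_ne_top
      (eLpNorm_le_eLpNorm_of_exponent_le one_le_two σ.memLp.1)

lemma C10.ac (σ : C10 d) : AbsolutelyContinuousOnInterval σ.path 0 1 :=
  ContDiffOn.absolutelyContinuousOnInterval (by rw [uIcc_of_le zero_le_one]; exact σ.2.1)

lemma C10.norm_velocity_le (σ : C10 d) {t : ℝ} (ht : t ∈ Icc (0 : ℝ) 1) :
    ‖velocity σ.path t‖ ≤ ‖σ‖ :=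
  (σ.vel.norm_coe_le_norm ⟨t, ht⟩).trans (norm_snd_le (C10.embed d σ))

lemma C10.ae_norm_velocity_le (σ : C10 d) : ∀ᵐ t ∂vol01, ‖velocity σ.path t‖ ≤ ‖σ‖ := by
  filter_upwards [ae_restrict_mem measurableSet_Icc] with t ht using σ.norm_velocity_le ht

lemma C10.memLp_velocity (σ : C10 d) (p : ENNReal) : MemLp (velocity σ.path) p vol01 :=
  MemLp.of_bound ((σ.2.1.continuousOn_derivWithin (uniqueDiffOn_Icc zero_lt_one)
    le_rfl).aestronglyMeasurable measurableSet_Icc) ‖σ‖ σ.ae_norm_velocity_le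

/-- A curve of class `C^1` as an element of `W^{1,p}_0`. -/
def C10.toW (p : ENNReal) (σ : C10 d) : W10 p d := ⟨σ.1, σ.ac, σ.2.2, σ.memLp_velocity p⟩

/-- The inclusion of `C^1_0` in `W^{1,1}_0`. -/
def C10.toWL (d : ℕ) : C10 d →L[ℝ] W10 1 d :=
  LinearMap.mkContinuous
    { toFun := C10.toW 1
      map_add' := fun _ _ => rfl
      map_smul' := fun _ _ => rfl } 1 fun σ => by
    rw [one_mul, norm_W10]
    refine ENNReal.toReal_le_of_le_ofReal (norm_nonneg σ) ?_
    have h := eLpNorm_le_of_ae_bound (p := 1) σ.ae_norm_velocity_le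
    simp only [measure_univ, ENNReal.one_rpow, one_mul] at h
    exact h

lemma C10.attainsSmooth : AttainsSmooth (C10.path (d := d)) := by
  intro γ hγ h0
  set τ : C(unitInterval, Vec d) := ⟨fun t => γ t, hγ.continuous.comp continuous_subtype_val⟩
  have h : ∀ t ∈ Icc (0 : ℝ) 1, ext τ t = γ t := fun t ht => ext_apply τ ⟨t, ht⟩
  exact ⟨⟨τ, ((hγ.of_le (by exact_mod_cast le_top)).contDiffOn).congr h, h0⟩, h⟩

lemma W10.attainsSmooth {p : ENNReal} : AttainsSmooth (W10.path (p := p) (d := d)) := by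
  intro γ hγ h0
  obtain ⟨σ, hσ⟩ := C10.attainsSmooth γ hγ h0
  exact ⟨σ.toW p, hσ⟩

end Spaces

end LevyYM

end

theorem mainTheorem6 {d N : ℕ} (g : Matrix (Fin d) (Fin d) ℝ)
    (hg : g = 1 ∨ g = LevyYM.minkowski d)
    (G : Subgroup (Matrix.unitaryGroup (Fin N) ℂ))
    (hG : IsClosed (G : Set (Matrix.unitaryGroup (Fin N) ℂ)))
    (A : LevyYM.Connection d G)
    (j : LevyYM.Vec d → Fin d → Matrix (Fin N) (Fin N) ℂ)
    (hj : ∀ ν, Continuous fun x => j x ν) :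
    -- curves of class `C^1`
    (LevyYM.InLevyDomain g LevyYM.C10.path
        (fun σ : LevyYM.C10 d => LevyYM.transport A σ.path 1 0) ∧
      (LevyYM.YangMills g A j ↔
        LevyYM.HasLevyD2 g LevyYM.C10.path
          (fun σ : LevyYM.C10 d => LevyYM.transport A σ.path 1 0)
          (fun σ => LevyYM.currentIntegral A j σ.path))) ∧
    -- curves of class `W^{1,1}`
    (LevyYM.InLevyDomain g LevyYM.W10.path
        (fun σ : LevyYM.W10 1 d => LevyYM.transport A σ.path 1 0) ∧
      (LevyYM.YangMills g A j ↔
        LevyYM.HasLevyD2 g LevyYM.W10.path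
          (fun σ : LevyYM.W10 1 d => LevyYM.transport A σ.path 1 0)
          (fun σ => LevyYM.currentIntegral A j σ.path))) ∧
    -- curves of class `W^{1,2}`
    (LevyYM.InLevyDomain g LevyYM.W10.path
        (fun σ : LevyYM.W10 2 d => LevyYM.transport A σ.path 1 0) ∧
      (LevyYM.YangMills g A j ↔
        LevyYM.HasLevyD2 g LevyYM.W10.path
          (fun σ : LevyYM.W10 2 d => LevyYM.transport A σ.path 1 0)
          (fun σ => LevyYM.currentIntegral A j σ.path))) :=
  -- `C^1_0` and `W^{1,2}_0` reach `L_1` through their inclusions in `W^{1,1}_0`; these keep the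
  -- underlying curve, hence `rfl`.
  ⟨LevyYM.inLevyDomain_and_yangMills_iff
      (LevyYM.W10.isVelocityMap_embedL.comp (LevyYM.C10.toWL d) fun _ => rfl)
      LevyYM.C10.attainsSmooth hg hj,
    LevyYM.inLevyDomain_and_yangMills_iff LevyYM.W10.isVelocityMap_embedL
      LevyYM.W10.attainsSmooth hg hj,
    LevyYM.inLevyDomain_and_yangMills_iff
      (LevyYM.W10.isVelocityMap_embedL.comp (LevyYM.W10.ofTwo d) fun _ => rfl)
      LevyYM.W10.attainsSmooth hg hj⟩
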